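/- **Setting.** Let $T>0$, let $S\subset\mathbb R$ be finite, $\lambda_0:S\to[0,\infty)$, and let $\mu_0(u,\cdot)$ be a probability on $S$ for every $u\in S$. On a filtered probability space $(\Omega,(\mathcal F_t),P)$ let $W^1$ be an $(\mathcal F_t)$-Brownian motion and $N(\cdot;u,v)$, $(u,v)\in S\times S$, independent $(\mathcal F_t)$-Poisson processes with rates $\nu(\{(u,v)\})=\lambda_0(u)\mu_0(u,v)$, i.e. a Poisson random measure $N(dt,d\zeta)$ with marks $\zeta\in Z:=S\times S$. Let $K_0(x;(u,v))=\mathbf 1_{\{x=u\}}(v-u)$, and let $b_1(t,x,y)$, $\sigma_1(t,y)>0$, $K_1(t,x,y;\zeta)$ ($x\in S$) be real measurable functions. Assume that the system $$X_t=x_0+\int_0^t\!\int_Z K_0(X_{s^-};\zeta)N(ds,d\zeta),\qquad Y_t=y_0+\int_0^t b_1(s,X_s,Y_s)ds+\int_0^t\sigma_1(s,Y_s)dW^1_s+\int_0^t\!\int_Z K_1(s,X_{s^-},Y_{s^-};\zeta)N(ds,d\zeta)$$ ($x_0\in S$, $y_0\in\mathbb R$) has an adapted càdlàg solution $(X,Y)$,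 $X$ being $S$-valued, which is unique up to indistinguishability on $[0,T]$. Thus $X$ is a pure jump process on $S$. Assume $$E\int_0^T\Big(\int_Z|K_1(t,X_{t^-},Y_{t^-};\zeta)|\nu(d\zeta)+|b_1|+\sigma_1^2+\Big|\frac{b_1}{\sigma_1}\Big|\Big)dt<\infty ,$$ where $b_1,\sigma_1$ are evaluated at $(t,X_t,Y_t)$, and, for every $u\in S$, $\int_0^T\big(b_1(t,u,Y_t)/\sigma_1(t,Y_t)\big)^2dt<\infty$ $P$-a.s. **Filter and reference probability.** Let $\mathcal F^Y_t$ be generated by $Y_s$, $s\le t$, and the null events; let $\pi_t$ be the càdlàg version of the conditional law of $X_t$ given $\mathcal F^Y_t$; for $\rho$ a measure on $S$ and a function $F(t,x,y)$ put $\rho_t(F)=\int F(t,x,Y_t)\rho_t(dx)$ and $\rho_{t^-}(F)=\int F(t,x,Y_{t^-})\rho_{t^-}(dx)$. Assume $E\int_0^T\pi_t(|b_1/\sigma_1|)^2dt<\infty$. Let $m(dt,dz)=\sum_{s:\Delta Y_s\ne0}\delta_{(s,\Delta Y_s)}(dt,dz)$, $\lambda(t,x,y)=\nu(\zeta:K_1(t,x,y;\zeta)\neq0)$,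 and let $\lambda\phi(t,x,y,\cdot)$ be the measure $A\mapsto\nu(\zeta:K_1(t,x,y;\zeta)\in A\setminus\{0\})$ on $\mathbb R$. Let $\eta(t,y,dz)$ be a transition kernel such that $\eta_t:=\eta(t,Y_{t^-},\cdot)$ satisfies $E\int_0^T\eta_t(\mathbb R)dt<\infty$ and is equivalent to $\pi_{t^-}(\lambda\phi)$, namely $\pi_{t^-}(\lambda\phi(dz))=(1+\Psi(t,z))\eta_t(dz)$ with $\Psi>-1$ $\mathcal F^Y$-predictable. Put $$I_t=W^1_t+\int_0^t\Big\{\frac{b_1(s,X_s,Y_s)}{\sigma_1(s,Y_s)}-\pi_s\Big(\frac{b_1}{\sigma_1}\Big)\Big\}ds,\qquad \widetilde W^1_t=I_t+\int_0^t\pi_s\Big(\frac{b_1}{\sigma_1}\Big)ds,$$ let $Z=\mathcal E\big(-\int\pi_s(\tfrac{b_1}{\sigma_1})dI_s\big)\,\mathcal E\big(\int\!\!\int(\tfrac1{1+\Psi(s,z)}-1)(m(ds,dz)-\pi_{s^-}(\lambda\phi(dz))ds)\big)$ ($\mathcal E$ the Doléans-Dade exponential), assume that $Z$ is a $(P,\mathcal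 F^Y_t)$-martingale on $[0,T]$, and let $dP_0=Z_T\,dP$. **Zakai equation.** For $f\in C_b^{1,2}([0,T]\times\mathbb R)$ put $$L^X_0f(t,x,y)=\partial_tf(t,x)+\int_{\{K_1(t,x,y;\zeta)=0\}}[f(t,x+K_0(x;\zeta))-f(t,x)]\nu(d\zeta),$$ $$\overline Lf(t,x,y,A)=\int_{\{K_1(t,x,y;\zeta)\in A\setminus\{0\}\}}[f(t,x+K_0(x;\zeta))-f(t,x)]\nu(d\zeta).$$ A strong solution of the Zakai equation is an $\mathcal F^Y_t$-adapted càdlàg process $\xi$ of finite nonnegative measures on $S$ with $\xi_{t^-}(\lambda\phi)\ll\eta_t$ for a.e. $t\le T$, $P_0$-a.s., with $$\int_0^T\big\{\eta_s(\mathbb R)\,\xi_s(S)+\xi_s(\lambda^0)+\xi_{s}(\lambda(s,\cdot,Y_{s^-}))+\xi_s(|b_1/\sigma_1|)^2\big\}ds<\infty\quad P_0\text{-a.s.},$$ where $\lambda^0(x)=\nu(\zeta:K_0(x;\zeta)\ne0)$, and such that for every $f\in C_b^{1,2}([0,T]\times\mathbb R)$, $P_0$-a.s. for all $t\le T$, $$\xi_t(f)=f(0,x_0)+\int_0^t\{\xi_s(L_0^Xf)-\xi_s(\lambda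 f)+\eta_s(\mathbb R)\xi_s(f)\}ds+\int_0^t\frac{\xi_s(b_1f)}{\sigma_1(s,Y_s)}d\widetilde W^1_s$$ $$\qquad+\int_0^t\!\int_{\mathbb R}\Big\{\frac{d\xi_{s^-}(\lambda\phi f)}{d\eta_s}(z)-\xi_{s^-}(f)+\frac{d\xi_{s^-}(\overline Lf)}{d\eta_s}(z)\Big\}m(ds,dz).$$ **Proposition.** Pathwise uniqueness holds for the Zakai equation: if $\xi$ and $\xi'$ are strong solutions, then $P_0$-a.s. $\xi_t=\xi'_t$ for all $t\in[0,T]$. -/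

import Mathlib

open MeasureTheory ProbabilityTheory Filter Topology
open scoped NNReal ENNReal

noncomputable section

namespace PureJumpFilter

/-! ### General notions for processes indexed by `ℝ≥0` -/

/-- `∫₀ᵗ H s ds` for a function `H` of a time variable in `ℝ≥0`. -/
def timeIntegral (H : ℝ≥0 → ℝ) (t : ℝ≥0) : ℝ :=
  ∫ s in (0 : ℝ)..t, H s.toNNReal

/-- `∫₀ᵗ H s ds ∈ [0, ∞]` for a nonnegative function `H` of a time variable in `ℝ≥0`. -/
def timeLIntegral (H : ℝ≥0 → ℝ≥0∞) (t : ℝ≥0) : ℝ≥0∞ :=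
  ∫⁻ s in Set.Icc (0 : ℝ) t, H s.toNNReal

/-- Right-continuous paths with left limits. -/
def IsCadlag {E : Type*} [TopologicalSpace E] (x : ℝ≥0 → E) : Prop :=
  ∀ t, ContinuousWithinAt x (Set.Ici t) t ∧ ∃ l, Tendsto x (𝓝[<] t) (𝓝 l)

/-- The jump `Δ y s = y s - y (s-)` of a path. -/
def jump (y : ℝ≥0 → ℝ) (s : ℝ≥0) : ℝ := y s - Function.leftLim y s

variable {Ω : Type*} {mΩ : MeasurableSpace Ω}

/-- The σ-algebra generated by the null events. -/
@[reducible] def nullSigma (P : Measure Ω) : MeasurableSpace Ω :=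
  MeasurableSpace.generateFrom {A | MeasurableSet A ∧ P A = 0}

theorem nullSigma_le (P : Measure Ω) : nullSigma P ≤ mΩ :=
  MeasurableSpace.generateFrom_le fun _ h => h.1

/-- The observation filtration `σ(Y s : s ≤ t)`, augmented by the null events. -/
def obsFiltration (P : Measure Ω) (Y : ℝ≥0 → Ω → ℝ) (hY : ∀ t, StronglyMeasurable (Y t)) :
    Filtration ℝ≥0 mΩ :=
  Filtration.natural Y hY ⊔ Filtration.const ℝ≥0 (nullSigma P) (nullSigma_le P)

/-- `W` is a standard Brownian motion relative to the filtration `𝓕`. -/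
structure IsBrownianWrt (P : Measure Ω) (𝓕 : Filtration ℝ≥0 mΩ) (W : ℝ≥0 → Ω → ℝ) : Prop where
  brownian : IsBrownianReal W P
  adapted : ∀ t, Measurable[𝓕 t] (W t)
  indep : ∀ s t, s ≤ t →
    Indep (MeasurableSpace.comap (fun ω => W t ω - W s ω) inferInstance) (𝓕 s) P

/-- `N i`, `i : ι`, are independent Poisson processes with rates `r i` relative to the
filtration `𝓕`; for finite `ι` this is a Poisson random measure on `ℝ₊ × ι` with intensity
`dt ⊗ r`. -/
structure IsPoissonFamily {ι : Type*} (P : Measure Ω) (𝓕 : Filtration ℝ≥0 mΩ)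
    (N : ι → ℝ≥0 → Ω → ℕ) (r : ι → ℝ≥0) : Prop where
  adapted : ∀ i t, Measurable[𝓕 t] (N i t)
  paths : ∀ i, ∀ᵐ ω ∂P, N i 0 ω = 0 ∧ Monotone (fun t => N i t ω) ∧ IsCadlag (fun t => N i t ω)
  law : ∀ i s t, s ≤ t → HasLaw (fun ω => N i t ω - N i s ω) (poissonMeasure (r i * (t - s))) P
  indep : ∀ s t, s ≤ t → iIndepFun (fun i ω => N i t ω - N i s ω) P
  indep_past : ∀ s t, s ≤ t →
    Indep (MeasurableSpace.comap (fun ω i => N i t ω - N i s ω) MeasurableSpace.pi) (𝓕 s) P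

/-- Elementary integrands `∑_{i < n} c i · 1_{(τ i, τ (i+1)]}` with `c i` bounded and
`𝓕 (τ i)`-measurable. -/
structure SimpleIntegrand (𝓕 : Filtration ℝ≥0 mΩ) where
  n : ℕ
  τ : ℕ → ℝ≥0
  mono : Monotone τ
  c : ℕ → Ω → ℝ
  measurable_c : ∀ i, Measurable[𝓕 (τ i)] (c i)
  bounded_c : ∃ C, ∀ i ω, |c i ω| ≤ C

def SimpleIntegrand.value {𝓕 : Filtration ℝ≥0 mΩ} (H : SimpleIntegrand 𝓕) (s : ℝ≥0) (ω : Ω) : ℝ :=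
  ∑ i ∈ Finset.range H.n, (Set.Ioc (H.τ i) (H.τ (i + 1))).indicator (fun _ => H.c i ω) s

def SimpleIntegrand.integral {𝓕 : Filtration ℝ≥0 mΩ} (H : SimpleIntegrand 𝓕) (W : ℝ≥0 → Ω → ℝ)
    (t : ℝ≥0) (ω : Ω) : ℝ :=
  ∑ i ∈ Finset.range H.n, H.c i ω * (W (min (H.τ (i + 1)) t) ω - W (min (H.τ i) t) ω)

/-- `M` is the Itô integral process `∫₀ᵗ H dW`, `t ≤ T`, of the integrand `H` against the Brownian
motion `W` under `Q`: the limit, uniformly on `[0, T]` in probability, of the integrals of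
elementary processes `Hₙ` with `∫₀ᵀ |Hₙ - H|² ds → 0` in probability. -/
def IsItoIntegral (Q : Measure Ω) (𝓖 : Filtration ℝ≥0 mΩ) (T : ℝ≥0)
    (W H M : ℝ≥0 → Ω → ℝ) : Prop :=
  ∃ Hn : ℕ → SimpleIntegrand 𝓖, ∀ ε : ℝ≥0∞, 0 < ε →
    Tendsto (fun n => Q {ω | ε ≤ timeLIntegral
      (fun s => ‖(Hn n).value s ω - H s ω‖ₑ ^ 2) T}) atTop (𝓝 0) ∧
    Tendsto (fun n => Q {ω | ε ≤ ⨆ t ∈ Set.Iic T,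
      ‖(Hn n).integral W t ω - M t ω‖ₑ}) atTop (𝓝 0)

/-- Test functions of class `C_b^{1,2}`: bounded, with bounded continuous derivatives
`∂ₜ f`, `∂ₓ f`, `∂ₓₓ f`. Only the values for times in `[0, T]` are ever used. -/
structure IsTestFunction (f : ℝ → ℝ → ℝ) : Prop where
  differentiable_t : ∀ x, Differentiable ℝ (fun t => f t x)
  differentiable_x : ∀ t, Differentiable ℝ (f t)
  differentiable_xx : ∀ t, Differentiable ℝ (deriv (f t))
  continuous : Continuous (fun p : ℝ × ℝ => f p.1 p.2)
  continuous_t : Continuous (fun p : ℝ × ℝ => deriv (fun t => f t p.2) p.1)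
  continuous_x : Continuous (fun p : ℝ × ℝ => deriv (f p.1) p.2)
  continuous_xx : Continuous (fun p : ℝ × ℝ => deriv (deriv (f p.1)) p.2)
  bounded : ∃ C, ∀ t x, |f t x| ≤ C ∧ |deriv (fun t => f t x) t| ≤ C ∧ |deriv (f t) x| ≤ C ∧
    |deriv (deriv (f t)) x| ≤ C

/-! ### The model -/

/-- The data of the partially observed system: a finite state space `S ⊆ ℝ`, the jump rate `lam0`
and the jump distribution `mu0` of the signal, and the coefficients of the observation. The marks
of the driving Poisson random measure are the pairs `(u, v) ∈ S × S`. -/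
structure Model where
  S : Finset ℝ
  lam0 : S → ℝ≥0
  mu0 : S → S → ℝ≥0
  sum_mu0 : ∀ u, ∑ v, mu0 u v = 1
  b1 : ℝ≥0 → S → ℝ → ℝ
  sigma1 : ℝ≥0 → ℝ → ℝ
  K1 : ℝ≥0 → S → ℝ → S × S → ℝ
  measurable_b1 : ∀ x, Measurable (fun p : ℝ≥0 × ℝ => b1 p.1 x p.2)
  measurable_sigma1 : Measurable (fun p : ℝ≥0 × ℝ => sigma1 p.1 p.2)
  measurable_K1 : ∀ x ζ, Measurable (fun p : ℝ≥0 × ℝ => K1 p.1 x p.2 ζ)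
  sigma1_pos : ∀ t y, 0 < sigma1 t y
  x0 : S
  y0 : ℝ

namespace Model

variable (𝓜 : Model)

/-- The rate `ν({(u, v)}) = λ₀(u) μ₀(u, v)`. -/
def rate (ζ : 𝓜.S × 𝓜.S) : ℝ≥0 := 𝓜.lam0 ζ.1 * 𝓜.mu0 ζ.1 ζ.2

/-- The intensity measure `ν` on the mark space `S × S`. -/
def nu : Measure (𝓜.S × 𝓜.S) := ∑ ζ, 𝓜.rate ζ • Measure.dirac ζ

instance : IsFiniteMeasure 𝓜.nu := by
  unfold nu
  infer_instance

/-- `K₀(x; (u, v)) = 1_{x = u} (v - u)`. -/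
def K0 (x : 𝓜.S) (ζ : 𝓜.S × 𝓜.S) : ℝ := if x = ζ.1 then (ζ.2 : ℝ) - ζ.1 else 0

/-- The marks that make the observation jump. -/
def d1 (t : ℝ≥0) (x : 𝓜.S) (y : ℝ) : Set (𝓜.S × 𝓜.S) := {ζ | 𝓜.K1 t x y ζ ≠ 0}

/-- The jump intensity `λ(t, x, y) = ν(d¹(t, x, y))` of the observation. -/
def lam (t : ℝ≥0) (x : 𝓜.S) (y : ℝ) : ℝ≥0∞ := 𝓜.nu (𝓜.d1 t x y)

/-- The jump intensity `λ⁰(x) = ν(K₀(x; ·) ≠ 0)` of the signal. -/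
def lamX (x : 𝓜.S) : ℝ≥0∞ := 𝓜.nu {ζ | 𝓜.K0 x ζ ≠ 0}

/-- The measure `λ φ(t, x, y, dz)`, i.e. `A ↦ ν(ζ : K₁(t, x, y; ζ) ∈ A \ {0})`. -/
def lamPhi (t : ℝ≥0) (x : 𝓜.S) (y : ℝ) : Measure ℝ :=
  (𝓜.nu.restrict (𝓜.d1 t x y)).map (𝓜.K1 t x y)

instance (t : ℝ≥0) (x : 𝓜.S) (y : ℝ) : IsFiniteMeasure (𝓜.lamPhi t x y) := by
  unfold lamPhi
  infer_instance

/-- The measure `ρ(λ φ)(dz) = ∫ λ φ(t, x, y, dz) ρ(dx)`. -/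
def mixLamPhi (ρ : Measure 𝓜.S) (t : ℝ≥0) (y : ℝ) : Measure ℝ :=
  ∑ x, ρ {x} • 𝓜.lamPhi t x y

/-- The signed measure `ρ(λ φ f)(dz) = ∫ f(t, x) λ φ(t, x, y, dz) ρ(dx)`. -/
def mixLamPhiTest (ρ : Measure 𝓜.S) (f : ℝ → ℝ → ℝ) (t : ℝ≥0) (y : ℝ) : SignedMeasure ℝ :=
  ∑ x : 𝓜.S, (ρ.real {x} * f t x) • (𝓜.lamPhi t x y).toSignedMeasure

/-- The signed measure `L̄ f(t, x, y, A) = ∫_{ζ : K₁ ∈ A \ {0}} [f(t, x + K₀) - f(t, x)] ν(dζ)`,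
which records the common jumps of signal and observation. -/
def Lbar (f : ℝ → ℝ → ℝ) (t : ℝ≥0) (x : 𝓜.S) (y : ℝ) : SignedMeasure ℝ :=
  ((𝓜.nu.restrict (𝓜.d1 t x y)).withDensityᵥ
    (fun ζ => f t (x + 𝓜.K0 x ζ) - f t x)).map (𝓜.K1 t x y)

/-- The signed measure `ρ(L̄ f)(dz)`. -/
def mixLbar (ρ : Measure 𝓜.S) (f : ℝ → ℝ → ℝ) (t : ℝ≥0) (y : ℝ) : SignedMeasure ℝ :=
  ∑ x : 𝓜.S, ρ.real {x} • 𝓜.Lbar f t x y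

/-- `L₀ˣ f = ∂ₜ f + ∫_{K₁ = 0} [f(t, x + K₀) - f(t, x)] ν(dζ)`. -/
def L0 (f : ℝ → ℝ → ℝ) (t : ℝ≥0) (x : 𝓜.S) (y : ℝ) : ℝ :=
  deriv (fun s => f s x) t +
    ∫ ζ in {ζ | 𝓜.K1 t x y ζ = 0}, (f t (x + 𝓜.K0 x ζ) - f t x) ∂𝓜.nu

/-- `(b₁ / σ₁)(t, x, y)`. -/
def ratio (t : ℝ≥0) (x : 𝓜.S) (y : ℝ) : ℝ := 𝓜.b1 t x y / 𝓜.sigma1 t y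

/-- `(X, Y)` solves, on `[0, T]`, the system
`dX = ∫ K₀(X₋; ζ) N(dt, dζ)`,
`dY = b₁(t, X, Y) dt + σ₁(t, Y) dW + ∫ K₁(t, X₋, Y₋; ζ) N(dt, dζ)`, `X₀ = x₀`, `Y₀ = y₀`. -/
structure IsSolution (P : Measure Ω) (𝓕 : Filtration ℝ≥0 mΩ) (T : ℝ≥0) (W : ℝ≥0 → Ω → ℝ)
    (N : 𝓜.S × 𝓜.S → ℝ≥0 → Ω → ℕ) (X : ℝ≥0 → Ω → 𝓜.S) (Y : ℝ≥0 → Ω → ℝ) : Prop where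
  adapted_X : ∀ t, Measurable[𝓕 t] (X t)
  adapted_Y : ∀ t, Measurable[𝓕 t] (Y t)
  cadlag_X : ∀ᵐ ω ∂P, IsCadlag (fun t => X t ω)
  cadlag_Y : ∀ᵐ ω ∂P, IsCadlag (fun t => Y t ω)
  integrable_b1 : ∀ᵐ ω ∂P, timeLIntegral (fun s => ‖𝓜.b1 s (X s ω) (Y s ω)‖ₑ) T < ∞
  equation_X : ∀ᵐ ω ∂P, ∀ t ≤ T, (X t ω : ℝ) = 𝓜.x0 +
    ∑ ζ, ∑ᶠ s ∈ Set.Ioc 0 t,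
      𝓜.K0 (Function.leftLim (fun r => X r ω) s) ζ * jump (fun r => (N ζ r ω : ℝ)) s
  equation_Y : ∃ M : ℝ≥0 → Ω → ℝ,
    IsItoIntegral P 𝓕 T W (fun s ω => 𝓜.sigma1 s (Y s ω)) M ∧
    ∀ᵐ ω ∂P, ∀ t ≤ T, Y t ω = 𝓜.y0 +
      timeIntegral (fun s => 𝓜.b1 s (X s ω) (Y s ω)) t + M t ω +
      ∑ ζ, ∑ᶠ s ∈ Set.Ioc 0 t,
        𝓜.K1 s (Function.leftLim (fun r => X r ω) s) (Function.leftLim (fun r => Y r ω) s) ζ *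
          jump (fun r => (N ζ r ω : ℝ)) s

/-- Integrability of the coefficients along the system. The corresponding conditions on `K₀` and
on the total jump intensity hold automatically because `S` is finite. -/
structure IsIntegrableSystem (P : Measure Ω) (T : ℝ≥0) (X : ℝ≥0 → Ω → 𝓜.S) (Y : ℝ≥0 → Ω → ℝ) :
    Prop where
  K1 : ∫⁻ ω, timeLIntegral (fun s => ∫⁻ ζ, ‖𝓜.K1 s (Function.leftLim (fun r => X r ω) s)
    (Function.leftLim (fun r => Y r ω) s) ζ‖ₑ ∂𝓜.nu) T ∂P < ∞
  b1 : ∫⁻ ω, timeLIntegral (fun s => ‖𝓜.b1 s (X s ω) (Y s ω)‖ₑ) T ∂P < ∞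
  sigma1 : ∫⁻ ω, timeLIntegral (fun s => ‖𝓜.sigma1 s (Y s ω)‖ₑ ^ 2) T ∂P < ∞
  ratio : ∫⁻ ω, timeLIntegral (fun s => ‖𝓜.ratio s (X s ω) (Y s ω)‖ₑ) T ∂P < ∞

/-- `π` is the filter: the càdlàg version of the conditional law of `X t` given the observation
σ-algebra at time `t`. -/
structure IsFilter (P : Measure Ω) (𝓨 : Filtration ℝ≥0 mΩ) (T : ℝ≥0) (X : ℝ≥0 → Ω → 𝓜.S)
    (π : ℝ≥0 → Ω → ProbabilityMeasure 𝓜.S) : Prop where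
  adapted : ∀ t ≤ T, Measurable[𝓨 t] (π t)
  cadlag : ∀ᵐ ω ∂P, IsCadlag (fun t => π t ω)
  condExp : ∀ t ≤ T, ∀ g : 𝓜.S → ℝ,
    (fun ω => ∫ x, g x ∂(π t ω : Measure 𝓜.S)) =ᵐ[P] P[fun ω => g (X t ω) | 𝓨 t]

/-- `π_t(b₁ / σ₁)`. -/
def filteredRatio (Y : ℝ≥0 → Ω → ℝ) (π : ℝ≥0 → Ω → ProbabilityMeasure 𝓜.S)
    (t : ℝ≥0) (ω : Ω) : ℝ :=
  ∫ x, 𝓜.ratio t x (Y t ω) ∂(π t ω : Measure 𝓜.S)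

/-- The measure `π_{t-}(λ φ)(dz)`. -/
def filteredLamPhi (Y : ℝ≥0 → Ω → ℝ) (π : ℝ≥0 → Ω → ProbabilityMeasure 𝓜.S)
    (t : ℝ≥0) (ω : Ω) : Measure ℝ :=
  𝓜.mixLamPhi (Function.leftLim (fun s => π s ω) t : ProbabilityMeasure 𝓜.S) t
    (Function.leftLim (fun s => Y s ω) t)

/-- The innovation process `I_t = W_t + ∫₀ᵗ {b₁(s)/σ₁(s) - π_s(b₁/σ₁)} ds`. -/
def innovation (W : ℝ≥0 → Ω → ℝ) (X : ℝ≥0 → Ω → 𝓜.S) (Y : ℝ≥0 → Ω → ℝ)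
    (π : ℝ≥0 → Ω → ProbabilityMeasure 𝓜.S) (t : ℝ≥0) (ω : Ω) : ℝ :=
  W t ω + timeIntegral (fun s => 𝓜.ratio s (X s ω) (Y s ω) - 𝓜.filteredRatio Y π s ω) t

/-- `W̃_t = I_t + ∫₀ᵗ π_s(b₁/σ₁) ds`. -/
def Wtilde (W : ℝ≥0 → Ω → ℝ) (X : ℝ≥0 → Ω → 𝓜.S) (Y : ℝ≥0 → Ω → ℝ)
    (π : ℝ≥0 → Ω → ProbabilityMeasure 𝓜.S) (t : ℝ≥0) (ω : Ω) : ℝ :=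
  𝓜.innovation W X Y π t ω + timeIntegral (fun s => 𝓜.filteredRatio Y π s ω) t

/-- The transition function `η(t, y, dz)` gives a measure `η_t = η(t, Y_{t-}, ·)` that is
integrable in mean and equivalent to `π_{t-}(λ φ)`, with
`π_{t-}(λ φ)(dz) = (1 + Ψ(t, z)) η_t(dz)` for a predictable `Ψ > -1`. -/
structure IsReference (P : Measure Ω) (𝓨 : Filtration ℝ≥0 mΩ) (T : ℝ≥0) (Y : ℝ≥0 → Ω → ℝ)
    (π : ℝ≥0 → Ω → ProbabilityMeasure 𝓜.S) (η : Kernel (ℝ≥0 × ℝ) ℝ)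
    (Ψ : ℝ≥0 → Ω → ℝ → ℝ) : Prop where
  integrable : ∫⁻ ω, timeLIntegral
    (fun s => η (s, Function.leftLim (fun r => Y r ω) s) Set.univ) T ∂P < ∞
  predictable : Measurable[𝓨.predictable.prod inferInstance]
    (fun p : (ℝ≥0 × Ω) × ℝ => Ψ p.1.1 p.1.2 p.2)
  pos : ∀ᵐ ω ∂P, ∀ t ≤ T, ∀ z, 0 < 1 + Ψ t ω z
  density : ∀ᵐ ω ∂P, ∀ᵐ t ∂(volume.restrict (Set.Icc (0 : ℝ) T)),
    𝓜.filteredLamPhi Y π t.toNNReal ω =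
      (η (t.toNNReal, Function.leftLim (fun r => Y r ω) t.toNNReal)).withDensity
        (fun z => ENNReal.ofReal (1 + Ψ t.toNNReal ω z))

/-- The density process `Z = Z⁰ Z¹`, where `Z⁰` is the Doléans-Dade exponential of
`- ∫ π(b₁/σ₁) dI` and `Z¹` that of `∫∫ (1/(1+Ψ) - 1) (m(ds, dz) - π_{s-}(λ φ)(dz) ds)`, in closed
form. Here `J` stands for the Itô integral `∫ π(b₁/σ₁) dI` and `m` is the jump measure of `Y`. -/
def girsanovDensity (Y : ℝ≥0 → Ω → ℝ) (π : ℝ≥0 → Ω → ProbabilityMeasure 𝓜.S)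
    (Ψ : ℝ≥0 → Ω → ℝ → ℝ) (J : ℝ≥0 → Ω → ℝ) (t : ℝ≥0) (ω : Ω) : ℝ :=
  Real.exp (- J t ω - timeIntegral (fun s => 𝓜.filteredRatio Y π s ω ^ 2) t / 2) *
  (Real.exp (- timeIntegral
      (fun s => ∫ z, ((1 + Ψ s ω z)⁻¹ - 1) ∂(𝓜.filteredLamPhi Y π s ω)) t) *
    ∏ᶠ s ∈ {s | s ∈ Set.Ioc 0 t ∧ jump (fun r => Y r ω) s ≠ 0},
      (1 + ((1 + Ψ s ω (jump (fun r => Y r ω) s))⁻¹ - 1)))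

/-- The reference probability `dP₀ = Z_T dP`; only its restriction to the observation σ-algebra
at time `T` matters. -/
def referenceMeasure (P : Measure Ω) (T : ℝ≥0) (Y : ℝ≥0 → Ω → ℝ)
    (π : ℝ≥0 → Ω → ProbabilityMeasure 𝓜.S) (Ψ : ℝ≥0 → Ω → ℝ → ℝ) (J : ℝ≥0 → Ω → ℝ) :
    Measure Ω :=
  P.withDensity (fun ω => ENNReal.ofReal (𝓜.girsanovDensity Y π Ψ J T ω))

/-! ### The Zakai equation -/

/-- `ξ_t(f) = ∫ f(t, x) ξ_t(dx)`. -/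
def pairing (ρ : Measure 𝓜.S) (f : ℝ → ℝ → ℝ) (t : ℝ≥0) : ℝ := ∫ x : 𝓜.S, f t x ∂ρ

/-- The drift `ξ_t(L₀ˣ f) - ξ_t(λ f) + η_t(ℝ) ξ_t(f)`. -/
def zakaiDrift (Y : ℝ≥0 → Ω → ℝ) (η : Kernel (ℝ≥0 × ℝ) ℝ) (f : ℝ → ℝ → ℝ)
    (ξ : ℝ≥0 → Ω → FiniteMeasure 𝓜.S) (t : ℝ≥0) (ω : Ω) : ℝ :=
  (∫ x, 𝓜.L0 f t x (Y t ω) ∂(ξ t ω : Measure 𝓜.S))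
  - (∫ x, (𝓜.lam t x (Y t ω)).toReal * f t x ∂(ξ t ω : Measure 𝓜.S))
  + (η (t, Function.leftLim (fun r => Y r ω) t)).real Set.univ * 𝓜.pairing (ξ t ω) f t

/-- The diffusion coefficient `ξ_t(b₁ f) / σ₁(t)`. -/
def zakaiDiffusion (Y : ℝ≥0 → Ω → ℝ) (f : ℝ → ℝ → ℝ)
    (ξ : ℝ≥0 → Ω → FiniteMeasure 𝓜.S) (t : ℝ≥0) (ω : Ω) : ℝ :=
  (∫ x, 𝓜.b1 t x (Y t ω) * f t x ∂(ξ t ω : Measure 𝓜.S)) / 𝓜.sigma1 t (Y t ω)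

/-- The jump coefficient
`dξ_{t-}(λ φ f)/dη_t (z) - ξ_{t-}(f) + dξ_{t-}(L̄ f)/dη_t (z)`. -/
def zakaiJump (Y : ℝ≥0 → Ω → ℝ) (η : Kernel (ℝ≥0 × ℝ) ℝ) (f : ℝ → ℝ → ℝ)
    (ξ : ℝ≥0 → Ω → FiniteMeasure 𝓜.S) (t : ℝ≥0) (ω : Ω) (z : ℝ) : ℝ :=
  let ξl : Measure 𝓜.S := (Function.leftLim (fun s => ξ s ω) t : FiniteMeasure 𝓜.S)
  let yl : ℝ := Function.leftLim (fun s => Y s ω) t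
  (𝓜.mixLamPhiTest ξl f t yl).rnDeriv (η (t, yl)) z - 𝓜.pairing ξl f t
    + (𝓜.mixLbar ξl f t yl).rnDeriv (η (t, yl)) z

/-- Strong solutions of the Zakai equation on `[0, T]`. The integral against the jump measure
`m(ds, dz) = ∑_{ΔY_s ≠ 0} δ_{(s, ΔY_s)}` is the sum over the jumps of `Y`. -/
structure IsZakaiSolution (P₀ : Measure Ω) (𝓨 : Filtration ℝ≥0 mΩ) (T : ℝ≥0)
    (Wt : ℝ≥0 → Ω → ℝ) (Y : ℝ≥0 → Ω → ℝ) (η : Kernel (ℝ≥0 × ℝ) ℝ)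
    (ξ : ℝ≥0 → Ω → FiniteMeasure 𝓜.S) : Prop where
  adapted : ∀ t ≤ T, Measurable[𝓨 t] (ξ t)
  cadlag : ∀ᵐ ω ∂P₀, IsCadlag (fun t => ξ t ω)
  absolutelyContinuous : ∀ᵐ ω ∂P₀, ∀ᵐ t ∂(volume.restrict (Set.Icc (0 : ℝ) T)),
    𝓜.mixLamPhi (Function.leftLim (fun s => ξ s ω) t.toNNReal : FiniteMeasure 𝓜.S) t.toNNReal
      (Function.leftLim (fun s => Y s ω) t.toNNReal) ≪
      η (t.toNNReal, Function.leftLim (fun s => Y s ω) t.toNNReal)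
  integrable : ∀ᵐ ω ∂P₀, timeLIntegral (fun s =>
    (∫⁻ x, (η (s, Function.leftLim (fun r => Y r ω) s) Set.univ + 𝓜.lamX x +
        𝓜.lam s x (Function.leftLim (fun r => Y r ω) s)) ∂(ξ s ω : Measure 𝓜.S)) +
      (∫⁻ x, ‖𝓜.ratio s x (Y s ω)‖ₑ ∂(ξ s ω : Measure 𝓜.S)) ^ 2) T < ∞
  equation : ∀ f : ℝ → ℝ → ℝ, IsTestFunction f → ∃ M : ℝ≥0 → Ω → ℝ,
    IsItoIntegral P₀ 𝓨 T Wt (𝓜.zakaiDiffusion Y f ξ) M ∧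
    ∀ᵐ ω ∂P₀, ∀ t ≤ T, 𝓜.pairing (ξ t ω) f t = f 0 𝓜.x0 +
      timeIntegral (fun s => 𝓜.zakaiDrift Y η f ξ s ω) t + M t ω +
      ∑ᶠ s ∈ {s | s ∈ Set.Ioc 0 t ∧ jump (fun r => Y r ω) s ≠ 0},
        𝓜.zakaiJump Y η f ξ s ω (jump (fun r => Y r ω) s)

end Model

end PureJumpFilter

end

/-!
Since `P` is absolutely continuous with respect to the reference probability, one may work under
`P`, where the noise of the Zakai equation is the Brownian motion `W` plus the drift
`∫ b₁/σ₁(s, X_s, Y_s) ds`. Testing the equation with a function that is the indicator of `u` on `S`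
gives equations for the masses `ξ_t({u})`. Between jumps of the Poisson family `Y` does not jump,
and the vector `d` of the differences of the masses of two solutions then solves a finite linear
Itô system whose coefficients are bounded in the clock `η(ℝ) + ∑ᵤ (b₁/σ₁)² + 1`. Started from zero,
`d` stays at zero: by Doob's inequality the second moment of its supremum is at most half of itself
as long as the clock has advanced by less than a small `ε`. At a jump of `Y` the increment of a
solution depends only on its left limit, so `d` does not leave zero there either. Decreasing
families of adapted events take the place of stopping times throughout.
-/

noncomputable section

namespace PureJumpFilter

variable {Ω : Type*} {mΩ : MeasurableSpace Ω} {P : Measure Ω}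

section Doob

variable {𝓖 : Filtration ℕ mΩ}

/-- The pathwise inequality behind Doob's `L²` inequality. -/
lemma sq_partialSups_le (q : ℕ → ℝ) (n : ℕ) :
    partialSups q n ^ 2 ≤
      4 * q n ^ 2 - 4 * ∑ k ∈ Finset.range n, partialSups q k * (q (k + 1) - q k) := by
  have sum_le : ∀ n, ∑ k ∈ Finset.range n, partialSups q k * (q (k + 1) - q k) ≤
      partialSups q n * q n - partialSups q n ^ 2 / 2 := by
    intro n
    induction n with
    | zero => simp only [Finset.range_zero, Finset.sum_empty, partialSups_zero]; nlinarith
    | succ n ih =>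
      rw [Finset.sum_range_succ, partialSups_add_one]
      rcases le_total (partialSups q n) (q (n + 1)) with h | h
      · rw [sup_eq_right.2 h]
        nlinarith [sq_nonneg (partialSups q n - q (n + 1))]
      · rw [sup_eq_left.2 h]
        nlinarith
  nlinarith [sum_le n, sq_nonneg (partialSups q n - 2 * q n)]

lemma integral_mul_eq_integral_mul_condExp {m : MeasurableSpace Ω} (hm : m ≤ mΩ)
    [SigmaFinite (P.trim hm)] {b g : Ω → ℝ} (hb : StronglyMeasurable[m] b)
    (hbg : Integrable (b * g) P) (hg : Integrable g P) :
    ∫ ω, b ω * g ω ∂P = ∫ ω, b ω * P[g | m] ω ∂P :=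
  (integral_condExp hm).symm.trans
    (integral_congr_ae (condExp_mul_of_stronglyMeasurable_left hb hbg hg))

lemma integral_mul_sub_nonneg_of_submartingale [SigmaFiniteFiltration P 𝓖] {X : ℕ → Ω → ℝ}
    (hX : Submartingale X 𝓖 P) {i j : ℕ} (hij : i ≤ j) {b : Ω → ℝ}
    (hb : StronglyMeasurable[𝓖 i] b) (hb0 : 0 ≤ b)
    (hint : Integrable (b * (X j - X i)) P) : 0 ≤ ∫ ω, b ω * (X j - X i) ω ∂P := by
  rw [integral_mul_eq_integral_mul_condExp (𝓖.le i) hb hint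
    ((hX.integrable j).sub (hX.integrable i))]
  refine integral_nonneg_of_ae ?_
  filter_upwards [hX.condExp_sub_nonneg hij] with ω hω using mul_nonneg (hb0 ω) hω

lemma integral_mul_sub_eq_zero_of_martingale [SigmaFiniteFiltration P 𝓖] {M : ℕ → Ω → ℝ}
    (hM : Martingale M 𝓖 P) {i j : ℕ} (hij : i ≤ j) {b : Ω → ℝ}
    (hb : StronglyMeasurable[𝓖 i] b) (hint : Integrable (b * (M j - M i)) P) :
    ∫ ω, b ω * (M j - M i) ω ∂P = 0 := by
  rw [integral_mul_eq_integral_mul_condExp (𝓖.le i) hb hint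
    ((hM.integrable j).sub (hM.integrable i))]
  refine integral_eq_zero_of_ae ?_
  filter_upwards [condExp_sub (hM.integrable j) (hM.integrable i) (𝓖 i),
    hM.condExp_ae_eq hij, hM.condExp_ae_eq (le_refl i)] with ω h hj hi
  simp only [h, Pi.sub_apply, hj, hi, sub_self, mul_zero, Pi.zero_apply]

lemma memLp_partialSups {X : ℕ → Ω → ℝ} {p : ℝ≥0∞} (hX : ∀ n, MemLp (X n) p P) (n : ℕ) :
    MemLp (fun ω => partialSups (fun k => X k ω) n) p P := by
  induction n with
  | zero => simpa only [partialSups_zero] using hX 0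
  | succ n ih =>
    simp only [partialSups_add_one]
    exact ih.sup (hX (n + 1))

lemma stronglyMeasurable_partialSups {X : ℕ → Ω → ℝ} (hX : StronglyAdapted 𝓖 X) (n : ℕ) :
    StronglyMeasurable[𝓖 n] (fun ω => partialSups (fun k => X k ω) n) := by
  induction n with
  | zero => simpa only [partialSups_zero] using hX 0
  | succ n ih =>
    simp only [partialSups_add_one]
    exact ((ih.mono (𝓖.mono n.le_succ)).measurable.sup (hX (n + 1)).measurable).stronglyMeasurable

theorem integral_sq_partialSups_le_of_submartingale [SigmaFiniteFiltration P 𝓖] {X : ℕ → Ω → ℝ}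
    (hX : Submartingale X 𝓖 P) (hX0 : ∀ n, 0 ≤ X n) (hXL : ∀ n, MemLp (X n) 2 P) (n : ℕ) :
    ∫ ω, partialSups (fun k => X k ω) n ^ 2 ∂P ≤ 4 * ∫ ω, X n ω ^ 2 ∂P := by
  set s : ℕ → Ω → ℝ := fun k ω => partialSups (fun k => X k ω) k
  have hs0 : ∀ k, 0 ≤ s k := fun k ω => (hX0 0 ω).trans
    (le_partialSups_of_le (fun k => X k ω) k.zero_le)
  have hint : ∀ k, Integrable (s k * (X (k + 1) - X k)) P := fun k =>
    (memLp_partialSups hXL k).integrable_mul ((hXL (k + 1)).sub (hXL k))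
  have hsum : Integrable (fun ω => ∑ k ∈ Finset.range n, (s k * (X (k + 1) - X k)) ω) P :=
    integrable_finsetSum _ fun k _ => hint k
  calc ∫ ω, s n ω ^ 2 ∂P
      ≤ ∫ ω, (4 * X n ω ^ 2 -
          4 * ∑ k ∈ Finset.range n, (s k * (X (k + 1) - X k)) ω) ∂P :=
        integral_mono (memLp_partialSups hXL n).integrable_sq
          (((hXL n).integrable_sq.const_mul 4).sub (hsum.const_mul 4))
          fun ω => sq_partialSups_le (fun k => X k ω) n
    _ = 4 * ∫ ω, X n ω ^ 2 ∂P -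
          4 * ∑ k ∈ Finset.range n, ∫ ω, (s k * (X (k + 1) - X k)) ω ∂P := by
        rw [integral_sub ((hXL n).integrable_sq.const_mul 4) (hsum.const_mul 4),
          integral_const_mul, integral_const_mul, integral_finsetSum _ fun k _ => hint k]
    _ ≤ 4 * ∫ ω, X n ω ^ 2 ∂P :=
        sub_le_self _ (mul_nonneg zero_le_four (Finset.sum_nonneg fun k _ =>
          integral_mul_sub_nonneg_of_submartingale hX k.le_succ
            (stronglyMeasurable_partialSups hX.stronglyAdapted k) (hs0 k) (hint k)))

theorem integral_sq_partialSups_abs_le_of_martingale [SigmaFiniteFiltration P 𝓖]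
    {M : ℕ → Ω → ℝ} (hM : Martingale M 𝓖 P) (hML : ∀ n, MemLp (M n) 2 P) (n : ℕ) :
    ∫ ω, partialSups (fun k => |M k ω|) n ^ 2 ∂P ≤ 4 * ∫ ω, M n ω ^ 2 ∂P := by
  have h := integral_sq_partialSups_le_of_submartingale (X := fun k ω => |M k ω|)
    (hM.submartingale.sup hM.neg.submartingale) (fun _ _ => abs_nonneg _)
    (fun k => (hML k).norm) n
  simpa only [sq_abs] using h

lemma integral_sq_succ_of_martingale [SigmaFiniteFiltration P 𝓖] {M : ℕ → Ω → ℝ}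
    (hM : Martingale M 𝓖 P) (hML : ∀ n, MemLp (M n) 2 P) (n : ℕ) :
    ∫ ω, M (n + 1) ω ^ 2 ∂P =
      ∫ ω, M n ω ^ 2 ∂P + ∫ ω, (M (n + 1) ω - M n ω) ^ 2 ∂P := by
  have hΔ : MemLp (M (n + 1) - M n) 2 P := (hML (n + 1)).sub (hML n)
  have hcross : Integrable (M n * (M (n + 1) - M n)) P := (hML n).integrable_mul hΔ
  have hexpand : ∀ ω, M (n + 1) ω ^ 2 = M n ω ^ 2 + (M (n + 1) - M n) ω ^ 2 +
      2 * (M n * (M (n + 1) - M n)) ω := fun ω => by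
    simp only [Pi.mul_apply, Pi.sub_apply]; ring
  simp_rw [hexpand]
  rw [integral_add (by exact (hML n).integrable_sq.add hΔ.integrable_sq) (hcross.const_mul 2),
    integral_add (hML n).integrable_sq hΔ.integrable_sq, integral_const_mul]
  have hzero := integral_mul_sub_eq_zero_of_martingale hM n.le_succ
    (hM.stronglyMeasurable n) hcross
  simp only [Pi.mul_apply, Nat.succ_eq_add_one] at hzero ⊢
  rw [hzero, mul_zero, add_zero]
  rfl

lemma martingale_sum_mul_of_indep [IsFiniteMeasure P] {a Z : ℕ → Ω → ℝ}
    (ha : StronglyAdapted 𝓖 a) (hZ : ∀ k, StronglyMeasurable[𝓖 (k + 1)] (Z k))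
    (hZ_indep : ∀ k, Indep (MeasurableSpace.comap (Z k) inferInstance) (𝓖 k) P)
    (hZ_int : ∀ k, Integrable (Z k) P) (hZ_mean : ∀ k, ∫ ω, Z k ω ∂P = 0)
    (haZ : ∀ k, Integrable (a k * Z k) P) :
    Martingale (fun n => ∑ k ∈ Finset.range n, a k * Z k) 𝓖 P := by
  refine martingale_of_condExp_sub_eq_zero_nat (fun n => ?_)
    (fun n => integrable_finsetSum' _ fun k _ => haZ k) fun n => ?_
  · refine Finset.stronglyMeasurable_sum _ fun k hk => ?_
    have hk : k < n := Finset.mem_range.1 hk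
    exact ((ha k).mono (𝓖.mono hk.le)).mul ((hZ k).mono (𝓖.mono hk))
  · have hcond : P[Z n | 𝓖 n] =ᵐ[P] fun _ => ∫ ω, Z n ω ∂P :=
      condExp_indep_eq ((hZ n).mono (𝓖.le _)).measurable.comap_le (𝓖.le n)
        (comap_measurable (Z n)).stronglyMeasurable (hZ_indep n)
    rw [Finset.sum_range_succ, add_sub_cancel_left]
    filter_upwards [condExp_mul_of_stronglyMeasurable_left (ha n) (haZ n) (hZ_int n), hcond]
      with ω hpull hω
    rw [hpull, Pi.mul_apply, hω, hZ_mean, mul_zero, Pi.zero_apply]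

lemma integral_sq_mul_of_indep {m mΩ : MeasurableSpace Ω} {P : Measure Ω} (hm : m ≤ mΩ)
    {b Z : Ω → ℝ} (hb : Measurable[m] b) (hZ : Measurable Z)
    (hZ_indep : Indep (MeasurableSpace.comap Z inferInstance) m P) :
    ∫ ω, (b ω * Z ω) ^ 2 ∂P = (∫ ω, b ω ^ 2 ∂P) * ∫ ω, Z ω ^ 2 ∂P := by
  have hind : IndepFun b Z P :=
    (IndepFun_iff_Indep _ _ _).2 (indep_of_indep_of_le_left hZ_indep.symm hb.comap_le)
  have hsq : IndepFun (fun ω => b ω ^ 2) (fun ω => Z ω ^ 2) P :=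
    hind.comp (measurable_id.pow_const 2) (measurable_id.pow_const 2)
  simp only [mul_pow]
  exact hsq.integral_mul_eq_mul_integral
    ((hb.mono hm le_rfl).pow_const 2).aestronglyMeasurable (hZ.pow_const 2).aestronglyMeasurable

/-- Doob's `L²` inequality combined with the Itô isometry in discrete time. -/
theorem integral_sq_partialSups_abs_sum_mul_le [IsFiniteMeasure P] {a Z : ℕ → Ω → ℝ}
    (ha : StronglyAdapted 𝓖 a) (ha_bdd : ∀ k, ∃ C, ∀ ω, |a k ω| ≤ C)
    (hZ : ∀ k, StronglyMeasurable[𝓖 (k + 1)] (Z k))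
    (hZ_indep : ∀ k, Indep (MeasurableSpace.comap (Z k) inferInstance) (𝓖 k) P)
    (hZ_memLp : ∀ k, MemLp (Z k) 2 P) (hZ_mean : ∀ k, ∫ ω, Z k ω ∂P = 0) (n : ℕ) :
    MemLp (fun ω => partialSups (fun k => |∑ j ∈ Finset.range k, a j ω * Z j ω|) n) 2 P ∧
    ∫ ω, partialSups (fun k => |∑ j ∈ Finset.range k, a j ω * Z j ω|) n ^ 2 ∂P ≤
      4 * ∑ k ∈ Finset.range n, (∫ ω, a k ω ^ 2 ∂P) * ∫ ω, Z k ω ^ 2 ∂P := by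
  have haZ : ∀ k, MemLp (a k * Z k) 2 P := by
    intro k
    obtain ⟨C, hC⟩ := ha_bdd k
    refine (hZ_memLp k).of_le_mul (c := C)
      (((ha k).mono (𝓖.le k)).mul ((hZ k).mono (𝓖.le _))).aestronglyMeasurable
      (ae_of_all _ fun ω => ?_)
    rw [Pi.mul_apply, norm_mul]
    exact mul_le_mul_of_nonneg_right (hC ω) (norm_nonneg _)
  set Q : ℕ → Ω → ℝ := fun n => ∑ k ∈ Finset.range n, a k * Z k with hQ
  have hQ_apply : ∀ n ω, Q n ω = ∑ k ∈ Finset.range n, a k ω * Z k ω := fun n ω => by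
    simp only [hQ, Finset.sum_apply, Pi.mul_apply]
  have hQ_mart : Martingale Q 𝓖 P :=
    martingale_sum_mul_of_indep ha hZ hZ_indep (fun k => (hZ_memLp k).integrable one_le_two)
      hZ_mean fun k => (haZ k).integrable one_le_two
  have hQ_memLp : ∀ n, MemLp (Q n) 2 P := fun n => memLp_finsetSum' _ fun k _ => haZ k
  have isometry : ∀ n, ∫ ω, Q n ω ^ 2 ∂P =
      ∑ k ∈ Finset.range n, (∫ ω, a k ω ^ 2 ∂P) * ∫ ω, Z k ω ^ 2 ∂P := by
    intro n
    induction n with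
    | zero => simp [Q]
    | succ n ih =>
      rw [integral_sq_succ_of_martingale hQ_mart hQ_memLp, ih, Finset.sum_range_succ,
        ← integral_sq_mul_of_indep (𝓖.le n) (ha n).measurable ((hZ n).mono (𝓖.le _)).measurable
          (hZ_indep n)]
      simp only [hQ_apply, Finset.sum_range_succ, add_sub_cancel_left]
  simp only [← hQ_apply, ← isometry]
  exact ⟨memLp_partialSups (fun k => (hQ_memLp k).norm) n,
    integral_sq_partialSups_abs_le_of_martingale hQ_mart hQ_memLp n⟩

end Doob

section Grid

lemma exists_monotone_enumeration {α : Type*} [LinearOrder α] {F : Finset α} (hF : F.Nonempty) :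
    ∃ t : ℕ → α, Monotone t ∧ (∀ k, t k ∈ F) ∧ ∀ x ∈ F, ∃ k ≤ F.card, t k = x := by
  obtain ⟨n, hn⟩ := Nat.exists_eq_add_one.2 hF.card_pos
  refine ⟨fun k => F.orderEmbOfFin hn (Fin.clamp k n), fun i j hij => ?_,
    fun k => F.orderEmbOfFin_mem hn _, fun x hx => ?_⟩
  · refine (F.orderEmbOfFin hn).monotone (Fin.le_def.2 ?_)
    simp only [Fin.coe_clamp]
    omega
  · obtain ⟨i, rfl⟩ : x ∈ Set.range (F.orderEmbOfFin hn) := by rwa [F.range_orderEmbOfFin]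
    exact ⟨i, i.2.le.trans_eq hn.symm, congrArg _ (Fin.ext (by simp only [Fin.coe_clamp]; omega))⟩

lemma le_or_ge_of_monotone {α : Type*} [Preorder α] {t : ℕ → α} (ht : Monotone t) (i k : ℕ) :
    t i ≤ t k ∨ t (k + 1) ≤ t i :=
  (le_or_gt i k).imp (fun h => ht h) fun h => ht h

lemma exists_grid (T : ℝ≥0) (F : Finset ℝ≥0) {δ : ℝ≥0} (hδ : 0 < δ) :
    ∃ (m : ℕ) (t : ℕ → ℝ≥0), Monotone t ∧ t 0 = 0 ∧ (∀ k, t k ≤ T) ∧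
      (∀ x ∈ F, x ≤ T → ∃ k ≤ m, t k = x) ∧ (∀ x ∈ F, ∀ k, x ≤ t k ∨ t (k + 1) ≤ x) ∧
      ∀ k, t (k + 1) ≤ t k + δ := by
  classical
  set R := (Finset.range (⌈T / δ⌉₊ + 2)).image fun i : ℕ => min (i * δ) T
  set G : Finset ℝ≥0 := insert 0 (F.filter (· ≤ T) ∪ R)
  obtain ⟨t, ht, htG, hGt⟩ := exists_monotone_enumeration (F := G) ⟨0, Finset.mem_insert_self ..⟩
  have hF : ∀ x ∈ F, x ≤ T → x ∈ G := fun x hx hxT =>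
    Finset.mem_insert_of_mem (Finset.mem_union_left _ (Finset.mem_filter.2 ⟨hx, hxT⟩))
  have htT : ∀ k, t k ≤ T := by
    intro k
    have hk := htG k
    simp only [G, R, Finset.mem_insert, Finset.mem_union, Finset.mem_filter,
      Finset.mem_image] at hk
    rcases hk with h | h | ⟨i, -, h⟩
    · exact h.trans_le zero_le
    · exact h.2
    · exact h ▸ min_le_right _ _
  have hgap : ∀ x ∈ G, ∀ k, x ≤ t k ∨ t (k + 1) ≤ x := by
    intro x hx k
    obtain ⟨i, -, rfl⟩ := hGt x hx
    exact le_or_ge_of_monotone ht i k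
  refine ⟨G.card, t, ht, ?_, htT, fun x hx hxT => hGt x (hF x hx hxT), fun x hx k => ?_,
    fun k => ?_⟩
  · obtain ⟨i, -, hi⟩ := hGt 0 (Finset.mem_insert_self ..)
    exact le_antisymm (hi ▸ ht i.zero_le) zero_le
  · by_cases hxT : x ≤ T
    · exact hgap x (hF x hx hxT) k
    · exact Or.inr ((htT _).trans (not_le.1 hxT).le)
  · set i := ⌊t k / δ⌋₊
    have hik : i * δ ≤ t k := (le_div_iff₀ hδ).1 (Nat.floor_le zero_le)
    have hki : t k < (i + 1) * δ := (div_lt_iff₀ hδ).1 (Nat.lt_floor_add_one _)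
    have hiT : i ≤ ⌈T / δ⌉₊ :=
      (Nat.floor_mono (by gcongr; exact htT k)).trans (Nat.floor_le_ceil _)
    have hR : min ((i + 1 : ℕ) * δ) T ∈ G := Finset.mem_insert_of_mem
      (Finset.mem_union_right _ (Finset.mem_image.2 ⟨i + 1, Finset.mem_range.2 (by omega), rfl⟩))
    rcases hgap _ hR k with h | h
    · rcases min_le_iff.1 h with h | h
      · exact absurd (by exact_mod_cast h) hki.not_ge
      · exact ((htT _).trans h).trans le_self_add
    · calc t (k + 1) ≤ (i + 1 : ℕ) * δ := h.trans (min_le_left _ _)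
        _ = i * δ + δ := by push_cast; ring
        _ ≤ t k + δ := by gcongr

lemma lintegral_Ioc_add {f : ℝ → ℝ≥0∞} {a b c : ℝ} (hab : a ≤ b) (hbc : b ≤ c) :
    ∫⁻ s in Set.Ioc a c, f s = (∫⁻ s in Set.Ioc a b, f s) + ∫⁻ s in Set.Ioc b c, f s := by
  rw [← Set.Ioc_union_Ioc_eq_Ioc hab hbc,
    lintegral_union measurableSet_Ioc (Set.Ioc_disjoint_Ioc_of_le le_rfl)]

lemma setLIntegral_Ioc_eq_mul_of_eqOn {v : ℝ≥0 → ℝ≥0∞} {c : ℝ≥0∞} {a b : ℝ≥0}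
    (hv : Set.EqOn v (fun _ => c) (Set.Ioc a b)) :
    ∫⁻ s in Set.Ioc (a : ℝ) b, v s.toNNReal = c * ENNReal.ofReal (b - a) := by
  rw [← Real.volume_Ioc, ← setLIntegral_const]
  exact setLIntegral_congr_fun measurableSet_Ioc fun s hs =>
    hv ⟨Real.lt_toNNReal_iff_coe_lt.2 hs.1, Real.toNNReal_le_iff_le_coe.2 hs.2⟩

lemma indicator_mul_add_le_of_eqOn {A : Set ℝ≥0} (hA : IsLowerSet A) {v : ℝ≥0 → ℝ≥0∞}
    {c C : ℝ≥0∞} (hcC : c ≤ C) {a b δ : ℝ≥0} (hab : a ≤ b) (hδ : b ≤ a + δ)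
    (hv : Set.EqOn v (fun _ => c) (Set.Ioc a b)) :
    A.indicator (fun _ => c) a * ENNReal.ofReal (b - a) + A.indicator (fun _ => C * δ) b ≤
      (∫⁻ s in Set.Ioc (a : ℝ) b, A.indicator v s.toNNReal) + A.indicator (fun _ => C * δ) a := by
  by_cases hb : b ∈ A
  · have hvA : Set.EqOn (A.indicator v) (fun _ => c) (Set.Ioc a b) := fun s hs => by
      rw [Set.indicator_of_mem (hA hs.2 hb), hv hs]
    rw [Set.indicator_of_mem hb, Set.indicator_of_mem (hA hab hb), Set.indicator_of_mem (hA hab hb),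
      setLIntegral_Ioc_eq_mul_of_eqOn hvA]
  · rw [Set.indicator_of_notMem hb, add_zero]
    refine le_add_left ?_
    by_cases ha : a ∈ A
    · have hba : ENNReal.ofReal ((b : ℝ) - a) ≤ δ := by
        rw [← ENNReal.ofReal_coe_nnreal]
        exact ENNReal.ofReal_le_ofReal (sub_le_iff_le_add'.2 (by exact_mod_cast hδ))
      simpa only [Set.indicator_of_mem ha] using mul_le_mul' hcC hba
    · simp only [Set.indicator_of_notMem ha, zero_mul, le_refl]

/-- Stopping at the first grid point outside `A` overshoots by at most one cell, whence the error
term `C * δ`. -/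
lemma sum_indicator_grid_le {t : ℕ → ℝ≥0} (ht : Monotone t) {δ : ℝ≥0}
    (hδ : ∀ k, t (k + 1) ≤ t k + δ) {A : Set ℝ≥0} (hA : IsLowerSet A)
    {v : ℝ≥0 → ℝ≥0∞} {C : ℝ≥0∞} (hvC : ∀ s, v s ≤ C)
    (hv : ∀ k, Set.EqOn v (fun _ => v (t (k + 1))) (Set.Ioc (t k) (t (k + 1)))) (m : ℕ) :
    ∑ j ∈ Finset.range m, A.indicator (fun _ => v (t (j + 1))) (t j) *
        ENNReal.ofReal (t (j + 1) - t j) ≤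
      (∫⁻ s in Set.Ioc (0 : ℝ) (t m), A.indicator v s.toNNReal) + C * δ := by
  have h : ∀ m, (∑ j ∈ Finset.range m, A.indicator (fun _ => v (t (j + 1))) (t j) *
        ENNReal.ofReal (t (j + 1) - t j)) + A.indicator (fun _ => C * δ) (t m) ≤
      (∫⁻ s in Set.Ioc (0 : ℝ) (t m), A.indicator v s.toNNReal) + C * δ := by
    intro m
    induction m with
    | zero =>
      simp only [Finset.range_zero, Finset.sum_empty, zero_add]
      exact (Set.indicator_le_self' (fun _ _ => zero_le) _).trans le_add_self
    | succ m ih =>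
      have hcell := indicator_mul_add_le_of_eqOn hA (hvC _) (ht m.le_succ) (hδ m) (hv m)
      rw [Finset.sum_range_succ, lintegral_Ioc_add (t m).2 (NNReal.coe_le_coe.2 (ht m.le_succ)),
        add_assoc, add_right_comm]
      refine (add_le_add_right hcell _).trans ?_
      rw [add_left_comm, add_comm]
      exact add_le_add_left ih _
  exact le_self_add.trans (h m)

end Grid

namespace SimpleIntegrand

variable {𝓗 : Filtration ℝ≥0 mΩ} (H : SimpleIntegrand 𝓗)

lemma exists_bound_value : ∃ C : ℝ≥0, ∀ s ω, |H.value s ω| ≤ C := by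
  obtain ⟨C, hC⟩ := H.bounded_c
  refine ⟨(H.n * |C|).toNNReal, fun s ω => ?_⟩
  rw [Real.coe_toNNReal _ (by positivity)]
  refine (Finset.abs_sum_le_sum_abs _ _).trans
    ((Finset.sum_le_card_nsmul _ _ |C| fun i _ => ?_).trans (by simp))
  rw [← Real.norm_eq_abs]
  exact (norm_indicator_le_norm_self _ _).trans ((hC i ω).trans (le_abs_self C))

/-- The grid `t` contains all partition points of `H` up to the range of `t`. -/
def IsRefinedBy (t : ℕ → ℝ≥0) : Prop :=
  ∀ i ≤ H.n, ∀ k, H.τ i ≤ t k ∨ t (k + 1) ≤ H.τ i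

namespace IsRefinedBy

variable {H} {t : ℕ → ℝ≥0}

lemma mem_Ioc_iff (hHt : H.IsRefinedBy t) {i k : ℕ} (hi : i < H.n) {s : ℝ≥0}
    (hs : s ∈ Set.Ioc (t k) (t (k + 1))) :
    s ∈ Set.Ioc (H.τ i) (H.τ (i + 1)) ↔ H.τ i ≤ t k ∧ t (k + 1) ≤ H.τ (i + 1) :=
  ⟨fun h => ⟨(hHt i hi.le k).resolve_right (h.1.trans_le hs.2).not_ge,
      (hHt (i + 1) hi k).resolve_left (hs.1.trans_le h.2).not_ge⟩,
    fun h => ⟨h.1.trans_lt hs.1, hs.2.trans h.2⟩⟩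

lemma value_eq (hHt : H.IsRefinedBy t) {k : ℕ} {s : ℝ≥0} (hs : s ∈ Set.Ioc (t k) (t (k + 1)))
    (ω : Ω) : H.value s ω = H.value (t (k + 1)) ω := by
  have hk : t (k + 1) ∈ Set.Ioc (t k) (t (k + 1)) := ⟨hs.1.trans_le hs.2, le_rfl⟩
  refine Finset.sum_congr rfl fun i hi => ?_
  simp only [Set.indicator_apply, hHt.mem_Ioc_iff (Finset.mem_range.1 hi) hs,
    hHt.mem_Ioc_iff (Finset.mem_range.1 hi) hk]

lemma measurable_value (hHt : H.IsRefinedBy t) (k : ℕ) :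
    Measurable[𝓗 (t k)] (H.value (t (k + 1))) := by
  refine Finset.measurable_fun_sum _ fun i hi => ?_
  by_cases h : t (k + 1) ∈ Set.Ioc (H.τ i) (H.τ (i + 1))
  · simp only [Set.indicator_of_mem h]
    have hτ : H.τ i ≤ t k := (hHt i (Finset.mem_range.1 hi).le k).resolve_right h.1.not_ge
    exact (H.measurable_c i).mono (𝓗.mono hτ) le_rfl
  · simp only [Set.indicator_of_notMem h]
    exact measurable_const

lemma integral_succ (hHt : H.IsRefinedBy t) (ht : Monotone t) (W : ℝ≥0 → Ω → ℝ) (k : ℕ)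
    (ω : Ω) : H.integral W (t (k + 1)) ω =
      H.integral W (t k) ω + H.value (t (k + 1)) ω * (W (t (k + 1)) ω - W (t k) ω) := by
  rcases (ht k.le_succ).eq_or_lt with heq | hlt
  · rw [← Nat.succ_eq_add_one, ← heq, sub_self, mul_zero, add_zero]
  have hk : t (k + 1) ∈ Set.Ioc (t k) (t (k + 1)) := ⟨hlt, le_rfl⟩
  unfold integral value
  rw [Finset.sum_mul, ← Finset.sum_add_distrib]
  refine Finset.sum_congr rfl fun i hi => ?_
  have hi := Finset.mem_range.1 hi
  have hτ : H.τ i ≤ H.τ (i + 1) := H.mono i.le_succ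
  simp only [Set.indicator_apply, hHt.mem_Ioc_iff hi hk]
  rcases hHt i hi.le k with h1 | h1 <;> rcases hHt (i + 1) hi k with h2 | h2
  · simp only [(h2.trans_lt hlt).not_ge, and_false, if_false, min_eq_left h1, min_eq_left h2,
      min_eq_left (h1.trans hlt.le), min_eq_left (h2.trans hlt.le)]
    ring
  · simp only [h1, h2, and_self, if_true, min_eq_left, min_eq_right,
      h1.trans hlt.le, hlt.le.trans h2]
    ring
  · exact absurd (h1.trans (hτ.trans h2)) hlt.not_ge
  · simp only [(hlt.trans_le h1).not_ge, false_and, if_false, min_eq_right h1, min_eq_right h2,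
      min_eq_right (hlt.le.trans h1), min_eq_right (hlt.le.trans h2)]
    ring

lemma integral_eq_sum (hHt : H.IsRefinedBy t) (ht : Monotone t) (h0 : t 0 = 0)
    (W : ℝ≥0 → Ω → ℝ) (k : ℕ) (ω : Ω) : H.integral W (t k) ω =
      ∑ j ∈ Finset.range k, H.value (t (j + 1)) ω * (W (t (j + 1)) ω - W (t j) ω) := by
  induction k with
  | zero => simp [integral, h0]
  | succ k ih => rw [hHt.integral_succ ht, Finset.sum_range_succ, ih]

end IsRefinedBy

end SimpleIntegrand

section DoobBrownian

lemma enorm_sq_eq_ofReal (x : ℝ) : ‖x‖ₑ ^ 2 = ENNReal.ofReal (x ^ 2) := by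
  rw [← enorm_pow, Real.enorm_eq_ofReal (sq_nonneg x)]

lemma ofReal_integral_sq {f : Ω → ℝ} (hf : MemLp f 2 P) :
    ENNReal.ofReal (∫ ω, f ω ^ 2 ∂P) = ∫⁻ ω, ‖f ω‖ₑ ^ 2 ∂P := by
  simp only [enorm_sq_eq_ofReal]
  exact ofReal_integral_eq_lintegral_ofReal hf.integrable_sq (ae_of_all _ fun ω => sq_nonneg _)

variable {𝓗 : Filtration ℝ≥0 mΩ} {W : ℝ≥0 → Ω → ℝ}

namespace IsBrownianWrt

variable (hW : IsBrownianWrt P 𝓗 W) {s t : ℝ≥0} (hst : s ≤ t)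

include hW

lemma memLp_sub (s t : ℝ≥0) : MemLp (fun ω => W t ω - W s ω) 2 P := by
  have hlaw := hW.brownian.toIsPreBrownianReal.hasLaw_sub t s
  have hid := memLp_id_gaussianReal' (μ := 0) (v := nndist t.1 s.1) 2 (by simp)
  rw [← hlaw.map_eq] at hid
  exact hid.comp_of_map hlaw.aemeasurable

lemma integral_sub_eq_zero (s t : ℝ≥0) : ∫ ω, W t ω - W s ω ∂P = 0 :=
  (hW.brownian.toIsPreBrownianReal.hasLaw_sub t s).integral_eq.trans integral_id_gaussianReal

include hst in
lemma integral_sub_sq : ∫ ω, (W t ω - W s ω) ^ 2 ∂P = t - s := by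
  have hvar := (hW.brownian.toIsPreBrownianReal.hasLaw_sub t s).variance_eq
  rw [variance_id_gaussianReal] at hvar
  have hnn : (nndist t.1 s.1 : ℝ) = t - s := by
    rw [coe_nndist, Real.dist_eq]
    exact abs_of_nonneg (sub_nonneg.2 (NNReal.coe_le_coe.2 hst))
  rw [← hnn, ← hvar]
  exact (variance_of_integral_eq_zero (hW.memLp_sub s t).aemeasurable
    (hW.integral_sub_eq_zero s t)).symm

omit hst in
theorem lintegral_sq_partialSups_le [IsFiniteMeasure P] {t : ℕ → ℝ≥0} (ht : Monotone t)
    {a : ℕ → Ω → ℝ} (ha : ∀ k, Measurable[𝓗 (t k)] (a k)) {C : ℝ} (haC : ∀ k ω, |a k ω| ≤ C)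
    (n : ℕ) :
    ∫⁻ ω, ‖partialSups (fun k =>
      |∑ j ∈ Finset.range k, a j ω * (W (t (j + 1)) ω - W (t j) ω)|) n‖ₑ ^ 2 ∂P ≤
      4 * ∫⁻ ω, ∑ j ∈ Finset.range n, ‖a j ω‖ₑ ^ 2 * ENNReal.ofReal (t (j + 1) - t j) ∂P := by
  have ha' : ∀ k, Measurable (a k) := fun k => (ha k).mono (𝓗.le _) le_rfl
  have haL : ∀ k, MemLp (a k) 2 P := fun k =>
    MemLp.of_bound (ha' k).aestronglyMeasurable C (ae_of_all _ (haC k))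
  have hsub : ∀ k, (0 : ℝ) ≤ t (k + 1) - t k := fun k =>
    sub_nonneg.2 (NNReal.coe_le_coe.2 (ht k.le_succ))
  obtain ⟨hL, hle⟩ := integral_sq_partialSups_abs_sum_mul_le (P := P)
    (𝓖 := ⟨fun k => 𝓗 (t k), fun i j hij => 𝓗.mono (ht hij), fun k => 𝓗.le _⟩) (a := a)
    (Z := fun k ω => W (t (k + 1)) ω - W (t k) ω) (fun k => (ha k).stronglyMeasurable)
    (fun k => ⟨C, haC k⟩)
    (fun k => ((hW.adapted _).sub
      ((hW.adapted _).mono (𝓗.mono (ht k.le_succ)) le_rfl)).stronglyMeasurable)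
    (fun k => hW.indep _ _ (ht k.le_succ)) (fun k => hW.memLp_sub _ _)
    (fun k => hW.integral_sub_eq_zero _ _) n
  rw [← ofReal_integral_sq hL]
  refine (ENNReal.ofReal_le_ofReal hle).trans (le_of_eq ?_)
  rw [ENNReal.ofReal_mul zero_le_four, ENNReal.ofReal_ofNat, lintegral_finsetSum _ fun k _ =>
    ((ha' k).enorm.pow_const 2).mul_const _, ENNReal.ofReal_sum_of_nonneg fun k _ =>
      mul_nonneg (integral_nonneg fun _ => sq_nonneg _) (integral_nonneg fun _ => sq_nonneg _)]
  congr 1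
  refine Finset.sum_congr rfl fun k _ => ?_
  rw [hW.integral_sub_sq (ht k.le_succ), ENNReal.ofReal_mul' (hsub k), ofReal_integral_sq (haL k),
    lintegral_mul_const _ ((ha' k).enorm.pow_const 2)]

end IsBrownianWrt

namespace SimpleIntegrand

variable (H H' : SimpleIntegrand 𝓗) (G : ℝ≥0 → Set Ω) (t : ℕ → ℝ≥0)

/-- The coefficient of `H - H'` on the `j`-th cell of the grid `t`, stopped on leaving the events
`G`. -/
def stoppedDiff (j : ℕ) : Ω → ℝ :=
  (G (t j)).indicator fun ω => H.value (t (j + 1)) ω - H'.value (t (j + 1)) ω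

variable {H H' G t}

lemma measurable_stoppedDiff (hH : H.IsRefinedBy t) (hH' : H'.IsRefinedBy t) {k : ℕ}
    (hG : MeasurableSet[𝓗 (t k)] (G (t k))) :
    Measurable[𝓗 (t k)] (stoppedDiff H H' G t k) :=
  ((hH.measurable_value k).sub (hH'.measurable_value k)).indicator hG

lemma sum_stoppedDiff_mul (hH : H.IsRefinedBy t) (hH' : H'.IsRefinedBy t) (ht : Monotone t)
    (h0 : t 0 = 0) (hG : Antitone G) (W : ℝ≥0 → Ω → ℝ) {k : ℕ} {ω : Ω} (hω : ω ∈ G (t k)) :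
    ∑ j ∈ Finset.range k, stoppedDiff H H' G t j ω * (W (t (j + 1)) ω - W (t j) ω) =
      H.integral W (t k) ω - H'.integral W (t k) ω := by
  rw [hH.integral_eq_sum ht h0, hH'.integral_eq_sum ht h0, ← Finset.sum_sub_distrib]
  refine Finset.sum_congr rfl fun j hj => ?_
  rw [stoppedDiff, Set.indicator_of_mem (hG (ht (Finset.mem_range.1 hj).le) hω), sub_mul]

lemma sum_enorm_stoppedDiff_sq_le (hH : H.IsRefinedBy t) (hH' : H'.IsRefinedBy t)
    (ht : Monotone t) {T δ : ℝ≥0} (htT : ∀ k, t k ≤ T) (hδ : ∀ k, t (k + 1) ≤ t k + δ)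
    (hG : Antitone G) {C : ℝ≥0} (hC : ∀ s ω, |H.value s ω - H'.value s ω| ≤ C) (m : ℕ) (ω : Ω) :
    ∑ j ∈ Finset.range m, ‖stoppedDiff H H' G t j ω‖ₑ ^ 2 * ENNReal.ofReal (t (j + 1) - t j) ≤
      timeLIntegral (fun s => (G s).indicator
        (fun ω => ‖H.value s ω - H'.value s ω‖ₑ ^ 2) ω) T + C ^ 2 * δ := by
  have hle := sum_indicator_grid_le ht hδ (A := {s | ω ∈ G s}) (fun x y hyx hx => hG hyx hx)
    (v := fun s => ‖H.value s ω - H'.value s ω‖ₑ ^ 2) (C := C ^ 2)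
    (fun s => by
      gcongr
      rw [Real.enorm_eq_ofReal_abs, ← ENNReal.ofReal_coe_nnreal]
      exact ENNReal.ofReal_le_ofReal (hC s ω))
    (fun k s hs => by simp only [hH.value_eq hs, hH'.value_eq hs]) m
  calc _ = _ := Finset.sum_congr rfl fun j _ => by
        by_cases hω : ω ∈ G (t j) <;> simp [stoppedDiff, hω]
    _ ≤ _ := hle
    _ ≤ _ := by
        gcongr
        exact lintegral_mono_set (Set.Ioc_subset_Icc_self.trans
          (Set.Icc_subset_Icc_right (NNReal.coe_le_coe.2 (htT m))))

lemma exists_refining_grid (H H' : SimpleIntegrand 𝓗) (T : ℝ≥0) (F : Finset ℝ≥0) {δ : ℝ≥0}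
    (hδ : 0 < δ) : ∃ (m : ℕ) (t : ℕ → ℝ≥0), Monotone t ∧ t 0 = 0 ∧ (∀ k, t k ≤ T) ∧
      (∀ x ∈ F, x ≤ T → ∃ k ≤ m, t k = x) ∧ H.IsRefinedBy t ∧ H'.IsRefinedBy t ∧
      ∀ k, t (k + 1) ≤ t k + δ := by
  classical
  obtain ⟨m, t, ht, h0, htT, hF, hgap, hmesh⟩ := exists_grid T
    (F ∪ (Finset.range (H.n + 1)).image H.τ ∪ (Finset.range (H'.n + 1)).image H'.τ) hδ
  simp only [Finset.mem_union, Finset.mem_image, Finset.mem_range] at hF hgap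
  exact ⟨m, t, ht, h0, htT, fun x hx => hF x (Or.inl (Or.inl hx)),
    fun i hi => hgap _ (Or.inl (Or.inr ⟨i, Nat.lt_succ_of_le hi, rfl⟩)),
    fun i hi => hgap _ (Or.inr ⟨i, Nat.lt_succ_of_le hi, rfl⟩), hmesh⟩

lemma exists_bound_value_sub (H H' : SimpleIntegrand 𝓗) :
    ∃ C : ℝ≥0, 0 < C ∧ ∀ s ω, |H.value s ω - H'.value s ω| ≤ C := by
  obtain ⟨C₁, hC₁⟩ := H.exists_bound_value
  obtain ⟨C₂, hC₂⟩ := H'.exists_bound_value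
  refine ⟨C₁ + C₂ + 1, by positivity, fun s ω => ?_⟩
  push_cast
  linarith [abs_sub (H.value s ω) (H'.value s ω), hC₁ s ω, hC₂ s ω]

/-- Along decreasing adapted events, Doob's inequality needs no stopping times. -/
theorem lintegral_sup_integral_sub_le [IsProbabilityMeasure P] (hW : IsBrownianWrt P 𝓗 W)
    (T : ℝ≥0) (H H' : SimpleIntegrand 𝓗) (hG : ∀ t ≤ T, MeasurableSet[𝓗 t] (G t))
    (hGa : Antitone G) (F : Finset ℝ≥0) (hF : ∀ t ∈ F, t ≤ T) {e : ℝ≥0} (he : 0 < e) :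
    ∫⁻ ω, F.sup (fun t => (G t).indicator
        (fun ω => ‖H.integral W t ω - H'.integral W t ω‖ₑ ^ 2) ω) ∂P ≤
      4 * (∫⁻ ω, timeLIntegral (fun s => (G s).indicator
        (fun ω => ‖H.value s ω - H'.value s ω‖ₑ ^ 2) ω) T ∂P) + e := by
  obtain ⟨C, hC0, hC⟩ := exists_bound_value_sub H H'
  obtain ⟨m, t, ht, h0, htT, hFt, hH, hH', hmesh⟩ :=
    exists_refining_grid H H' T F (δ := e / (4 * C ^ 2)) (by positivity)
  have ha : ∀ k ω, |stoppedDiff H H' G t k ω| ≤ C := fun k ω =>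
    (norm_indicator_le_norm_self (E := ℝ) _ _).trans (hC _ _)
  have hsup : ∀ ω, F.sup (fun t => (G t).indicator
      (fun ω => ‖H.integral W t ω - H'.integral W t ω‖ₑ ^ 2) ω) ≤
      ‖partialSups (fun k => |∑ j ∈ Finset.range k,
        stoppedDiff H H' G t j ω * (W (t (j + 1)) ω - W (t j) ω)|) m‖ₑ ^ 2 := by
    refine fun ω => Finset.sup_le fun x hx => ?_
    obtain ⟨k, hkm, rfl⟩ := hFt x hx (hF x hx)
    by_cases hω : ω ∈ G (t k)
    · rw [Set.indicator_of_mem hω, ← sum_stoppedDiff_mul hH hH' ht h0 hGa W hω]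
      gcongr
      refine enorm_le_iff_norm_le.2 ((le_partialSups_of_le (fun k => |∑ j ∈ Finset.range k,
        stoppedDiff H H' G t j ω * (W (t (j + 1)) ω - W (t j) ω)|) hkm).trans (le_abs_self _))
    · rw [Set.indicator_of_notMem hω]
      exact zero_le
  have hmeshC : (4 : ℝ≥0∞) * (C ^ 2 * (e / (4 * C ^ 2) : ℝ≥0)) = e := by
    have : 4 * (C ^ 2 * (e / (4 * C ^ 2))) = e := by field_simp
    exact_mod_cast this
  refine (lintegral_mono hsup).trans ((hW.lintegral_sq_partialSups_le ht (fun k =>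
    measurable_stoppedDiff hH hH' (hG _ (htT k))) ha m).trans ?_)
  calc _ ≤ 4 * ∫⁻ ω, (timeLIntegral (fun s => (G s).indicator
          (fun ω => ‖H.value s ω - H'.value s ω‖ₑ ^ 2) ω) T +
          C ^ 2 * (e / (4 * C ^ 2) : ℝ≥0)) ∂P := by
        gcongr with ω
        exact sum_enorm_stoppedDiff_sq_le hH hH' ht htT hmesh hGa hC m ω
    _ = _ := by
        rw [lintegral_add_right _ measurable_const, lintegral_const, measure_univ, mul_one,
          mul_add, hmeshC]

end SimpleIntegrand

end DoobBrownian

section MaximalInequality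

/-- Joint measurability on `[0, t] × Ω` with respect to `m`; for `m = 𝓗 t` and all `t` this is
progressive measurability. -/
def MeasurableUpTo {E : Type*} [MeasurableSpace E] (m : MeasurableSpace Ω) (t : ℝ≥0)
    (h : ℝ≥0 → Ω → E) : Prop :=
  Measurable[(inferInstance : MeasurableSpace ℝ≥0).prod m] (fun p : ℝ≥0 × Ω => h (min p.1 t) p.2)

namespace MeasurableUpTo

variable {m : MeasurableSpace Ω} {t : ℝ≥0}

lemma lintegral {h : ℝ≥0 → Ω → ℝ≥0∞} (hh : MeasurableUpTo m t h) (a : ℝ) :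
    Measurable[m] (fun ω => ∫⁻ s in Set.Icc a t, h s.toNNReal ω) := by
  have hmin : ∀ ω, ∫⁻ s in Set.Icc a t, h s.toNNReal ω =
      ∫⁻ s in Set.Icc a t, h (min s.toNNReal t) ω := fun ω =>
    setLIntegral_congr_fun measurableSet_Icc fun s hs => by
      rw [min_eq_left (Real.toNNReal_le_iff_le_coe.2 hs.2)]
  simp only [hmin]
  have hjoint : Measurable[(inferInstance : MeasurableSpace ℝ).prod m]
      (fun p : ℝ × Ω => h (min p.1.toNNReal t) p.2) :=
    hh.comp ((measurable_real_toNNReal.comp (@measurable_fst _ _ _ m)).prodMk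
      (@measurable_snd _ _ _ m))
  exact @Measurable.lintegral_prod_left' _ _ _ m _ _ _ hjoint

lemma aemeasurable_path {E : Type*} [MeasurableSpace E] {h : ℝ≥0 → Ω → E}
    (hh : MeasurableUpTo m t h) (ω : Ω) :
    AEMeasurable (fun s : ℝ => h s.toNNReal ω) (volume.restrict (Set.Icc (0 : ℝ) t)) := by
  have hmin : Measurable (fun s : ℝ => h (min s.toNNReal t) ω) :=
    hh.comp (measurable_real_toNNReal.prodMk (@measurable_const _ _ m _ ω))
  refine ⟨_, hmin, ?_⟩
  filter_upwards [ae_restrict_mem measurableSet_Icc] with s hs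
  rw [min_eq_left (Real.toNNReal_le_iff_le_coe.2 hs.2)]

end MeasurableUpTo

lemma setLIntegral_le_of_ordConnected {f : ℝ → ℝ≥0∞} {A : Set ℝ} (hA : A.OrdConnected) {κ : ℝ≥0∞}
    (h : ∀ a ∈ A, ∀ b ∈ A, a ≤ b → ∫⁻ s in Set.Icc a b, f s ≤ κ) : ∫⁻ s in A, f s ≤ κ := by
  rcases A.eq_empty_or_nonempty with rfl | ⟨x, hx⟩
  · simp only [Measure.restrict_empty, lintegral_zero_measure, zero_le]
  have : A.OrdConnected := hA
  have : Nonempty A := ⟨⟨x, hx⟩⟩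
  obtain ⟨b, hb, hb_top⟩ := exists_seq_monotone_tendsto_atTop_atTop A
  obtain ⟨a, ha, ha_bot⟩ := exists_seq_antitone_tendsto_atTop_atBot A
  have hU : A = ⋃ n, Set.Icc (a n : ℝ) (b n) := by
    refine Set.Subset.antisymm (fun y hy => Set.mem_iUnion.2 ?_)
      (Set.iUnion_subset fun n => hA.out (a n).2 (b n).2)
    exact ((ha_bot.eventually (eventually_le_atBot ⟨y, hy⟩)).and
      (hb_top.eventually (eventually_ge_atTop ⟨y, hy⟩))).exists
  have hmono : Monotone fun n => Set.Icc (a n : ℝ) (b n) := fun i j hij =>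
    Set.Icc_subset_Icc (ha hij) (hb hij)
  rw [← withDensity_apply f hA.measurableSet, hU, hmono.measure_iUnion]
  refine iSup_le fun n => ?_
  rw [withDensity_apply f measurableSet_Icc]
  rcases le_or_gt (a n : ℝ) (b n) with hab | hab
  · exact h _ (a n).2 _ (b n).2 hab
  · simp only [Set.Icc_eq_empty hab.not_ge, Measure.restrict_empty, lintegral_zero_measure, zero_le]

lemma ordConnected_preimage_toNNReal {A : Set ℝ≥0} (hA : IsLowerSet A) :
    (Real.toNNReal ⁻¹' A).OrdConnected :=
  ⟨fun _ _ _ hy _ hz => hA (Real.toNNReal_le_toNNReal hz.2) hy⟩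

lemma timeLIntegral_mono_right (f : ℝ≥0 → ℝ≥0∞) : Monotone (timeLIntegral f) := fun _ _ hst =>
  lintegral_mono_set (Set.Icc_subset_Icc_right (NNReal.coe_le_coe.2 hst))

lemma timeLIntegral_indicator_le {f : ℝ≥0 → ℝ≥0∞} {A : Set ℝ≥0} (hA : IsLowerSet A) {κ : ℝ≥0∞}
    (h : ∀ t ∈ A, timeLIntegral f t ≤ κ) (T : ℝ≥0) : timeLIntegral (A.indicator f) T ≤ κ := by
  have hconn := (ordConnected_preimage_toNNReal hA).inter (Set.ordConnected_Icc (a := 0) (b := ↑T))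
  have hind : (fun s : ℝ => A.indicator f s.toNNReal) =
      (Real.toNNReal ⁻¹' A).indicator fun s => f s.toNNReal := rfl
  rw [timeLIntegral, hind,
    setLIntegral_indicator (ordConnected_preimage_toNNReal hA).measurableSet]
  refine setLIntegral_le_of_ordConnected hconn fun a ha b hb _ => ?_
  refine (lintegral_mono_set (Set.Icc_subset_Icc ha.2.1 (Real.le_coe_toNNReal b))).trans
    (h _ hb.1)

lemma ennreal_add_sq_le (a b : ℝ≥0∞) : (a + b) ^ 2 ≤ 2 * (a ^ 2 + b ^ 2) := by
  rcases eq_or_ne a ∞ with rfl | ha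
  · simp
  rcases eq_or_ne b ∞ with rfl | hb
  · simp
  lift a to ℝ≥0 using ha
  lift b to ℝ≥0 using hb
  exact_mod_cast add_sq_le (a := a) (b := b)

lemma timeLIntegral_indicator_sq_le {v h : ℝ≥0 → ℝ} {T : ℝ≥0} {A B : Set ℝ≥0} (hA : IsLowerSet A)
    (hAB : A ⊆ B) {κ : ℝ≥0∞} (hκ : ∀ t ∈ A, timeLIntegral (fun s => ‖v s - h s‖ₑ ^ 2) t ≤ κ)
    (hm : AEMeasurable (fun s : ℝ => ‖v s.toNNReal - h s.toNNReal‖ₑ ^ 2)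
      (volume.restrict (Set.Icc (0 : ℝ) T))) :
    timeLIntegral (A.indicator fun s => ‖v s‖ₑ ^ 2) T ≤
      2 * timeLIntegral (B.indicator fun s => ‖h s‖ₑ ^ 2) T + 2 * κ := by
  have hpoint : ∀ s, A.indicator (fun s => ‖v s‖ₑ ^ 2) s ≤
      2 * B.indicator (fun s => ‖h s‖ₑ ^ 2) s +
        2 * A.indicator (fun s => ‖v s - h s‖ₑ ^ 2) s := by
    intro s
    by_cases hs : s ∈ A
    · simp only [Set.indicator_of_mem hs, Set.indicator_of_mem (hAB hs), ← mul_add]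
      refine (pow_le_pow_left' ?_ 2).trans (ennreal_add_sq_le _ _)
      simpa only [add_sub_cancel] using enorm_add_le (h s) (v s - h s)
    · simp only [Set.indicator_of_notMem hs, zero_le]
  have hmeas : AEMeasurable (fun s : ℝ => 2 * A.indicator (fun s => ‖v s - h s‖ₑ ^ 2) s.toNNReal)
      (volume.restrict (Set.Icc (0 : ℝ) T)) :=
    (hm.indicator (ordConnected_preimage_toNNReal hA).measurableSet).const_mul 2
  refine (lintegral_mono fun s : ℝ => hpoint s.toNNReal).trans ?_
  rw [lintegral_add_right' _ hmeas, lintegral_const_mul' _ _ ENNReal.ofNat_ne_top,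
    lintegral_const_mul' _ _ ENNReal.ofNat_ne_top]
  gcongr
  · rfl
  · exact timeLIntegral_indicator_le hA hκ T

namespace SimpleIntegrand

variable {𝓗 : Filtration ℝ≥0 mΩ} {W : ℝ≥0 → Ω → ℝ}

lemma measurableUpTo_value (H : SimpleIntegrand 𝓗) (t : ℝ≥0) :
    MeasurableUpTo (𝓗 t) t H.value := by
  refine Finset.measurable_fun_sum _ fun i _ => ?_
  by_cases h : H.τ i ≤ t
  · have hc : Measurable[(inferInstance : MeasurableSpace ℝ≥0).prod (𝓗 t)]
        (fun p : ℝ≥0 × Ω => H.c i p.2) :=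
      ((H.measurable_c i).mono (𝓗.mono h) le_rfl).comp (@measurable_snd _ _ _ (𝓗 t))
    have hcell : MeasurableSet[(inferInstance : MeasurableSpace ℝ≥0).prod (𝓗 t)]
        {p : ℝ≥0 × Ω | min p.1 t ∈ Set.Ioc (H.τ i) (H.τ (i + 1))} :=
      ((@measurable_fst _ _ _ (𝓗 t)).min measurable_const) measurableSet_Ioc
    exact Measurable.indicator (s := {p : ℝ≥0 × Ω | min p.1 t ∈ Set.Ioc (H.τ i) (H.τ (i + 1))})
      hc hcell
  · have hzero : ∀ p : ℝ≥0 × Ω, (Set.Ioc (H.τ i) (H.τ (i + 1))).indicator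
        (fun _ => H.c i p.2) (min p.1 t) = 0 := fun p =>
      Set.indicator_of_notMem (fun hp => h (hp.1.le.trans (min_le_right _ _))) _
    simp only [hzero]
    exact measurable_const

lemma measurable_integral (H : SimpleIntegrand 𝓗) (hW : ∀ t, Measurable (W t)) (t : ℝ≥0) :
    Measurable (H.integral W t) :=
  Finset.measurable_fun_sum _ fun i _ =>
    ((H.measurable_c i).mono (𝓗.le _) le_rfl).mul ((hW _).sub (hW _))

variable (H H' : SimpleIntegrand 𝓗) (h : ℝ≥0 → Ω → ℝ) (G : ℝ≥0 → Set Ω) (κ : ℝ≥0)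

/-- The part of `G t` on which `H - H'` approximates `h` up to `κ` in `L²(0, t)`. -/
def approxEvent (t : ℝ≥0) : Set Ω :=
  G t ∩ {ω | timeLIntegral (fun s => ‖H.value s ω - H'.value s ω - h s ω‖ₑ ^ 2) t ≤ κ}

variable {h G} {T : ℝ≥0}

lemma antitone_approxEvent (hGa : Antitone G) : Antitone (approxEvent H H' h G κ) :=
  fun _ _ hst _ hω => ⟨hGa hst hω.1, (timeLIntegral_mono_right _ hst).trans hω.2⟩

lemma measurableUpTo_error {t : ℝ≥0} (hh : MeasurableUpTo (𝓗 t) t h) :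
    MeasurableUpTo (𝓗 t) t fun s ω => ‖H.value s ω - H'.value s ω - h s ω‖ₑ ^ 2 :=
  (measurable_enorm.comp
    (((H.measurableUpTo_value t).sub (H'.measurableUpTo_value t)).sub hh)).pow_const 2

lemma measurableSet_approxEvent {t : ℝ≥0} (hh : MeasurableUpTo (𝓗 t) t h)
    (hG : MeasurableSet[𝓗 t] (G t)) : MeasurableSet[𝓗 t] (approxEvent H H' h G κ t) :=
  hG.inter (measurableSet_le ((measurableUpTo_error H H' hh).lintegral 0) measurable_const)

lemma lintegral_sup_approxEvent_le [IsProbabilityMeasure P] (hW : IsBrownianWrt P 𝓗 W)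
    (hh : ∀ t ≤ T, MeasurableUpTo (𝓗 t) t h) (hG : ∀ t ≤ T, MeasurableSet[𝓗 t] (G t))
    (hGa : Antitone G) {F : Finset ℝ≥0} (hF : ∀ t ∈ F, t ≤ T) {κ : ℝ≥0} (hκ : 0 < κ) :
    ∫⁻ ω, F.sup (fun t => (approxEvent H H' h G κ t).indicator
        (fun ω => ‖H.integral W t ω - H'.integral W t ω‖ₑ ^ 2) ω) ∂P ≤
      8 * (∫⁻ ω, timeLIntegral (fun s => (G s).indicator (fun ω => ‖h s ω‖ₑ ^ 2) ω) T ∂P) +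
        9 * κ := by
  refine (lintegral_sup_integral_sub_le hW T H H' (fun t ht => measurableSet_approxEvent H H' κ
    (hh t ht) (hG t ht)) (antitone_approxEvent H H' κ hGa) F hF hκ).trans ?_
  have hpath : ∀ ω, timeLIntegral (fun s => (approxEvent H H' h G κ s).indicator
      (fun ω => ‖H.value s ω - H'.value s ω‖ₑ ^ 2) ω) T ≤
      2 * timeLIntegral (fun s => (G s).indicator (fun ω => ‖h s ω‖ₑ ^ 2) ω) T + 2 * κ := fun ω =>
    timeLIntegral_indicator_sq_le (v := fun s => H.value s ω - H'.value s ω) (h := fun s => h s ω)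
      (A := {s | ω ∈ approxEvent H H' h G κ s}) (B := {s | ω ∈ G s})
      (fun _ _ hst hs => antitone_approxEvent H H' κ hGa hst hs) (fun _ hs => hs.1)
      (fun _ hs => hs.2) ((measurableUpTo_error H H' (hh T le_rfl)).aemeasurable_path ω)
  calc _ ≤ 4 * (∫⁻ ω, (2 * timeLIntegral (fun s => (G s).indicator
          (fun ω => ‖h s ω‖ₑ ^ 2) ω) T + 2 * κ) ∂P) + κ := by
        gcongr with ω
        exact hpath ω
    _ = _ := by
        rw [lintegral_add_right _ measurable_const, lintegral_const, measure_univ, mul_one,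
          lintegral_const_mul' _ _ ENNReal.ofNat_ne_top]
        ring

lemma indicator_le_liminf_approxEvent {H H' : ℕ → SimpleIntegrand 𝓗} {ω : Ω}
    (hconv : Tendsto (fun n => timeLIntegral
      (fun s => ‖(H n).value s ω - (H' n).value s ω - h s ω‖ₑ ^ 2) T) atTop (𝓝 0))
    {κ : ℝ≥0} (hκ : 0 < κ) {t : ℝ≥0} (ht : t ≤ T) {M : Ω → ℝ}
    (hM : Tendsto (fun n => (H n).integral W t ω - (H' n).integral W t ω) atTop (𝓝 (M ω))) :
    (G t).indicator (fun ω => ‖M ω‖ₑ ^ 2) ω ≤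
      liminf (fun n => (approxEvent (H n) (H' n) h G κ t).indicator
        (fun ω => ‖(H n).integral W t ω - (H' n).integral W t ω‖ₑ ^ 2) ω) atTop := by
  by_cases hω : ω ∈ G t
  · have hlim : Tendsto (fun n => ‖(H n).integral W t ω - (H' n).integral W t ω‖ₑ ^ 2) atTop
        (𝓝 (‖M ω‖ₑ ^ 2)) := ((ENNReal.continuous_pow 2).tendsto _).comp hM.enorm
    rw [Set.indicator_of_mem hω, ← hlim.liminf_eq]
    refine liminf_le_liminf ?_
    filter_upwards [hconv.eventually (gt_mem_nhds (ENNReal.coe_pos.2 hκ))] with n hn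
    have hmem : ω ∈ approxEvent (H n) (H' n) h G κ t :=
      ⟨hω, (timeLIntegral_mono_right _ ht).trans hn.le⟩
    rw [Set.indicator_of_mem hmem]
  · rw [Set.indicator_of_notMem hω]
    exact zero_le

/-- The integrand is approximated by differences of elementary integrands rather than by
elementary integrands, because a difference of two Itô integrals comes with two approximating
sequences on unrelated partitions. -/
theorem lintegral_iSup_limit_le [IsProbabilityMeasure P] (hW : IsBrownianWrt P 𝓗 W)
    {H H' : ℕ → SimpleIntegrand 𝓗} (hh : ∀ t ≤ T, MeasurableUpTo (𝓗 t) t h)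
    (hconv : ∀ᵐ ω ∂P, Tendsto (fun n => timeLIntegral
      (fun s => ‖(H n).value s ω - (H' n).value s ω - h s ω‖ₑ ^ 2) T) atTop (𝓝 0))
    {Q : Set ℝ≥0} (hQ : Q.Countable) (hQT : ∀ t ∈ Q, t ≤ T) {M : ℝ≥0 → Ω → ℝ}
    (hM : ∀ᵐ ω ∂P, ∀ t ∈ Q, Tendsto (fun n => (H n).integral W t ω - (H' n).integral W t ω) atTop
      (𝓝 (M t ω)))
    (hG : ∀ t ≤ T, MeasurableSet[𝓗 t] (G t)) (hGa : Antitone G) :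
    ∫⁻ ω, ⨆ t ∈ Q, (G t).indicator (fun ω => ‖M t ω‖ₑ ^ 2) ω ∂P ≤
      8 * ∫⁻ ω, timeLIntegral (fun s => (G s).indicator (fun ω => ‖h s ω‖ₑ ^ 2) ω) T ∂P := by
  classical
  rcases Q.eq_empty_or_nonempty with rfl | hne
  · simp
  obtain ⟨q, rfl⟩ := hQ.exists_eq_range hne
  have hqT : ∀ i, q i ≤ T := fun i => hQT _ ⟨i, rfl⟩
  refine ENNReal.le_of_forall_pos_le_add fun ε hε _ => ?_
  set κ : ℝ≥0 := ε / 9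
  have hκ : 0 < κ := by positivity
  set J : ℕ → ℝ≥0 → Ω → ℝ≥0∞ := fun n t => (approxEvent (H n) (H' n) h G κ t).indicator
    fun ω => ‖(H n).integral W t ω - (H' n).integral W t ω‖ₑ ^ 2
  set F : ℕ → Finset ℝ≥0 := fun n => (Finset.range (n + 1)).image q
  have hFT : ∀ n, ∀ t ∈ F n, t ≤ T := fun n t ht => by
    obtain ⟨i, -, rfl⟩ := Finset.mem_image.1 ht
    exact hqT i
  have hWm : ∀ t, Measurable (W t) := fun t => (hW.adapted t).mono (𝓗.le t) le_rfl
  have hmeas : ∀ n, Measurable fun ω => (F n).sup fun t => J n t ω := fun n => by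
    simp only [← Finset.sup_apply]
    exact Finset.sup_induction measurable_const (fun _ hf _ hg => hf.sup hg) fun t ht =>
      ((((H n).measurable_integral hWm t).sub
        ((H' n).measurable_integral hWm t)).enorm.pow_const 2).indicator
        (𝓗.le _ _ (measurableSet_approxEvent _ _ κ (hh t (hFT n t ht)) (hG t (hFT n t ht))))
  have hliminf : ∀ᵐ ω ∂P, ⨆ t ∈ Set.range q, (G t).indicator (fun ω => ‖M t ω‖ₑ ^ 2) ω ≤
      liminf (fun n => (F n).sup fun t => J n t ω) atTop := by
    filter_upwards [hconv, hM] with ω hω hMω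
    refine iSup₂_le fun t ⟨i, hi⟩ => hi ▸ (indicator_le_liminf_approxEvent hω hκ (hqT i)
      (hMω _ ⟨i, rfl⟩)).trans (liminf_le_liminf ?_)
    filter_upwards [eventually_ge_atTop i] with n hn
    exact Finset.le_sup (f := fun t => J n t ω)
      (Finset.mem_image.2 ⟨i, Finset.mem_range.2 (by omega), rfl⟩)
  have hε9 : 9 * (κ : ℝ≥0∞) = ε := by
    have : 9 * κ = ε := by simp only [κ]; field_simp
    exact_mod_cast this
  rw [← hε9]
  exact (lintegral_mono_ae hliminf).trans ((lintegral_liminf_le hmeas).trans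
    (liminf_le_of_frequently_le' (Frequently.of_forall fun n =>
      lintegral_sup_approxEvent_le (H n) (H' n) hW hh hG hGa (hFT n) hκ)))

end SimpleIntegrand

end MaximalInequality

section Tame

variable {E D : Type*} [NormedAddCommGroup E] {Q : Set ℝ≥0} {ε : ℝ≥0∞} {d : ℝ≥0 → E}
  {N : ℝ≥0 → D} {k : ℝ≥0 → ℝ≥0∞} {T : ℝ≥0}

variable (Q ε d N k) in
/-- The path `d` has stayed in the unit ball up to time `t`, and since it left `0` the path `N` has
not moved and the clock `∫ k` has not advanced by more than `ε`. These events, tested along a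
countable set `Q` of times, replace localization by stopping times. -/
def Tame (t : ℝ≥0) : Prop :=
  ∀ q ∈ Q, q ≤ t → ‖d q‖ₑ ≤ 1 ∧
    (d q = 0 ∨ (N q = N t ∧ ∫⁻ s in Set.Icc (q : ℝ) t, k s.toNNReal ≤ ε))

variable (Q ε d N k T) in
/-- The supremum of `‖d‖` over the times in `Q`, up to `T`, at which the path is tame. -/
def tameSup : ℝ≥0∞ :=
  ⨆ t ∈ Q ∩ Set.Iic T, {t | Tame Q ε d N k t}.indicator (fun t => ‖d t‖ₑ) t

lemma tameSup_le_iff {c : ℝ≥0∞} :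
    tameSup Q ε d N k T ≤ c ↔ ∀ t ∈ Q, t ≤ T → Tame Q ε d N k t → ‖d t‖ₑ ≤ c := by
  simp only [tameSup, iSup_le_iff, Set.mem_inter_iff, Set.mem_Iic, and_imp]
  refine forall₃_congr fun t _ _ => ?_
  by_cases h : Tame Q ε d N k t
  · rw [Set.indicator_of_mem (Set.mem_ofPred.2 h)]
    exact (imp_iff_right h).symm
  · rw [Set.indicator_of_notMem (mt Set.mem_ofPred.1 h)]
    exact iff_of_true zero_le fun hn => absurd hn h

lemma Tame.enorm_le_tameSup {t : ℝ≥0} (h : Tame Q ε d N k t) (ht : t ∈ Q) (htT : t ≤ T) :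
    ‖d t‖ₑ ≤ tameSup Q ε d N k T :=
  tameSup_le_iff.1 le_rfl t ht htT h

lemma tameSup_le_one : tameSup Q ε d N k T ≤ 1 :=
  tameSup_le_iff.2 fun t ht _ h => (h t ht le_rfl).1

lemma tameSup_sq_le {c : ℝ≥0∞} (h : ∀ t ∈ Q, t ≤ T → Tame Q ε d N k t → ‖d t‖ₑ ^ 2 ≤ c) :
    tameSup Q ε d N k T ^ 2 ≤ c := by
  simp only [← ENNReal.rpow_two, ← ENNReal.le_rpow_inv_iff two_pos] at h ⊢
  exact tameSup_le_iff.2 h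

lemma exists_mem_Ioo_of_eventually_nhdsGE (hQ : Dense Q) {p : ℝ≥0 → Prop} {r s : ℝ≥0}
    (hp : ∀ᶠ y in 𝓝[≥] r, p y) (hrs : r < s) : ∃ q ∈ Q, r < q ∧ q < s ∧ p q := by
  obtain ⟨c, hc, hcp⟩ := (mem_nhdsGE_iff_exists_Ico_subset' hrs).1 hp
  obtain ⟨q, hq, hrq, hqc⟩ := hQ.exists_between (lt_min hc hrs)
  exact ⟨q, hq, hrq, hqc.trans_le (min_le_right _ _),
    hcp ⟨hrq.le, hqc.trans_le (min_le_left _ _)⟩⟩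

lemma eventually_setLIntegral_Icc_le (hk : timeLIntegral k T < ∞) (hε : 0 < ε) {x : ℝ≥0}
    (hxT : x < T) : ∀ᶠ s : ℝ≥0 in 𝓝[≥] x, ∫⁻ r in Set.Icc (x : ℝ) s, k r.toNNReal ≤ ε := by
  have hvol : Tendsto (fun s : ℝ≥0 => volume.restrict (Set.Icc (0 : ℝ) T) (Set.Icc (x : ℝ) s))
      (𝓝[≥] x) (𝓝 0) := by
    have hcont : Continuous fun s : ℝ≥0 => ENNReal.ofReal ((s : ℝ) - x) :=
      ENNReal.continuous_ofReal.comp (by fun_prop)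
    have hlen := hcont.tendsto x
    simp only [sub_self, ENNReal.ofReal_zero] at hlen
    exact tendsto_of_tendsto_of_tendsto_of_le_of_le tendsto_const_nhds
      (hlen.mono_left nhdsWithin_le_nhds) (fun _ => zero_le) fun s =>
      (Measure.restrict_apply_le _ _).trans Real.volume_Icc.le
  filter_upwards [(tendsto_setLIntegral_zero hk.ne hvol).eventually (gt_mem_nhds hε),
    mem_nhdsWithin_of_mem_nhds (Iic_mem_nhds hxT)] with s hs hsT
  rw [Measure.restrict_restrict measurableSet_Icc,
    Set.inter_eq_left.2 (Set.Icc_subset_Icc x.coe_nonneg (NNReal.coe_le_coe.2 hsT))] at hs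
  exact hs.le

lemma forall_eq_zero_of_forall_exists_gt (hleft : ∀ t ≤ T, (∀ s < t, d s = 0) → d t = 0)
    (hright : ∀ x < T, (∀ s ≤ x, d s = 0) → ∃ y > x, ∀ s, x < s → s < y → d s = 0) :
    ∀ t ≤ T, d t = 0 := by
  set Z : Set ℝ≥0 := {t | ∀ s ≤ t, d s = 0}
  have hmem : ∀ t ≤ T, (∀ s < t, d s = 0) → t ∈ Z := fun t htT ht s hst =>
    hst.lt_or_eq.elim (ht s) fun h => h ▸ hleft t htT ht
  have hclosed : IsClosed (Z ∩ Set.Icc 0 T) := by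
    refine isClosed_of_closure_subset fun x hx => ?_
    have hxT : x ∈ Set.Icc 0 T := closure_minimal Set.inter_subset_right isClosed_Icc hx
    refine ⟨hmem x hxT.2 fun s hsx => ?_, hxT⟩
    obtain ⟨z, hsz, hz, -⟩ := mem_closure_iff.1 hx (Set.Ioi s) isOpen_Ioi hsx
    exact hz s (Set.mem_Ioi.1 hsz).le
  refine hclosed.mem_of_ge_of_forall_exists_gt (hmem 0 zero_le fun s hs => (not_lt_zero hs).elim)
    zero_le fun x ⟨hx, hxT⟩ => ?_
  obtain ⟨y, hxy, hy⟩ := hright x hxT.2 hx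
  refine ⟨min y T, hmem _ (min_le_right _ _) fun s hs => ?_, lt_min hxy hxT.2, min_le_right _ _⟩
  exact (le_or_gt s x).elim (hx s) fun hxs => hy s hxs (hs.trans_le (min_le_left _ _))

lemma eq_zero_of_tame_eq_zero [TopologicalSpace D] [DiscreteTopology D] (hQ : Dense Q) (hε : 0 < ε)
    (hN : ∀ t, ContinuousWithinAt N (Set.Ici t) t) (hd : ∀ t, ContinuousWithinAt d (Set.Ici t) t)
    (hleft : ∀ t ≤ T, (∀ s < t, d s = 0) → d t = 0) (hk : timeLIntegral k T < ∞)
    (htame : ∀ t ∈ Q, t ≤ T → Tame Q ε d N k t → d t = 0) : ∀ t ≤ T, d t = 0 := by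
  refine forall_eq_zero_of_forall_exists_gt hleft fun x hxT hx => ?_
  have hsmall : ∀ᶠ s in 𝓝[≥] x, ‖d s‖ₑ ≤ 1 := by
    have hlim := (hd x).enorm
    simp only [ContinuousWithinAt, hx x le_rfl, enorm_zero] at hlim
    exact (hlim.eventually (gt_mem_nhds one_pos)).mono fun _ => le_of_lt
  have hfrozen : ∀ᶠ s in 𝓝[≥] x, N s = N x := by
    have hlim := (hN x).tendsto
    rwa [nhds_discrete, tendsto_pure] at hlim
  obtain ⟨c, hxc, hc⟩ := (mem_nhdsGE_iff_exists_Ico_subset' hxT).1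
    (hsmall.and (hfrozen.and (eventually_setLIntegral_Icc_le hk hε hxT)))
  have hzero : ∀ q ∈ Q, x < q → q < min c T → d q = 0 := by
    refine fun q hq hxq hqc => htame q hq (hqc.le.trans (min_le_right _ _)) fun p _ hpq => ?_
    rcases le_or_gt p x with hpx | hxp
    · exact ⟨by simp [hx p hpx], Or.inl (hx p hpx)⟩
    · have hqc' : q < c := hqc.trans_le (min_le_left _ _)
      obtain ⟨hp1, hpN, -⟩ := hc ⟨hxp.le, hpq.trans_lt hqc'⟩
      obtain ⟨-, hqN, hqk⟩ := hc ⟨hxq.le, hqc'⟩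
      exact ⟨hp1, Or.inr ⟨hpN.trans hqN.symm,
        (lintegral_mono_set (Set.Icc_subset_Icc_left (NNReal.coe_le_coe.2 hxp.le))).trans hqk⟩⟩
  refine ⟨min c T, lt_min hxc hxT, fun s hxs hs => by_contra fun hds => ?_⟩
  obtain ⟨q, hq, hsq, hqc, hdq⟩ := exists_mem_Ioo_of_eventually_nhdsGE hQ
    ((hd s).eventually_ne hds) hs
  exact hdq (hzero q hq (hxs.trans hsq) hqc)

variable [PartialOrder D]

lemma Tame.anti (hN : Monotone N) {s t : ℝ≥0} (hst : s ≤ t) (h : Tame Q ε d N k t) :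
    Tame Q ε d N k s := fun q hq hqs => by
  obtain ⟨hone, hfrozen⟩ := h q hq (hqs.trans hst)
  refine ⟨hone, hfrozen.imp_right fun ⟨hNq, hclock⟩ => ⟨?_, ?_⟩⟩
  · exact (hN hqs).antisymm ((hN hst).trans hNq.ge)
  · exact (lintegral_mono_set (Set.Icc_subset_Icc_right (NNReal.coe_le_coe.2 hst))).trans hclock

lemma Tame.enorm_le_tameSup_of_lt (hQ : Dense Q) (hN : Monotone N)
    (hd : ∀ t, ContinuousWithinAt d (Set.Ici t) t) {s t : ℝ≥0} (hst : s < t) (htT : t ≤ T)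
    (ht : Tame Q ε d N k t) : ‖d s‖ₑ ≤ tameSup Q ε d N k T := by
  by_contra! hlt
  obtain ⟨q, hq, -, hqt, hltq⟩ := exists_mem_Ioo_of_eventually_nhdsGE hQ
    ((hd s).enorm.eventually (lt_mem_nhds hlt)) hst
  exact hltq.not_ge ((ht.anti hN hqt.le).enorm_le_tameSup hq (hqt.le.trans htT))

lemma Tame.zero_or_const (hQ : Dense Q) (hN : Monotone N)
    (hd : ∀ t, ContinuousWithinAt d (Set.Ici t) t) {t : ℝ≥0} (ht : Tame Q ε d N k t) {s : ℝ≥0}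
    (hst : s ≤ t) : (∀ r < s, d r = 0) ∨ ∃ q < s, N q = N s := by
  refine or_iff_not_imp_left.2 fun h => ?_
  push Not at h
  obtain ⟨r, hrs, hr⟩ := h
  obtain ⟨q, hq, -, hqs, hdq⟩ := exists_mem_Ioo_of_eventually_nhdsGE hQ
    ((hd r).eventually_ne hr) hrs
  have hNq := ((ht q hq (hqs.le.trans hst)).2.resolve_left hdq).1
  exact ⟨q, hqs, (hN hqs.le).antisymm ((hN hst).trans hNq.ge)⟩

lemma lintegral_clock_tame_le (hQ : Dense Q) (hN : Monotone N)
    (hd : ∀ t, ContinuousWithinAt d (Set.Ici t) t) :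
    timeLIntegral ({s | (∃ r < s, d r ≠ 0) ∧ Tame Q ε d N k s}.indicator k) T ≤ ε := by
  set A : Set ℝ≥0 := {s | (∃ r < s, d r ≠ 0) ∧ Tame Q ε d N k s}
  have hA : (Real.toNNReal ⁻¹' A).OrdConnected := by
    refine ⟨fun x hx y hy z hz => ⟨?_, hy.2.anti hN (Real.toNNReal_le_toNNReal hz.2)⟩⟩
    obtain ⟨r, hr, hdr⟩ := hx.1
    exact ⟨r, hr.trans_le (Real.toNNReal_le_toNNReal hz.1), hdr⟩
  have hind : (fun s : ℝ => A.indicator k s.toNNReal) =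
      (Real.toNNReal ⁻¹' A).indicator fun s => k s.toNNReal := rfl
  rw [timeLIntegral, hind, setLIntegral_indicator hA.measurableSet]
  refine setLIntegral_le_of_ordConnected (hA.inter Set.ordConnected_Icc) fun a ha b hb hab => ?_
  obtain ⟨⟨⟨r, hra, hdr⟩, -⟩, -⟩ := ha
  obtain ⟨q, hq, -, hqa, hdq⟩ := exists_mem_Ioo_of_eventually_nhdsGE hQ
    ((hd r).eventually_ne hdr) hra
  obtain ⟨-, hclock⟩ := (hb.1.2 q hq (hqa.le.trans (Real.toNNReal_le_toNNReal hab))).2.resolve_left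
    hdq
  rw [Real.coe_toNNReal _ hb.2.1] at hclock
  exact (lintegral_mono_set (Set.Icc_subset_Icc_left (Real.lt_toNNReal_iff_coe_lt.1 hqa).le)).trans
    hclock

lemma timeLIntegral_tame_le (hQ : Dense Q) (hN : Monotone N)
    (hd : ∀ t, ContinuousWithinAt d (Set.Ici t) t)
    (hleft : ∀ t ≤ T, (∀ s < t, d s = 0) → d t = 0) {p : ℕ} (hp : p ≠ 0) :
    timeLIntegral ({t | Tame Q ε d N k t}.indicator fun s => k s * ‖d s‖ₑ ^ p) T ≤
      ε * tameSup Q ε d N k T ^ p := by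
  set A : Set ℝ≥0 := {s | (∃ r < s, d r ≠ 0) ∧ Tame Q ε d N k s}
  -- Right continuity bounds `d` at every tame time that is not the last one.
  have hlast : ∀ᵐ s ∂(volume : Measure ℝ), ¬(s ∈ {s : ℝ | s ≤ T ∧ Tame Q ε d N k s.toNNReal} ∧
      ∀ t ∈ {s : ℝ | s ≤ T ∧ Tame Q ε d N k s.toNNReal}, t ≤ s) := by
    refine compl_mem_ae_iff.2 (Set.Subsingleton.measure_zero ?_ _)
    exact fun x hx y hy => (hy.2 x hx.1).antisymm (hx.2 y hy.1)
  have hpoint : ∀ᵐ s ∂(volume.restrict (Set.Icc (0 : ℝ) T)),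
      {t | Tame Q ε d N k t}.indicator (fun s => k s * ‖d s‖ₑ ^ p) s.toNNReal ≤
        A.indicator k s.toNNReal * tameSup Q ε d N k T ^ p := by
    filter_upwards [ae_restrict_of_ae hlast, ae_restrict_mem measurableSet_Icc] with s hs hsT
    refine Set.indicator_apply_le' (fun ht => ?_) fun _ => zero_le
    by_cases hzero : ∀ r < s.toNNReal, d r = 0
    · simp [hleft _ (Real.toNNReal_le_iff_le_coe.2 hsT.2) hzero, hp]
    push Not at hzero hs
    obtain ⟨t, ⟨htT, htame⟩, hst⟩ := hs ⟨hsT.2, ht⟩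
    rw [Set.indicator_of_mem (show s.toNNReal ∈ A from ⟨hzero, ht⟩)]
    gcongr
    exact htame.enorm_le_tameSup_of_lt hQ hN hd
      ((Real.toNNReal_lt_toNNReal_iff_of_nonneg hsT.1).2 hst) (Real.toNNReal_le_iff_le_coe.2 htT)
  refine (lintegral_mono_ae hpoint).trans ?_
  rw [lintegral_mul_const' _ _
    (ENNReal.pow_ne_top (tameSup_le_one.trans_lt ENNReal.one_lt_top).ne)]
  gcongr
  exact lintegral_clock_tame_le hQ hN hd

lemma tameSup_sq_le_of_drift (hQ : Dense Q) (hN : Monotone N)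
    (hd : ∀ t, ContinuousWithinAt d (Set.Ici t) t)
    (hleft : ∀ t ≤ T, (∀ s < t, d s = 0) → d t = 0) {M : ℝ≥0 → E} {C : ℝ≥0∞}
    (hdrift : ∀ t ≤ T, (∀ s ≤ t, (∀ r < s, d r = 0) ∨ ∃ q < s, N q = N s) →
      ‖d t - M t‖ₑ ≤ C * timeLIntegral (fun s => k s * ‖d s‖ₑ) t) :
    tameSup Q ε d N k T ^ 2 ≤ 2 * ((C * ε) ^ 2 * tameSup Q ε d N k T ^ 2 +
      ⨆ t ∈ Q ∩ Set.Iic T, {t | Tame Q ε d N k t}.indicator (fun t => ‖M t‖ₑ ^ 2) t) := by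
  set B := ⨆ t ∈ Q ∩ Set.Iic T, {t | Tame Q ε d N k t}.indicator (fun t => ‖M t‖ₑ ^ 2) t
  refine tameSup_sq_le fun t ht htT htame => ?_
  have hclock : timeLIntegral (fun s => k s * ‖d s‖ₑ) t ≤ ε * tameSup Q ε d N k T := by
    refine le_trans ?_ ((timeLIntegral_mono_right _ htT).trans (by
      simpa only [pow_one] using
        timeLIntegral_tame_le hQ hN hd hleft (ε := ε) (k := k) one_ne_zero))
    refine setLIntegral_mono' measurableSet_Icc fun s hs => ?_
    exact (Set.indicator_of_mem (show s.toNNReal ∈ {t | Tame Q ε d N k t} from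
      htame.anti hN (Real.toNNReal_le_iff_le_coe.2 hs.2)) (fun s => k s * ‖d s‖ₑ)).ge
  have hM : ‖M t‖ₑ ^ 2 ≤ B := by
    refine le_trans (le_of_eq ?_) (le_iSup₂ (f := fun t (_ : t ∈ Q ∩ Set.Iic T) =>
      {t | Tame Q ε d N k t}.indicator (fun t => ‖M t‖ₑ ^ 2) t) t ⟨ht, htT⟩)
    exact (Set.indicator_of_mem (Set.mem_ofPred.2 htame) (fun t => ‖M t‖ₑ ^ 2)).symm
  calc ‖d t‖ₑ ^ 2 = ‖(d t - M t) + M t‖ₑ ^ 2 := by rw [sub_add_cancel]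
    _ ≤ (C * (ε * tameSup Q ε d N k T) + ‖M t‖ₑ) ^ 2 := by
      gcongr
      refine (enorm_add_le _ _).trans (add_le_add_left ?_ _)
      refine (hdrift t htT fun s => htame.zero_or_const hQ hN hd).trans ?_
      gcongr
    _ ≤ 2 * ((C * (ε * tameSup Q ε d N k T)) ^ 2 + ‖M t‖ₑ ^ 2) := ennreal_add_sq_le _ _
    _ ≤ 2 * ((C * ε) ^ 2 * tameSup Q ε d N k T ^ 2 + B) := by
      rw [← mul_assoc, mul_pow (C * ε)]
      gcongr

end Tame

lemma measurableUpTo_of_rightContinuous {E : Type*} [TopologicalSpace E]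
    [TopologicalSpace.PseudoMetrizableSpace E] [MeasurableSpace E] [BorelSpace E]
    {m : MeasurableSpace Ω} {t : ℝ≥0} {x : ℝ≥0 → Ω → E} (hx : ∀ s ≤ t, Measurable[m] (x s))
    (hc : ∀ ω s, ContinuousWithinAt (fun s => x s ω) (Set.Ici s) s) : MeasurableUpTo m t x := by
  set g : ℕ → ℝ≥0 → ℝ≥0 := fun n s => (⌈s * (n + 1)⌉₊ : ℝ≥0) / (n + 1)
  have hle : ∀ n s, s ≤ g n s := fun n s => by
    rw [le_div_iff₀ (by positivity)]
    exact Nat.le_ceil _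
  have hge : ∀ n s, g n s ≤ s + 1 / (n + 1) := fun n s => by
    rw [div_le_iff₀ (by positivity), add_mul, one_div, inv_mul_cancel₀ (by positivity)]
    exact (Nat.ceil_lt_add_one zero_le).le
  have hlim : ∀ s, Tendsto (fun n => g n s) atTop (𝓝 s) := fun s => by
    have hupper : Tendsto (fun n : ℕ => s + 1 / ((n : ℝ≥0) + 1)) atTop (𝓝 s) := by
      simpa only [add_zero] using
        tendsto_const_nhds.add (tendsto_one_div_add_atTop_nhds_zero_nat (𝕜 := ℝ≥0))
    exact tendsto_of_tendsto_of_tendsto_of_le_of_le tendsto_const_nhds hupper (fun n => hle n s)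
      fun n => hge n s
  refine measurable_of_tendsto_metrizable (f := fun n (p : ℝ≥0 × Ω) => x (min (g n p.1) t) p.2)
    (fun n => ?_) (tendsto_pi_nhds.2 fun p => ?_)
  · have hgrid : Measurable[(⊤ : MeasurableSpace ℕ).prod m]
        (fun p : ℕ × Ω => x (min ((p.1 : ℝ≥0) / (n + 1)) t) p.2) :=
      measurable_from_prod_countable_right fun j =>
        hx (min ((j : ℝ≥0) / (n + 1)) t) (min_le_right _ _)
    have hceil : Measurable (fun s : ℝ≥0 => ⌈s * (n + 1)⌉₊) :=
      Nat.measurable_ceil.comp (measurable_id.mul_const _)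
    have hnode : Measurable[(inferInstance : MeasurableSpace ℝ≥0).prod m,
        (⊤ : MeasurableSpace ℕ).prod m] (fun p : ℝ≥0 × Ω => (⌈p.1 * (n + 1)⌉₊, p.2)) :=
      (hceil.comp (@measurable_fst _ _ _ m)).prodMk (@measurable_snd _ _ _ m)
    have hcomp := hgrid.comp hnode
    simp only [Function.comp_def] at hcomp
    exact hcomp
  · exact (hc p.2 (min p.1 t)).tendsto.comp (tendsto_nhdsWithin_iff.2
      ⟨(hlim p.1).min tendsto_const_nhds,
        Eventually.of_forall fun n => min_le_min_right _ (hle n p.1)⟩)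

lemma enorm_sq_le_sum {ι : Type*} [Fintype ι] (x : ι → ℝ) : ‖x‖ₑ ^ 2 ≤ ∑ u, ‖x u‖ₑ ^ 2 := by
  simp only [enorm_eq_nnnorm]
  norm_cast
  rw [← NNReal.le_sqrt_iff_sq_le, pi_nnnorm_le_iff]
  exact fun u => NNReal.le_sqrt_iff_sq_le.2
    (Finset.single_le_sum (f := fun v => ‖x v‖₊ ^ 2) (fun _ _ => zero_le) (Finset.mem_univ u))

section LinearIto

/-- A right-continuous process `d`, an increasing right-continuous process `N` and a clock density
`k`, all adapted, such that `d` can leave `0` only continuously. -/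
structure IsRestartingSystem {E D : Type*} [NormedAddCommGroup E] [MeasurableSpace E]
    [PartialOrder D] [TopologicalSpace D] [MeasurableSpace D] (P : Measure Ω)
    (𝓗 : Filtration ℝ≥0 mΩ) (T : ℝ≥0) (d : ℝ≥0 → Ω → E) (N : ℝ≥0 → Ω → D)
    (k : ℝ≥0 → Ω → ℝ≥0∞) : Prop where
  adapted : ∀ t ≤ T, Measurable[𝓗 t] (d t)
  rightContinuous : ∀ ω t, ContinuousWithinAt (fun t => d t ω) (Set.Ici t) t
  adapted_jumps : ∀ t, Measurable[𝓗 t] (N t)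
  monotone_jumps : ∀ ω, Monotone fun t => N t ω
  rightContinuous_jumps : ∀ ω t, ContinuousWithinAt (fun t => N t ω) (Set.Ici t) t
  progressive_clock : ∀ t ≤ T, MeasurableUpTo (𝓗 t) t k
  clock_lt_top : ∀ᵐ ω ∂P, timeLIntegral (fun s => k s ω) T < ∞
  eq_zero_of_left : ∀ᵐ ω ∂P, ∀ t ≤ T, (∀ s < t, d s ω = 0) → d t ω = 0

namespace IsRestartingSystem

variable {E D : Type*} [NormedAddCommGroup E] [MeasurableSpace E] [BorelSpace E] [PartialOrder D]
  [TopologicalSpace D] [MeasurableSpace D] {𝓗 : Filtration ℝ≥0 mΩ} {Q : Set ℝ≥0} {ε : ℝ≥0∞}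
  {d : ℝ≥0 → Ω → E} {N : ℝ≥0 → Ω → D} {k : ℝ≥0 → Ω → ℝ≥0∞} {T : ℝ≥0}

variable (Q ε d N k) in
/-- The event that the path is tame at time `t`. -/
def tameEvent (t : ℝ≥0) : Set Ω :=
  {ω | Tame Q ε (fun s => d s ω) (fun s => N s ω) (fun s => k s ω) t}

variable (Q ε d N k T) in
/-- The random variable given by `tameSup` along each path. -/
def pathTameSup (ω : Ω) : ℝ≥0∞ :=
  tameSup Q ε (fun s => d s ω) (fun s => N s ω) (fun s => k s ω) T

omit [BorelSpace E] in
lemma antitone_tameEvent (h : IsRestartingSystem P 𝓗 T d N k) :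
    Antitone (tameEvent Q ε d N k) := fun s t hst ω hω => by
  have htame : Tame Q ε (fun s => d s ω) (fun s => N s ω) (fun s => k s ω) t := hω
  exact Set.mem_ofPred.2 (htame.anti (h.monotone_jumps ω) hst)

lemma measurableUpTo (h : IsRestartingSystem P 𝓗 T d N k) {t : ℝ≥0} (ht : t ≤ T) :
    MeasurableUpTo (𝓗 t) t d :=
  measurableUpTo_of_rightContinuous
    (fun s hs => (h.adapted s (hs.trans ht)).mono (𝓗.mono hs) le_rfl) h.rightContinuous

lemma measurableSet_tameEvent [MeasurableEq D]
    (h : IsRestartingSystem P 𝓗 T d N k) (hQ : Q.Countable) {t : ℝ≥0} (ht : t ≤ T) :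
    MeasurableSet[𝓗 t] (tameEvent Q ε d N k t) := by
  have hinter : tameEvent Q ε d N k t = ⋂ q ∈ Q, ⋂ (_ : q ≤ t), ({ω | ‖d q ω‖ₑ ≤ 1} ∩
      ({ω | d q ω = 0} ∪ ({ω | N q ω = N t ω} ∩
        {ω | ∫⁻ s in Set.Icc (q : ℝ) t, k s.toNNReal ω ≤ ε}))) := by
    ext ω
    simp only [tameEvent, Tame, Set.mem_ofPred_eq, Set.mem_iInter, Set.mem_inter_iff,
      Set.mem_union]
  rw [hinter]
  refine MeasurableSet.biInter hQ fun q _ => MeasurableSet.iInter fun hqt => ?_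
  have hdq : Measurable[𝓗 t] (d q) := (h.adapted q (hqt.trans ht)).mono (𝓗.mono hqt) le_rfl
  have hNq : Measurable[𝓗 t] (N q) := (h.adapted_jumps q).mono (𝓗.mono hqt) le_rfl
  exact (measurable_enorm.comp hdq measurableSet_Iic).inter ((hdq (measurableSet_singleton 0)).union
    ((measurableSet_eq_fun hNq (h.adapted_jumps t)).inter
      ((h.progressive_clock t ht).lintegral q measurableSet_Iic)))

lemma measurable_pathTameSup [MeasurableEq D]
    (h : IsRestartingSystem P 𝓗 T d N k) (hQ : Q.Countable) :
    Measurable (pathTameSup Q ε d N k T) :=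
  Measurable.biSup _ (hQ.mono Set.inter_subset_left) fun t ht =>
    ((h.adapted t ht.2).mono (𝓗.le _) le_rfl).enorm.indicator
      (𝓗.le _ _ (h.measurableSet_tameEvent hQ ht.2))

lemma lintegral_iSup_tameEvent_le [MeasurableEq D]
    [IsProbabilityMeasure P] (hs : IsRestartingSystem P 𝓗 T d N k) {W : ℝ≥0 → Ω → ℝ}
    (hW : IsBrownianWrt P 𝓗 W) (hQ : Dense Q) (hQc : Q.Countable) {h : ℝ≥0 → Ω → ℝ}
    (hh : ∀ t ≤ T, MeasurableUpTo (𝓗 t) t h)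
    (hbound : ∀ s ω, ‖h s ω‖ₑ ^ 2 ≤ k s ω * ‖d s ω‖ₑ ^ 2) {H H' : ℕ → SimpleIntegrand 𝓗}
    (hconv : ∀ᵐ ω ∂P, Tendsto (fun n => timeLIntegral (fun s =>
      ‖(H n).value s ω - (H' n).value s ω - h s ω‖ₑ ^ 2) T) atTop (𝓝 0))
    {M : ℝ≥0 → Ω → ℝ}
    (hM : ∀ᵐ ω ∂P, ∀ t ≤ T, Tendsto
      (fun n => (H n).integral W t ω - (H' n).integral W t ω) atTop (𝓝 (M t ω))) :
    ∫⁻ ω, ⨆ t ∈ Q ∩ Set.Iic T, (tameEvent Q ε d N k t).indicator (fun ω => ‖M t ω‖ₑ ^ 2) ω ∂P ≤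
      8 * (ε * ∫⁻ ω, pathTameSup Q ε d N k T ω ^ 2 ∂P) := by
  refine (SimpleIntegrand.lintegral_iSup_limit_le hW hh hconv (hQc.mono Set.inter_subset_left)
    (fun t ht => ht.2) (hM.mono fun ω hω t ht => hω t ht.2)
    (fun t ht => hs.measurableSet_tameEvent hQc ht) hs.antitone_tameEvent).trans ?_
  rw [← lintegral_const_mul _ ((hs.measurable_pathTameSup hQc).pow_const 2)]
  gcongr 8 * ?_
  refine lintegral_mono_ae ?_
  filter_upwards [hs.eq_zero_of_left] with ω hω
  refine (lintegral_mono fun s => ?_).trans (timeLIntegral_tame_le hQ (hs.monotone_jumps ω)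
    (hs.rightContinuous ω) hω two_ne_zero)
  refine Set.indicator_apply_le' (fun hmem => ?_) fun _ => zero_le
  exact (hbound _ ω).trans (Set.indicator_of_mem (show s.toNNReal ∈ {t | Tame Q ε (fun s => d s ω)
    (fun s => N s ω) (fun s => k s ω) t} from hmem) (fun s => k s ω * ‖d s ω‖ₑ ^ 2)).ge

lemma lintegral_sq_pathTameSup_le [MeasurableEq D] (hs : IsRestartingSystem P 𝓗 T d N k)
    (hQ : Dense Q) (hQc : Q.Countable) (hε : ε ≠ ∞) {M : ℝ≥0 → Ω → E} {C : ℝ≥0}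
    (hdrift : ∀ᵐ ω ∂P, ∀ t ≤ T, (∀ s ≤ t, (∀ r < s, d r ω = 0) ∨ ∃ q < s, N q ω = N s ω) →
      ‖d t ω - M t ω‖ₑ ≤ C * timeLIntegral (fun s => k s ω * ‖d s ω‖ₑ) t) :
    ∫⁻ ω, pathTameSup Q ε d N k T ω ^ 2 ∂P ≤
      2 * ((C * ε) ^ 2 * ∫⁻ ω, pathTameSup Q ε d N k T ω ^ 2 ∂P +
        ∫⁻ ω, ⨆ t ∈ Q ∩ Set.Iic T,
          (tameEvent Q ε d N k t).indicator (fun ω => ‖M t ω‖ₑ ^ 2) ω ∂P) := by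
  have hpath : ∀ᵐ ω ∂P, pathTameSup Q ε d N k T ω ^ 2 ≤
      2 * ((C * ε) ^ 2 * pathTameSup Q ε d N k T ω ^ 2 + ⨆ t ∈ Q ∩ Set.Iic T,
        (tameEvent Q ε d N k t).indicator (fun ω => ‖M t ω‖ₑ ^ 2) ω) := by
    filter_upwards [hdrift, hs.eq_zero_of_left] with ω hω hleft
    exact tameSup_sq_le_of_drift hQ (hs.monotone_jumps ω) (hs.rightContinuous ω) hleft hω
  refine (lintegral_mono_ae hpath).trans_eq ?_
  rw [lintegral_const_mul' _ _ (by simp),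
    lintegral_add_left (((hs.measurable_pathTameSup hQc).pow_const 2).const_mul _),
    lintegral_const_mul' _ _ (ENNReal.pow_ne_top (ENNReal.mul_ne_top ENNReal.coe_ne_top hε))]

lemma exists_pos_quadratic_le_half (a b : ℝ≥0) :
    ∃ ε : ℝ≥0, 0 < ε ∧ a * ε ^ 2 + b * ε ≤ 1 / 2 := by
  refine ⟨1 / (2 * (a + b + 1)), by positivity, ?_⟩
  have hε : 1 / (2 * (a + b + 1)) ≤ 1 := by
    rw [div_le_one (by positivity)]
    exact one_le_two.trans (le_mul_of_one_le_right zero_le le_add_self)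
  calc a * (1 / (2 * (a + b + 1))) ^ 2 + b * (1 / (2 * (a + b + 1)))
      ≤ a * (1 / (2 * (a + b + 1))) + b * (1 / (2 * (a + b + 1))) := by
        gcongr
        exact pow_le_of_le_one zero_le hε two_ne_zero
    _ = (a + b) / (2 * (a + b + 1)) := by ring
    _ ≤ 1 / 2 := by
        rw [div_le_div_iff₀ (by positivity) two_pos, one_mul, mul_comm]
        exact mul_le_mul_right le_self_add 2

end IsRestartingSystem

section System

variable {𝓗 : Filtration ℝ≥0 mΩ} {W : ℝ≥0 → Ω → ℝ} {ι D : Type*} [Fintype ι] [PartialOrder D]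
  [TopologicalSpace D] [MeasurableSpace D] [MeasurableEq D] {T : ℝ≥0} {d : ℝ≥0 → Ω → ι → ℝ}
  {N : ℝ≥0 → Ω → D} {k : ℝ≥0 → Ω → ℝ≥0∞} {h : ι → ℝ≥0 → Ω → ℝ}
  {H H' : ι → ℕ → SimpleIntegrand 𝓗} {M : ℝ≥0 → Ω → ι → ℝ}

lemma IsRestartingSystem.lintegral_iSup_tameEvent_pi_le [IsProbabilityMeasure P]
    (hs : IsRestartingSystem P 𝓗 T d N k) (hW : IsBrownianWrt P 𝓗 W)
    (hh : ∀ u, ∀ t ≤ T, MeasurableUpTo (𝓗 t) t (h u))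
    (hbound : ∀ u s ω, ‖h u s ω‖ₑ ^ 2 ≤ k s ω * ‖d s ω‖ₑ ^ 2)
    (hconv : ∀ u, ∀ᵐ ω ∂P, Tendsto (fun n => timeLIntegral (fun s =>
      ‖(H u n).value s ω - (H' u n).value s ω - h u s ω‖ₑ ^ 2) T) atTop (𝓝 0))
    (hM : ∀ u, ∀ᵐ ω ∂P, ∀ t ≤ T, Tendsto
      (fun n => (H u n).integral W t ω - (H' u n).integral W t ω) atTop (𝓝 (M t ω u)))
    {Q : Set ℝ≥0} (hQ : Dense Q) (hQc : Q.Countable) {ε : ℝ≥0∞} :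
    ∫⁻ ω, ⨆ t ∈ Q ∩ Set.Iic T, (tameEvent Q ε d N k t).indicator (fun ω => ‖M t ω‖ₑ ^ 2) ω ∂P ≤
      Fintype.card ι * (8 * (ε * ∫⁻ ω, pathTameSup Q ε d N k T ω ^ 2 ∂P)) := by
  have hW' : ∀ t, Measurable (W t) := fun t => (hW.adapted t).mono (𝓗.le t) le_rfl
  have hMm : ∀ u, ∀ t ∈ Q ∩ Set.Iic T, AEMeasurable
      ((tameEvent Q ε d N k t).indicator fun ω => ‖M t ω u‖ₑ ^ 2) P := fun u t ht => by
    refine ((aemeasurable_of_tendsto_metrizable_ae atTop (fun n => ?_)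
      ((hM u).mono fun ω hω => hω t ht.2)).enorm.pow_const 2).indicator
      (𝓗.le t _ (hs.measurableSet_tameEvent hQc ht.2))
    exact (((H u n).measurable_integral hW' t).sub
      ((H' u n).measurable_integral hW' t)).aemeasurable
  calc _ ≤ ∫⁻ ω, ∑ u, ⨆ t ∈ Q ∩ Set.Iic T,
        (tameEvent Q ε d N k t).indicator (fun ω => ‖M t ω u‖ₑ ^ 2) ω ∂P := by
        refine lintegral_mono fun ω => iSup₂_le fun t ht => Set.indicator_apply_le' (fun hω => ?_)
          fun _ => zero_le
        refine (enorm_sq_le_sum _).trans (Finset.sum_le_sum fun u _ => ?_)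
        refine le_trans (le_of_eq ?_) (le_iSup₂ (f := fun t (_ : t ∈ Q ∩ Set.Iic T) =>
          (tameEvent Q ε d N k t).indicator (fun ω => ‖M t ω u‖ₑ ^ 2) ω) t ht)
        exact (Set.indicator_of_mem hω fun ω => ‖M t ω u‖ₑ ^ 2).symm
    _ = ∑ u, ∫⁻ ω, ⨆ t ∈ Q ∩ Set.Iic T,
        (tameEvent Q ε d N k t).indicator (fun ω => ‖M t ω u‖ₑ ^ 2) ω ∂P :=
        lintegral_finsetSum' _ fun u _ => AEMeasurable.biSup _ (hQc.mono Set.inter_subset_left)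
          (hMm u)
    _ ≤ _ := by
        rw [← nsmul_eq_mul]
        exact Finset.sum_le_card_nsmul _ _ _ fun u _ =>
          hs.lintegral_iSup_tameEvent_le hW hQ hQc (hh u) (hbound u) (hconv u) (hM u)

/-- Doob's inequality bounds the second moment of the tame supremum by half of itself when the
clock threshold `ε` is small. -/
theorem IsRestartingSystem.ae_eq_zero [IsProbabilityMeasure P] [DiscreteTopology D]
    (hs : IsRestartingSystem P 𝓗 T d N k) (hW : IsBrownianWrt P 𝓗 W)
    (hh : ∀ u, ∀ t ≤ T, MeasurableUpTo (𝓗 t) t (h u))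
    (hbound : ∀ u s ω, ‖h u s ω‖ₑ ^ 2 ≤ k s ω * ‖d s ω‖ₑ ^ 2)
    (hconv : ∀ u, ∀ᵐ ω ∂P, Tendsto (fun n => timeLIntegral (fun s =>
      ‖(H u n).value s ω - (H' u n).value s ω - h u s ω‖ₑ ^ 2) T) atTop (𝓝 0))
    (hM : ∀ u, ∀ᵐ ω ∂P, ∀ t ≤ T, Tendsto
      (fun n => (H u n).integral W t ω - (H' u n).integral W t ω) atTop (𝓝 (M t ω u)))
    {C : ℝ≥0}
    (hdrift : ∀ᵐ ω ∂P, ∀ t ≤ T, (∀ s ≤ t, (∀ r < s, d r ω = 0) ∨ ∃ q < s, N q ω = N s ω) →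
      ‖d t ω - M t ω‖ₑ ≤ C * timeLIntegral (fun s => k s ω * ‖d s ω‖ₑ) t) :
    ∀ᵐ ω ∂P, ∀ t ≤ T, d t ω = 0 := by
  set Q : Set ℝ≥0 := Set.range (TopologicalSpace.denseSeq ℝ≥0)
  have hQc : Q.Countable := Set.countable_range _
  have hQ : Dense Q := TopologicalSpace.denseRange_denseSeq ℝ≥0
  obtain ⟨ε, hε, hεC⟩ := exists_pos_quadratic_le_half (2 * C ^ 2) (16 * Fintype.card ι)
  set S : Ω → ℝ≥0∞ := IsRestartingSystem.pathTameSup Q ε d N k T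
  have hhalf : ∫⁻ ω, S ω ^ 2 ∂P ≤ 2⁻¹ * ∫⁻ ω, S ω ^ 2 ∂P := by
    calc ∫⁻ ω, S ω ^ 2 ∂P
        ≤ 2 * ((C * ε) ^ 2 * ∫⁻ ω, S ω ^ 2 ∂P +
            Fintype.card ι * (8 * (ε * ∫⁻ ω, S ω ^ 2 ∂P))) :=
          (hs.lintegral_sq_pathTameSup_le hQ hQc ENNReal.coe_ne_top hdrift).trans (by
            gcongr; exact hs.lintegral_iSup_tameEvent_pi_le hW hh hbound hconv hM hQ hQc)
      _ = ((2 * C ^ 2 * ε ^ 2 + 16 * Fintype.card ι * ε : ℝ≥0) : ℝ≥0∞) * ∫⁻ ω, S ω ^ 2 ∂P := by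
          push_cast
          ring
      _ ≤ ((1 / 2 : ℝ≥0) : ℝ≥0∞) * ∫⁻ ω, S ω ^ 2 ∂P := by gcongr
      _ = 2⁻¹ * ∫⁻ ω, S ω ^ 2 ∂P := by simp
  have hfin : ∫⁻ ω, S ω ^ 2 ∂P ≠ ∞ :=
    ((lintegral_mono fun ω => pow_le_one₀ zero_le tameSup_le_one).trans_lt
      (by simp : ∫⁻ _, 1 ∂P < ∞)).ne
  have hzero : ∫⁻ ω, S ω ^ 2 ∂P = 0 := by
    by_contra hne
    have hlt := ENNReal.half_lt_self hne hfin
    rw [ENNReal.div_eq_inv_mul] at hlt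
    exact hlt.not_ge hhalf
  rw [lintegral_eq_zero_iff ((hs.measurable_pathTameSup hQc).pow_const 2)] at hzero
  filter_upwards [hzero, hs.clock_lt_top, hs.eq_zero_of_left] with ω hω hk hleft
  refine eq_zero_of_tame_eq_zero hQ (ENNReal.coe_pos.2 hε) (hs.rightContinuous_jumps ω)
    (hs.rightContinuous ω) hleft hk fun t ht htT htame => ?_
  have hle := htame.enorm_le_tameSup ht htT
  rw [show tameSup Q _ _ _ _ T = 0 from (pow_eq_zero_iff two_ne_zero).1 hω] at hle
  exact enorm_eq_zero.1 (le_antisymm hle zero_le)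

end System

end LinearIto

section Augmentation

/-- The filtration `𝓕` augmented by the null events. -/
def augmentation (P : Measure Ω) (𝓕 : Filtration ℝ≥0 mΩ) : Filtration ℝ≥0 mΩ :=
  𝓕 ⊔ Filtration.const ℝ≥0 (nullSigma P) (nullSigma_le P)

variable {𝓕 : Filtration ℝ≥0 mΩ}

lemma le_augmentation (P : Measure Ω) (𝓕 : Filtration ℝ≥0 mΩ) : 𝓕 ≤ augmentation P 𝓕 :=
  le_sup_left

lemma measurableSet_augmentation {A : Set Ω} (hA : MeasurableSet A) (hA₀ : P Aᶜ = 0) (t : ℝ≥0) :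
    MeasurableSet[augmentation P 𝓕 t] A := by
  have hle : nullSigma P ≤ augmentation P 𝓕 t := le_sup_right
  exact (hle _ (MeasurableSpace.measurableSet_generateFrom ⟨hA.compl, hA₀⟩)).of_compl

lemma obsFiltration_le_augmentation {Y : ℝ≥0 → Ω → ℝ} (hY : ∀ t, StronglyMeasurable (Y t))
    (hYa : ∀ t, Measurable[𝓕 t] (Y t)) : obsFiltration P Y hY ≤ augmentation P 𝓕 :=
  sup_le_sup_right
    (fun _ => iSup₂_le fun s hs => ((hYa s).mono (𝓕.mono hs) le_rfl).comap_le) _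

lemma augmentation_le_eventuallyMeasurableSpace (t : ℝ≥0) :
    augmentation P 𝓕 t ≤ eventuallyMeasurableSpace (𝓕 t) (ae P) :=
  sup_le (fun _ hA => MeasurableSet.eventuallyMeasurableSet hA)
    (MeasurableSpace.generateFrom_le fun _ hA =>
      ⟨∅, @MeasurableSet.empty _ (𝓕 t), ae_eq_empty.2 hA.2⟩)

lemma IsBrownianWrt.augmentation {W : ℝ≥0 → Ω → ℝ} (hW : IsBrownianWrt P 𝓕 W) :
    IsBrownianWrt P (augmentation P 𝓕) W where
  brownian := hW.brownian
  adapted t := (hW.adapted t).mono (le_augmentation P 𝓕 t) le_rfl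
  indep s t hst := by
    have hind := hW.indep s t hst
    rw [Indep_iff] at hind ⊢
    intro A B hA hB
    obtain ⟨B', hB', hBB'⟩ := augmentation_le_eventuallyMeasurableSpace s B hB
    rw [measure_congr (EventuallyEq.rfl.inter hBB'), measure_congr hBB']
    exact hind A B' hA hB'

/-- An elementary integrand for `𝓖`, seen as one for a larger filtration. -/
def SimpleIntegrand.ofLE {𝓖 𝓗 : Filtration ℝ≥0 mΩ} (h : 𝓖 ≤ 𝓗) (H : SimpleIntegrand 𝓖) :
    SimpleIntegrand 𝓗 where
  n := H.n
  τ := H.τ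
  mono := H.mono
  c := H.c
  measurable_c i := (H.measurable_c i).mono (h _) le_rfl
  bounded_c := H.bounded_c

end Augmentation

section ItoIntegral

lemma ae_tendsto_zero_of_measure_le {x : ℕ → Ω → ℝ≥0∞}
    (hx : ∀ n, P {ω | 2⁻¹ ^ n ≤ x n ω} ≤ 2⁻¹ ^ n) :
    ∀ᵐ ω ∂P, Tendsto (fun n => x n ω) atTop (𝓝 0) := by
  have hsum : ∑' n, P {ω | 2⁻¹ ^ n ≤ x n ω} ≠ ∞ := by
    refine ne_top_of_le_ne_top ?_ (ENNReal.tsum_le_tsum hx)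
    rw [ENNReal.tsum_geometric]
    simp
  filter_upwards [ae_eventually_notMem hsum] with ω hω
  refine tendsto_of_tendsto_of_tendsto_of_le_of_le' tendsto_const_nhds
    (ENNReal.tendsto_pow_atTop_nhds_zero_of_lt_one (by simp : (2⁻¹ : ℝ≥0∞) < 1))
    (Eventually.of_forall fun n => zero_le) ?_
  filter_upwards [hω] with n hn
  exact (not_le.1 hn).le

lemma exists_subseq_ae_tendsto_zero {x y : ℕ → Ω → ℝ≥0∞}
    (h : ∀ ε : ℝ≥0∞, 0 < ε → Tendsto (fun n => P {ω | ε ≤ x n ω}) atTop (𝓝 0) ∧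
      Tendsto (fun n => P {ω | ε ≤ y n ω}) atTop (𝓝 0)) :
    ∃ φ : ℕ → ℕ, ∀ᵐ ω ∂P, Tendsto (fun n => x (φ n) ω) atTop (𝓝 0) ∧
      Tendsto (fun n => y (φ n) ω) atTop (𝓝 0) := by
  have hpos (n : ℕ) : (0 : ℝ≥0∞) < 2⁻¹ ^ n := ENNReal.pow_pos (by simp) n
  have hex (n : ℕ) :
      ∃ m, P {ω | 2⁻¹ ^ n ≤ x m ω} ≤ 2⁻¹ ^ n ∧ P {ω | 2⁻¹ ^ n ≤ y m ω} ≤ 2⁻¹ ^ n :=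
    (((h _ (hpos n)).1.eventually_le_const (hpos n)).and
      ((h _ (hpos n)).2.eventually_le_const (hpos n))).exists
  choose φ hφ using hex
  exact ⟨φ, (ae_tendsto_zero_of_measure_le fun n => (hφ n).1).and
    (ae_tendsto_zero_of_measure_le fun n => (hφ n).2)⟩

lemma IsItoIntegral.exists_ae_tendsto {𝓖 : Filtration ℝ≥0 mΩ} {T : ℝ≥0} {W H M : ℝ≥0 → Ω → ℝ}
    (h : IsItoIntegral P 𝓖 T W H M) :
    ∃ Hn : ℕ → SimpleIntegrand 𝓖, ∀ᵐ ω ∂P,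
      Tendsto (fun n => timeLIntegral (fun s => ‖(Hn n).value s ω - H s ω‖ₑ ^ 2) T) atTop (𝓝 0) ∧
      TendstoUniformlyOn (fun n t => (Hn n).integral W t ω) (fun t => M t ω) atTop (Set.Iic T) := by
  obtain ⟨Hn, hHn⟩ := h
  obtain ⟨φ, hφ⟩ := exists_subseq_ae_tendsto_zero hHn
  refine ⟨fun n => Hn (φ n), ?_⟩
  filter_upwards [hφ] with ω hω
  refine ⟨hω.1, EMetric.tendstoUniformlyOn_iff.2 fun ε hε => ?_⟩
  filter_upwards [hω.2.eventually (gt_mem_nhds hε)] with n hn t ht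
  rw [edist_comm, edist_eq_enorm_sub]
  exact (le_iSup₂ (f := fun t (_ : t ∈ Set.Iic T) =>
    ‖(Hn (φ n)).integral W t ω - M t ω‖ₑ) t ht).trans_lt hn

lemma SimpleIntegrand.continuousOn_integral {𝓖 : Filtration ℝ≥0 mΩ} (H : SimpleIntegrand 𝓖)
    {W : ℝ≥0 → Ω → ℝ} {ω : Ω} {T : ℝ≥0} (hW : ContinuousOn (fun t => W t ω) (Set.Iic T)) :
    ContinuousOn (fun t => H.integral W t ω) (Set.Iic T) := by
  have hmin (a : ℝ≥0) : ContinuousOn (fun t => W (min a t) ω) (Set.Iic T) :=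
    hW.comp (continuous_const.min continuous_id).continuousOn
      fun t ht => (min_le_right a t).trans (Set.mem_Iic.1 ht)
  exact continuousOn_finsetSum _ fun i _ => continuousOn_const.mul ((hmin _).sub (hmin _))

end ItoIntegral

section TimeIntegral

variable {R : ℝ≥0 → ℝ} {T t : ℝ≥0}

lemma intervalIntegrable_of_le {f : ℝ → ℝ} (hf : IntervalIntegrable f volume 0 T) (ht : t ≤ T) :
    IntervalIntegrable f volume 0 t := by
  refine hf.mono_set ?_
  rw [Set.uIcc_of_le t.coe_nonneg, Set.uIcc_of_le T.coe_nonneg]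
  exact Set.Icc_subset_Icc_right (NNReal.coe_le_coe.2 ht)

lemma intervalIntegrable_of_timeLIntegral_lt_top
    (hm : AEStronglyMeasurable (fun s : ℝ => R s.toNNReal) (volume.restrict (Set.Icc 0 T)))
    (hR : timeLIntegral (fun s => ‖R s‖ₑ) T < ∞) :
    IntervalIntegrable (fun s : ℝ => R s.toNNReal) volume 0 T :=
  (intervalIntegrable_iff_integrableOn_Icc_of_le T.coe_nonneg).2 ⟨hm, hR⟩

lemma enorm_timeIntegral_le (R : ℝ≥0 → ℝ) (t : ℝ≥0) :
    ‖timeIntegral R t‖ₑ ≤ timeLIntegral (fun s => ‖R s‖ₑ) t := by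
  unfold timeIntegral timeLIntegral
  rw [intervalIntegral.integral_of_le t.coe_nonneg]
  exact (enorm_integral_le_lintegral_enorm _).trans (lintegral_mono_set Set.Ioc_subset_Icc_self)

lemma continuousOn_timeIntegral
    (hR : IntervalIntegrable (fun s : ℝ => R s.toNNReal) volume 0 T) :
    ContinuousOn (timeIntegral R) (Set.Iic T) := by
  have hprim := intervalIntegral.continuousOn_primitive_interval' hR Set.left_mem_uIcc
  rw [Set.uIcc_of_le T.coe_nonneg] at hprim
  exact hprim.comp NNReal.continuous_coe.continuousOn fun t ht => ⟨t.2, NNReal.coe_le_coe.2 ht⟩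

lemma indicator_Ioc_toNNReal_mul_eqOn (a b t : ℝ≥0) (c : ℝ) (R : ℝ≥0 → ℝ) :
    Set.EqOn (fun s : ℝ => (Set.Ioc a b).indicator (fun _ => c) s.toNNReal * R s.toNNReal)
      ((Set.Ioc ((min a t : ℝ≥0) : ℝ) (min b t : ℝ≥0)).indicator fun s => c * R s.toNNReal)
      (Set.Ioc 0 t) := by
  intro s hs
  have hmem : s.toNNReal ∈ Set.Ioc a b ↔ s ∈ Set.Ioc ((min a t : ℝ≥0) : ℝ) (min b t : ℝ≥0) := by
    rw [Set.mem_Ioc, Set.mem_Ioc, Real.lt_toNNReal_iff_coe_lt, Real.toNNReal_le_iff_le_coe,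
      NNReal.coe_min, NNReal.coe_min, min_lt_iff, le_min_iff]
    exact ⟨fun h => ⟨Or.inl h.1, h.2, hs.2⟩,
      fun h => ⟨h.1.resolve_right (not_lt.2 hs.2), h.2.1⟩⟩
  by_cases h : s ∈ Set.Ioc ((min a t : ℝ≥0) : ℝ) (min b t : ℝ≥0)
  · simp only [Set.indicator_of_mem h, Set.indicator_of_mem (hmem.2 h)]
  · simp only [Set.indicator_of_notMem h, Set.indicator_of_notMem (mt hmem.1 h), zero_mul]

lemma intervalIntegrable_indicator_Ioc_mul
    (hR : IntervalIntegrable (fun s : ℝ => R s.toNNReal) volume 0 t) (a b : ℝ≥0) (c : ℝ) :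
    IntervalIntegrable
      (fun s : ℝ => (Set.Ioc a b).indicator (fun _ => c) s.toNNReal * R s.toNNReal) volume 0 t := by
  rw [intervalIntegrable_iff_integrableOn_Ioc_of_le t.coe_nonneg] at hR ⊢
  have hcR : IntegrableOn (fun s : ℝ => c * R s.toNNReal) (Set.Ioc 0 t) volume := hR.const_mul c
  exact IntegrableOn.congr_fun (hcR.indicator measurableSet_Ioc)
    (indicator_Ioc_toNNReal_mul_eqOn a b t c R).symm measurableSet_Ioc

lemma timeIntegral_indicator_Ioc_mul
    (hR : IntervalIntegrable (fun s : ℝ => R s.toNNReal) volume 0 t) {a b : ℝ≥0} (hab : a ≤ b)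
    (c : ℝ) :
    timeIntegral (fun s => (Set.Ioc a b).indicator (fun _ => c) s * R s) t =
      c * (timeIntegral R (min b t) - timeIntegral R (min a t)) := by
  unfold timeIntegral
  rw [intervalIntegral.integral_interval_sub_left (intervalIntegrable_of_le hR (min_le_right b t))
      (intervalIntegrable_of_le hR (min_le_right a t)),
    intervalIntegral.integral_of_le (NNReal.coe_le_coe.2 (min_le_min_right t hab)),
    intervalIntegral.integral_of_le t.coe_nonneg,
    setIntegral_congr_fun measurableSet_Ioc (indicator_Ioc_toNNReal_mul_eqOn a b t c R),
    setIntegral_indicator measurableSet_Ioc, Set.inter_eq_right.2 (Set.Ioc_subset_Ioc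
      (min a t).coe_nonneg (NNReal.coe_le_coe.2 (min_le_right b t))), integral_const_mul]

end TimeIntegral

section DriftRemoval

variable {𝓖 : Filtration ℝ≥0 mΩ} {W Wt : ℝ≥0 → Ω → ℝ} {R h : ℝ≥0 → ℝ} {ω : Ω} {T t : ℝ≥0}

lemma SimpleIntegrand.measurable_value_path (H : SimpleIntegrand 𝓖) (ω : Ω) :
    Measurable (fun s : ℝ => H.value s.toNNReal ω) :=
  Finset.measurable_fun_sum _ fun _ _ =>
    (measurable_const.indicator measurableSet_Ioc).comp measurable_real_toNNReal

lemma SimpleIntegrand.intervalIntegrable_value_mul (H : SimpleIntegrand 𝓖)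
    (hR : IntervalIntegrable (fun s : ℝ => R s.toNNReal) volume 0 t) (ω : Ω) :
    IntervalIntegrable (fun s : ℝ => H.value s.toNNReal ω * R s.toNNReal) volume 0 t := by
  unfold SimpleIntegrand.value
  simp_rw [Finset.sum_mul]
  refine (IntervalIntegrable.sum (Finset.range H.n) fun i _ =>
    intervalIntegrable_indicator_Ioc_mul hR (H.τ i) (H.τ (i + 1)) (H.c i ω)).congr ?_
  exact fun s _ => by simp only [Finset.sum_apply]

lemma SimpleIntegrand.integral_timeIntegral (H : SimpleIntegrand 𝓖)
    (hR : IntervalIntegrable (fun s : ℝ => R s.toNNReal) volume 0 t) (ω : Ω) :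
    H.integral (fun t _ => timeIntegral R t) t ω =
      timeIntegral (fun s => H.value s ω * R s) t := by
  calc H.integral (fun t _ => timeIntegral R t) t ω
      = ∑ i ∈ Finset.range H.n, timeIntegral (fun s =>
          (Set.Ioc (H.τ i) (H.τ (i + 1))).indicator (fun _ => H.c i ω) s * R s) t :=
        Finset.sum_congr rfl fun i _ =>
          (timeIntegral_indicator_Ioc_mul hR (H.mono i.le_succ) (H.c i ω)).symm
    _ = timeIntegral (fun s => H.value s ω * R s) t := by
        unfold timeIntegral SimpleIntegrand.value
        simp_rw [Finset.sum_mul]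
        exact (intervalIntegral.integral_finsetSum fun i _ =>
          intervalIntegrable_indicator_Ioc_mul hR _ _ _).symm

lemma SimpleIntegrand.integral_eq_sub_timeIntegral (H : SimpleIntegrand 𝓖)
    (hWt : ∀ s ≤ t, Wt s ω = W s ω + timeIntegral R s)
    (hR : IntervalIntegrable (fun s : ℝ => R s.toNNReal) volume 0 t) :
    H.integral W t ω = H.integral Wt t ω - timeIntegral (fun s => H.value s ω * R s) t := by
  rw [← H.integral_timeIntegral hR ω]
  unfold SimpleIntegrand.integral
  rw [← Finset.sum_sub_distrib]
  refine Finset.sum_congr rfl fun i _ => ?_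
  rw [hWt _ (min_le_right _ _), hWt _ (min_le_right _ _)]
  ring

lemma edist_timeIntegral_mul_le {g : ℝ≥0 → ℝ}
    (hgm : AEStronglyMeasurable (fun s : ℝ => g s.toNNReal) (volume.restrict (Set.Icc 0 T)))
    (hhm : AEStronglyMeasurable (fun s : ℝ => h s.toNNReal) (volume.restrict (Set.Icc 0 T)))
    (hRm : AEStronglyMeasurable (fun s : ℝ => R s.toNNReal) (volume.restrict (Set.Icc 0 T)))
    (ht : t ≤ T)
    (hgR : IntervalIntegrable (fun s : ℝ => g s.toNNReal * R s.toNNReal) volume 0 t)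
    (hhR : IntervalIntegrable (fun s : ℝ => h s.toNNReal * R s.toNNReal) volume 0 t) :
    edist (timeIntegral (fun s => g s * R s) t) (timeIntegral (fun s => h s * R s) t) ≤
      timeLIntegral (fun s => ‖g s - h s‖ₑ ^ 2) T ^ (1 / (2 : ℝ)) *
        timeLIntegral (fun s => ‖R s‖ₑ ^ 2) T ^ (1 / (2 : ℝ)) := by
  have hsub : timeIntegral (fun s => g s * R s) t - timeIntegral (fun s => h s * R s) t =
      timeIntegral (fun s => (g s - h s) * R s) t := by
    unfold timeIntegral
    rw [← intervalIntegral.integral_sub hgR hhR]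
    simp_rw [sub_mul]
  have hHolder := ENNReal.lintegral_mul_le_Lp_mul_Lq (volume.restrict (Set.Icc (0 : ℝ) T))
    Real.HolderConjugate.two_two (hgm.sub hhm).enorm hRm.enorm
  simp only [Pi.mul_apply, Pi.sub_apply, ENNReal.rpow_two, ← enorm_mul] at hHolder
  rw [edist_eq_enorm_sub, hsub]
  exact (enorm_timeIntegral_le _ _).trans ((timeLIntegral_mono_right _ ht).trans hHolder)

lemma tendsto_integral_of_drift {Hn : ℕ → SimpleIntegrand 𝓖}
    (hWt : ∀ t ≤ T, Wt t ω = W t ω + timeIntegral R t)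
    (hR : IntervalIntegrable (fun s : ℝ => R s.toNNReal) volume 0 T)
    (hR2 : timeLIntegral (fun s => ‖R s‖ₑ ^ 2) T < ∞)
    (hhm : AEStronglyMeasurable (fun s : ℝ => h s.toNNReal) (volume.restrict (Set.Icc 0 T)))
    (hhR : IntervalIntegrable (fun s : ℝ => h s.toNNReal * R s.toNNReal) volume 0 T)
    (hconv : Tendsto (fun n => timeLIntegral (fun s => ‖(Hn n).value s ω - h s‖ₑ ^ 2) T) atTop
      (𝓝 0))
    {m : ℝ} (ht : t ≤ T) (hm : Tendsto (fun n => (Hn n).integral Wt t ω) atTop (𝓝 m)) :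
    Tendsto (fun n => (Hn n).integral W t ω) atTop
      (𝓝 (m - timeIntegral (fun s => h s * R s) t)) := by
  have hRm := ((intervalIntegrable_iff_integrableOn_Icc_of_le T.coe_nonneg).1 hR).1
  have hRt := intervalIntegrable_of_le hR ht
  simp_rw [fun n => (Hn n).integral_eq_sub_timeIntegral (fun s hs => hWt s (hs.trans ht)) hRt]
  refine hm.sub (tendsto_iff_edist_tendsto_0.2 ?_)
  refine tendsto_of_tendsto_of_tendsto_of_le_of_le tendsto_const_nhds ?_ (fun n => zero_le)
    fun n => edist_timeIntegral_mul_le ((Hn n).measurable_value_path ω).aestronglyMeasurable hhm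
      hRm ht ((Hn n).intervalIntegrable_value_mul hRt ω) (intervalIntegrable_of_le hhR ht)
  have hsqrt := (ENNReal.continuous_rpow_const (y := 1 / (2 : ℝ))).tendsto 0 |>.comp hconv
  rw [ENNReal.zero_rpow_of_pos (by norm_num)] at hsqrt
  have hprod := ENNReal.Tendsto.mul_const
    (b := timeLIntegral (fun s => ‖R s‖ₑ ^ 2) T ^ (1 / (2 : ℝ))) hsqrt
    (Or.inr (ENNReal.rpow_ne_top_of_nonneg (by norm_num) hR2.ne))
  rwa [zero_mul] at hprod

end DriftRemoval

section PointMasses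

variable {α : Type*} [MeasurableSpace α]

/-- The vector of the masses that a finite measure gives to the points. On a finite discrete space
it turns measure-valued processes into vector-valued ones. -/
def pointMasses (ρ : FiniteMeasure α) (a : α) : ℝ := (ρ : Measure α).real {a}

lemma pointMasses_injective [Countable α] :
    Function.Injective (pointMasses (α := α)) := fun ρ ρ' h =>
  Subtype.ext <| Measure.ext_iff_singleton.2 fun a =>
    (ENNReal.toReal_eq_toReal_iff' (measure_ne_top (ρ : Measure α) _)
      (measure_ne_top (ρ' : Measure α) _)).1 (congrFun h a)

lemma measurable_pointMasses [MeasurableSingletonClass α] : Measurable (pointMasses (α := α)) :=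
  measurable_pi_lambda _ fun a =>
    ((Measure.measurable_coe (measurableSet_singleton a)).comp
      measurable_subtype_coe).ennreal_toReal

lemma continuous_pointMasses [Finite α] [TopologicalSpace α] [DiscreteTopology α]
    [OpensMeasurableSpace α] : Continuous (pointMasses (α := α)) := by
  refine continuous_pi fun a => continuous_iff_continuousAt.2 fun ρ => ?_
  let g : BoundedContinuousFunction α ℝ := BoundedContinuousFunction.mkOfCompact
    ⟨Set.indicator {a} fun _ => 1, continuous_of_discreteTopology⟩
  have hg (ρ : FiniteMeasure α) : ∫ x, g x ∂(ρ : Measure α) = pointMasses ρ a := by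
    simp only [g, BoundedContinuousFunction.mkOfCompact_apply, ContinuousMap.coe_mk]
    rw [integral_indicator (isOpen_discrete _).measurableSet, setIntegral_const, smul_eq_mul,
      mul_one, pointMasses]
  have hlim := FiniteMeasure.tendsto_iff_forall_integral_tendsto.1 (tendsto_id (x := 𝓝 ρ)) g
  simp only [id, hg] at hlim
  exact hlim

end PointMasses

namespace Model

variable (𝓜 : Model)

section Coefficients

/-- The part of the Zakai drift of a time-independent test function that does not involve the
reference kernel, as a function of the state. -/
def driftCoeff (φ : ℝ → ℝ) (t : ℝ≥0) (x : 𝓜.S) (y : ℝ) : ℝ :=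
  𝓜.L0 (fun _ => φ) t x y - (𝓜.lam t x y).toReal * φ x

lemma measurable_K1_prod (x : 𝓜.S) :
    Measurable fun p : (ℝ≥0 × ℝ) × (𝓜.S × 𝓜.S) => 𝓜.K1 p.1.1 x p.1.2 p.2 :=
  measurable_from_prod_countable_left (𝓜.measurable_K1 x)

lemma measurable_lam (x : 𝓜.S) : Measurable fun p : ℝ≥0 × ℝ => 𝓜.lam p.1 x p.2 :=
  measurable_measure_prodMk_left (𝓜.measurable_K1_prod x (measurableSet_singleton 0).compl)

lemma L0_const (φ : ℝ → ℝ) (t : ℝ≥0) (x : 𝓜.S) (y : ℝ) :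
    𝓜.L0 (fun _ => φ) t x y =
      ∫ ζ in {ζ | 𝓜.K1 t x y ζ = 0}, (φ (x + 𝓜.K0 x ζ) - φ x) ∂𝓜.nu := by
  rw [L0, deriv_const, zero_add]

lemma measurable_L0_const (φ : ℝ → ℝ) (x : 𝓜.S) :
    Measurable fun p : ℝ≥0 × ℝ => 𝓜.L0 (fun _ => φ) p.1 x p.2 := by
  simp_rw [L0_const, ← integral_indicator (Set.toFinite _).measurableSet]
  have hmeas : Measurable fun p : (ℝ≥0 × ℝ) × (𝓜.S × 𝓜.S) =>
      {p : (ℝ≥0 × ℝ) × (𝓜.S × 𝓜.S) | 𝓜.K1 p.1.1 x p.1.2 p.2 = 0}.indicator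
        (fun p => φ (x + 𝓜.K0 x p.2) - φ x) p :=
    ((measurable_of_finite fun ζ : 𝓜.S × 𝓜.S => φ (x + 𝓜.K0 x ζ) - φ x).comp
      measurable_snd).indicator (𝓜.measurable_K1_prod x (measurableSet_singleton 0))
  exact hmeas.stronglyMeasurable.integral_prod_right'.measurable

lemma measurable_driftCoeff (φ : ℝ → ℝ) (x : 𝓜.S) :
    Measurable fun p : ℝ≥0 × ℝ => 𝓜.driftCoeff φ p.1 x p.2 :=
  (𝓜.measurable_L0_const φ x).sub ((𝓜.measurable_lam x).ennreal_toReal.mul_const _)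

lemma abs_driftCoeff_le {φ : ℝ → ℝ} {B : ℝ} (hφ : ∀ x, |φ x| ≤ B) (t : ℝ≥0) (x : 𝓜.S) (y : ℝ) :
    |𝓜.driftCoeff φ t x y| ≤ 3 * B * 𝓜.nu.real Set.univ := by
  have hB : 0 ≤ B := (abs_nonneg _).trans (hφ 0)
  have hL0 : |𝓜.L0 (fun _ => φ) t x y| ≤ 2 * B * 𝓜.nu.real Set.univ := by
    rw [L0_const]
    refine (norm_setIntegral_le_of_norm_le_const
      (f := fun ζ => φ (x + 𝓜.K0 x ζ) - φ x) (C := 2 * B) (measure_lt_top 𝓜.nu _)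
      fun ζ _ => ?_).trans ?_
    · exact (abs_sub _ _).trans (by linarith [hφ (x + 𝓜.K0 x ζ), hφ x])
    · exact mul_le_mul_of_nonneg_left (measureReal_mono (Set.subset_univ _)) (by positivity)
  have hlam : |(𝓜.lam t x y).toReal * φ x| ≤ 𝓜.nu.real Set.univ * B := by
    rw [abs_mul, abs_of_nonneg ENNReal.toReal_nonneg]
    exact mul_le_mul (measureReal_mono (Set.subset_univ _)) (hφ x) (abs_nonneg _)
      measureReal_nonneg
  exact (abs_sub _ _).trans (by linarith)

lemma zakaiDrift_eq_sum (Y : ℝ≥0 → Ω → ℝ) (η : Kernel (ℝ≥0 × ℝ) ℝ) (φ : ℝ → ℝ)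
    (ξ : ℝ≥0 → Ω → FiniteMeasure 𝓜.S) (t : ℝ≥0) (ω : Ω) :
    𝓜.zakaiDrift Y η (fun _ => φ) ξ t ω = ∑ x : 𝓜.S, pointMasses (ξ t ω) x *
      (𝓜.driftCoeff φ t x (Y t ω) +
        (η (t, Function.leftLim (fun r => Y r ω) t)).real Set.univ * φ x) := by
  unfold zakaiDrift pairing
  simp only [integral_fintype Integrable.of_finite, Finset.mul_sum, ← Finset.sum_sub_distrib,
    ← Finset.sum_add_distrib, smul_eq_mul]
  refine Finset.sum_congr rfl fun x _ => ?_
  rw [driftCoeff, pointMasses]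
  ring

end Coefficients

section TestFunction

variable {𝓜} {φ : ℝ → ℝ} {u : 𝓜.S}

lemma pairing_eq_pointMasses (hφ : ∀ x : 𝓜.S, φ x = if x = u then 1 else 0)
    (ρ : FiniteMeasure 𝓜.S) (t : ℝ≥0) : 𝓜.pairing ρ (fun _ => φ) t = pointMasses ρ u := by
  rw [pairing, integral_fintype Integrable.of_finite, pointMasses]
  simp [hφ]

lemma zakaiDiffusion_eq_ratio_mul (hφ : ∀ x : 𝓜.S, φ x = if x = u then 1 else 0)
    (Y : ℝ≥0 → Ω → ℝ) (ξ : ℝ≥0 → Ω → FiniteMeasure 𝓜.S) (t : ℝ≥0) (ω : Ω) :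
    𝓜.zakaiDiffusion Y (fun _ => φ) ξ t ω =
      𝓜.ratio t u (Y t ω) * pointMasses (ξ t ω) u := by
  rw [zakaiDiffusion, ratio, pointMasses, integral_fintype Integrable.of_finite]
  simp only [hφ, smul_eq_mul, mul_ite, mul_one, mul_zero, Finset.sum_ite_eq', Finset.mem_univ,
    if_true]
  ring

end TestFunction

end Model

lemma isTestFunction_of_contDiff {φ : ℝ → ℝ} (hφ : ContDiff ℝ (⊤ : ℕ∞) φ)
    (hs : HasCompactSupport φ) : IsTestFunction fun _ => φ := by
  have hφ' : ContDiff ℝ (⊤ : ℕ∞) (deriv φ) := (contDiff_infty_iff_deriv.1 hφ).2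
  have hφ'' : ContDiff ℝ (⊤ : ℕ∞) (deriv (deriv φ)) := (contDiff_infty_iff_deriv.1 hφ').2
  obtain ⟨C₀, hC₀⟩ := hs.exists_bound_of_continuous hφ.continuous
  obtain ⟨C₁, hC₁⟩ := hs.deriv.exists_bound_of_continuous hφ'.continuous
  obtain ⟨C₂, hC₂⟩ := hs.deriv.deriv.exists_bound_of_continuous hφ''.continuous
  have hC₀_nonneg : 0 ≤ C₀ := (norm_nonneg _).trans (hC₀ 0)
  have hC₁_nonneg : 0 ≤ C₁ := (norm_nonneg _).trans (hC₁ 0)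
  have hC₂_nonneg : 0 ≤ C₂ := (norm_nonneg _).trans (hC₂ 0)
  refine ⟨fun _ => differentiable_const _, fun _ => hφ.differentiable (by simp),
    fun _ => hφ'.differentiable (by simp), hφ.continuous.comp continuous_snd, ?_,
    hφ'.continuous.comp continuous_snd, hφ''.continuous.comp continuous_snd,
    C₀ + C₁ + C₂, fun t x => ⟨?_, ?_, ?_, ?_⟩⟩
  · simpa using continuous_const
  · exact (hC₀ x).trans (by linarith)
  · simp only [deriv_const, abs_zero]
    positivity
  · exact (hC₁ x).trans (by linarith)
  · exact (hC₂ x).trans (by linarith)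

lemma exists_isTestFunction_eq_ite (S : Finset ℝ) (u : S) : ∃ φ : ℝ → ℝ,
    IsTestFunction (fun _ => φ) ∧ ∀ x : S, φ x = if x = u then 1 else 0 := by
  have hisolated : ∀ᶠ y : ℝ in 𝓝 (u : ℝ), ∀ x : S, x ≠ u → y ≠ (x : ℝ) :=
    eventually_all.2 fun x => eventually_imp_distrib_left.2 fun hx =>
      isOpen_ne.mem_nhds fun h => hx (Subtype.ext h.symm)
  obtain ⟨ε, hε, hball⟩ := Metric.eventually_nhds_iff_ball.1 hisolated
  let φ : ContDiffBump (u : ℝ) := ⟨ε / 2, ε, by positivity, by linarith⟩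
  refine ⟨φ, isTestFunction_of_contDiff φ.contDiff φ.hasCompactSupport, fun x => ?_⟩
  split_ifs with hx
  · rw [hx]
    exact φ.one_of_mem_closedBall (Metric.mem_closedBall_self (by positivity))
  · refine φ.zero_of_le_dist ?_
    by_contra! h
    exact hball x (Metric.mem_ball.2 h) x hx rfl

section Jumps

lemma tendsto_nhdsLT_of_eqOn_Ico {E : Type*} [TopologicalSpace E] {f : ℝ≥0 → E} {q s : ℝ≥0} {l : E}
    (hqs : q < s) (hf : ∀ r ∈ Set.Ico q s, f r = l) : Tendsto f (𝓝[<] s) (𝓝 l) :=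
  tendsto_const_nhds.congr' <|
    eventually_of_mem (Ico_mem_nhdsLT hqs) fun r hr => (hf r hr).symm

lemma jump_eq_zero_of_tendsto {n : ℝ≥0 → ℝ} {s : ℝ≥0} (hs : 0 < s)
    (hn : Tendsto n (𝓝[<] s) (𝓝 (n s))) : jump n s = 0 := by
  have : (𝓝[<] s).NeBot := nhdsLT_neBot_of_exists_lt ⟨0, hs⟩
  rw [jump, leftLim_eq_of_tendsto hn, sub_self]

lemma jump_eq_zero_of_eqOn_Ico {n : ℝ≥0 → ℝ} {q s : ℝ≥0} (hqs : q < s)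
    (hn : ∀ r ∈ Set.Ico q s, n r = n s) : jump n s = 0 :=
  jump_eq_zero_of_tendsto (pos_of_gt hqs) (tendsto_nhdsLT_of_eqOn_Ico hqs hn)

lemma leftLim_congr_of_eqOn_Iio {E : Type*} [TopologicalSpace E] [T2Space E] {f g : ℝ≥0 → E}
    {s : ℝ≥0} (hs : 0 < s) (hfg : ∀ r < s, f r = g r) (hf : ∃ l, Tendsto f (𝓝[<] s) (𝓝 l)) :
    Function.leftLim f s = Function.leftLim g s := by
  have : (𝓝[<] s).NeBot := nhdsLT_neBot_of_exists_lt ⟨0, hs⟩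
  obtain ⟨l, hl⟩ := hf
  have hl' : Tendsto g (𝓝[<] s) (𝓝 l) := hl.congr' (eventually_mem_nhdsWithin.mono hfg)
  rw [leftLim_eq_of_tendsto hl, leftLim_eq_of_tendsto hl']

lemma finsum_mul_jump_eq_of_eqOn_Icc {n : ℝ≥0 → ℝ} (g : ℝ≥0 → ℝ) {q t s : ℝ≥0}
    (ht : t ∈ Set.Icc q s) (hn : ∀ r ∈ Set.Icc q s, n r = n s) :
    ∑ᶠ r ∈ Set.Ioc 0 t, g r * jump n r = ∑ᶠ r ∈ Set.Ioc 0 s, g r * jump n r := by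
  refine finsum_mem_inter_support_eq _ _ _ (Set.ext fun r => ?_)
  simp only [Set.mem_inter_iff, Set.mem_Ioc, Function.mem_support]
  refine ⟨fun h => ⟨⟨h.1.1, h.1.2.trans ht.2⟩, h.2⟩, fun h => ⟨⟨h.1.1, ?_⟩, h.2⟩⟩
  by_contra! hlt
  have hqr : q < r := ht.1.trans_lt hlt
  refine h.2 ?_
  rw [jump_eq_zero_of_eqOn_Ico hqr fun r' hr' => ?_, mul_zero]
  rw [hn r' ⟨hr'.1, hr'.2.le.trans h.1.2⟩, hn r ⟨hqr.le, h.1.2⟩]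

lemma IsPoissonFamily.ae_monotone {ι : Type*} [Countable ι] {𝓕 : Filtration ℝ≥0 mΩ}
    {N : ι → ℝ≥0 → Ω → ℕ} {r : ι → ℝ≥0} (hN : IsPoissonFamily P 𝓕 N r) :
    ∀ᵐ ω ∂P, ∀ ζ, Monotone fun t => N ζ t ω :=
  ae_all_iff.2 fun ζ => (hN.paths ζ).mono fun _ h => h.2.1

lemma IsItoIntegral.ae_continuousOn {𝓖 : Filtration ℝ≥0 mΩ} {T : ℝ≥0} {W H M : ℝ≥0 → Ω → ℝ}
    (hM : IsItoIntegral P 𝓖 T W H M)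
    (hW : ∀ᵐ ω ∂P, ContinuousOn (fun t => W t ω) (Set.Iic T)) :
    ∀ᵐ ω ∂P, ContinuousOn (fun t => M t ω) (Set.Iic T) := by
  obtain ⟨Hn, hHn⟩ := hM.exists_ae_tendsto
  filter_upwards [hHn, hW] with ω hHn hW
  exact hHn.2.continuousOn (Frequently.of_forall fun n => (Hn n).continuousOn_integral hW)

end Jumps

namespace Model

variable {𝓜 : Model}

lemma ae_jump_eq_zero {𝓕 : Filtration ℝ≥0 mΩ} {T : ℝ≥0} {W : ℝ≥0 → Ω → ℝ}
    (hW : IsBrownianWrt P 𝓕 W) {N : 𝓜.S × 𝓜.S → ℝ≥0 → Ω → ℕ}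
    (hN : IsPoissonFamily P 𝓕 N 𝓜.rate) {X : ℝ≥0 → Ω → 𝓜.S} {Y : ℝ≥0 → Ω → ℝ}
    (hXY : 𝓜.IsSolution P 𝓕 T W N X Y)
    (hb : ∀ᵐ ω ∂P, IntervalIntegrable
      (fun s : ℝ => 𝓜.b1 s.toNNReal (X s.toNNReal ω) (Y s.toNNReal ω)) volume 0 T) :
    ∀ᵐ ω ∂P, ∀ s ≤ T, (∃ q < s, ∀ ζ, N ζ q ω = N ζ s ω) → jump (fun r => Y r ω) s = 0 := by
  obtain ⟨M, hM, hY⟩ := hXY.equation_Y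
  have hMc := hM.ae_continuousOn (hW.brownian.cont.mono fun _ h => h.continuousOn)
  filter_upwards [hY, hMc, hN.ae_monotone, hb] with ω hY hMc hN hb s hsT ⟨q, hqs, hq⟩
  have hconst (ζ) : ∀ r ∈ Set.Icc q s, (N ζ r ω : ℝ) = N ζ s ω := fun r hr =>
    congrArg _ (le_antisymm (hN ζ hr.2) ((hq ζ).ge.trans (hN ζ hr.1)))
  let B (t : ℝ≥0) : ℝ := 𝓜.y0 + timeIntegral (fun s => 𝓜.b1 s (X s ω) (Y s ω)) t + M t ω
  have hB : ContinuousOn B (Set.Iic T) := ((continuousOn_timeIntegral hb).const_add _).add hMc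
  have hBs : Tendsto B (𝓝[<] s) (𝓝 (B s)) :=
    ((hB s hsT).mono fun r (hr : r < s) => hr.le.trans hsT).tendsto
  refine jump_eq_zero_of_tendsto (pos_of_gt hqs) ?_
  rw [hY s hsT]
  refine (hBs.add_const _).congr' ?_
  filter_upwards [Ico_mem_nhdsLT hqs] with r hr
  rw [hY r (hr.2.le.trans hsT)]
  exact congrArg (B r + ·) <| Finset.sum_congr rfl fun ζ _ =>
    (finsum_mul_jump_eq_of_eqOn_Icc _ ⟨hr.1, hr.2.le⟩ (hconst ζ)).symm

lemma zakaiJump_congr {ξ ξ' : ℝ≥0 → Ω → FiniteMeasure 𝓜.S} (Y : ℝ≥0 → Ω → ℝ)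
    (η : Kernel (ℝ≥0 × ℝ) ℝ) (f : ℝ → ℝ → ℝ) {s : ℝ≥0} (hs : 0 < s) {ω : Ω}
    (h : ∀ r < s, ξ r ω = ξ' r ω) (hξ : IsCadlag fun t => ξ t ω) (z : ℝ) :
    𝓜.zakaiJump Y η f ξ s ω z = 𝓜.zakaiJump Y η f ξ' s ω z := by
  unfold zakaiJump
  rw [leftLim_congr_of_eqOn_Iio hs h (hξ s).2]

lemma absolutelyContinuous_referenceMeasure {𝓨 : Filtration ℝ≥0 mΩ} {T : ℝ≥0}
    {Y : ℝ≥0 → Ω → ℝ} {π : ℝ≥0 → Ω → ProbabilityMeasure 𝓜.S} {η : Kernel (ℝ≥0 × ℝ) ℝ}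
    {Ψ : ℝ≥0 → Ω → ℝ → ℝ} (hη : 𝓜.IsReference P 𝓨 T Y π η Ψ) {J : ℝ≥0 → Ω → ℝ}
    (hZ : AEMeasurable (𝓜.girsanovDensity Y π Ψ J T) P) :
    P ≪ 𝓜.referenceMeasure P T Y π Ψ J := by
  refine withDensity_absolutelyContinuous' hZ.ennreal_ofReal ?_
  filter_upwards [hη.pos] with ω hω
  have hprod : 0 < ∏ᶠ s ∈ {s | s ∈ Set.Ioc 0 T ∧ jump (fun r => Y r ω) s ≠ 0},
      (1 + ((1 + Ψ s ω (jump (fun r => Y r ω) s))⁻¹ - 1)) := by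
    refine finprod_mem_induction (0 < ·) one_pos (fun _ _ => mul_pos) fun s hs => ?_
    rw [add_sub_cancel]
    exact inv_pos.2 (hω s hs.1.2 _)
  exact (ENNReal.ofReal_pos.2
    (mul_pos (Real.exp_pos _) (mul_pos (Real.exp_pos _) hprod))).ne'

end Model

lemma ae_leftLim_eq {ι : Type*} [Finite ι] {N : ι → ℝ≥0 → ℕ} (hN : ∀ ζ, Monotone (N ζ))
    {T : ℝ≥0} {y : ℝ≥0 → ℝ}
    (hy : ∀ s ≤ T, (∃ q < s, ∀ ζ, N ζ q = N ζ s) → jump y s = 0) :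
    ∀ᵐ s ∂volume.restrict (Set.Icc (0 : ℝ) T),
      Function.leftLim y s.toNNReal = y s.toNNReal := by
  let D : Set ℝ≥0 := insert 0 (⋃ ζ, {t | ¬ ContinuousAt (N ζ) t})
  have hD : (((↑) : ℝ≥0 → ℝ) '' D).Countable :=
    ((Set.countable_iUnion fun ζ => (hN ζ).countable_not_continuousAt).insert 0).image _
  filter_upwards [ae_restrict_of_ae (hD.ae_notMem volume), ae_restrict_mem measurableSet_Icc]
    with s hsD hs
  lift s to ℝ≥0 using hs.1
  rw [Real.toNNReal_coe]
  have hsD' : s ∉ D := fun h => hsD ⟨s, h, rfl⟩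
  simp only [D, Set.mem_insert_iff, Set.mem_iUnion, not_or, not_exists] at hsD'
  have : (𝓝[<] s).NeBot := nhdsLT_neBot_of_exists_lt ⟨0, pos_iff_ne_zero.2 hsD'.1⟩
  have hN_eq : ∀ᶠ q in 𝓝[<] s, ∀ ζ, N ζ q = N ζ s := eventually_all.2 fun ζ => by
    have hc : Tendsto (N ζ) (𝓝 s) (𝓝 (N ζ s)) := not_not.1 (hsD'.2 ζ)
    rw [nhds_discrete ℕ, tendsto_pure] at hc
    exact hc.filter_mono nhdsWithin_le_nhds
  obtain ⟨q, hq, hqs⟩ := (hN_eq.and eventually_mem_nhdsWithin).exists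
  exact (sub_eq_zero.1 (hy s (NNReal.coe_le_coe.1 hs.2) ⟨q, hqs, hq⟩)).symm

section RightContinuousPaths

lemma measurable_of_rightContinuous {E : Type*} [TopologicalSpace E]
    [TopologicalSpace.PseudoMetrizableSpace E] [MeasurableSpace E] [BorelSpace E] {x : ℝ≥0 → E}
    (hx : ∀ s, ContinuousWithinAt x (Set.Ici s) s) : Measurable x := by
  refine measurable_of_tendsto_metrizable (f := fun (n : ℕ) s => x (min s n)) (fun n => ?_) ?_
  · have h := measurableUpTo_of_rightContinuous (m := (⊤ : MeasurableSpace Unit)) (t := n)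
      (x := fun s _ => x s) (fun _ _ => measurable_const) (fun _ => hx)
    exact h.comp (measurable_id.prodMk (measurable_const (a := ())))
  · refine tendsto_pi_nhds.2 fun s => tendsto_const_nhds.congr' ?_
    filter_upwards [tendsto_natCast_atTop_atTop.eventually_ge_atTop s] with n hn
    rw [min_eq_left hn]

namespace IsCadlag

lemma comp {E F : Type*} [TopologicalSpace E] [TopologicalSpace F] {x : ℝ≥0 → E}
    (hx : IsCadlag x) {g : E → F} (hg : Continuous g) : IsCadlag fun t => g (x t) := fun t =>
  ⟨hg.continuousAt.comp_continuousWithinAt (hx t).1,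
    (hx t).2.imp' g fun l hl => (hg.tendsto l).comp hl⟩

lemma measurable {E : Type*} [TopologicalSpace E] [TopologicalSpace.PseudoMetrizableSpace E]
    [MeasurableSpace E] [BorelSpace E] {x : ℝ≥0 → E} (hx : IsCadlag x) : Measurable x :=
  measurable_of_rightContinuous fun s => (hx s).1

lemma exists_enorm_le {E : Type*} [SeminormedAddCommGroup E] {x : ℝ≥0 → E} (hx : IsCadlag x)
    (T : ℝ≥0) : ∃ C : ℝ≥0, ∀ s ≤ T, ‖x s‖ₑ ≤ C := by
  have hbounded : Bornology.IsBounded (x '' Set.Icc 0 T) := by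
    refine isCompact_Icc.induction_on (p := fun A => Bornology.IsBounded (x '' A)) (by simp)
      (fun A B hAB hB => hB.subset (Set.image_mono hAB))
      (fun A B hA hB => Set.image_union x A B ▸ hA.union hB) fun t _ => ?_
    obtain ⟨hright, l, hleft⟩ := hx t
    obtain ⟨A, hA, hAb⟩ := Metric.exists_isBounded_image_of_tendsto hleft
    obtain ⟨B, hB, hBb⟩ := Metric.exists_isBounded_image_of_tendsto hright
    refine ⟨A ∪ B, mem_nhdsWithin_of_mem_nhds ?_, Set.image_union x A B ▸ hAb.union hBb⟩
    rw [← nhdsLT_sup_nhdsGE]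
    exact union_mem_sup hA hB
  obtain ⟨C, hC⟩ := hbounded.exists_norm_le
  refine ⟨C.toNNReal, fun s hs => ?_⟩
  rw [← ofReal_norm]
  exact ENNReal.ofReal_le_ofReal (hC _ ⟨s, ⟨zero_le, hs⟩, rfl⟩)

end IsCadlag

lemma MeasurableUpTo.comp_time {E F : Type*} [MeasurableSpace E] [MeasurableSpace F]
    {m : MeasurableSpace Ω} {t : ℝ≥0} {y : ℝ≥0 → Ω → E} (hy : MeasurableUpTo m t y)
    {g : ℝ≥0 × E → F} (hg : Measurable g) : MeasurableUpTo m t (fun s ω => g (s, y s ω)) :=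
  hg.comp (((@measurable_fst _ _ _ m).min measurable_const).prodMk hy)

end RightContinuousPaths

lemma enorm_sum_mul_le {ι : Type*} [Fintype ι] (w a : ι → ℝ) {c : ℝ≥0∞} (ha : ∀ i, ‖a i‖ₑ ≤ c) :
    ‖∑ i, w i * a i‖ₑ ≤ Fintype.card ι * (c * ‖w‖ₑ) := by
  refine (enorm_sum_le _ _).trans ((Finset.sum_le_card_nsmul _ _ _ fun i _ => ?_).trans_eq
    (nsmul_eq_mul _ _))
  rw [enorm_mul, mul_comm c]
  gcongr
  exacts [enorm_le_iff_norm_le.2 (norm_le_pi_norm w i), ha i]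

namespace Model

section Clock

variable (𝓜 : Model) (η : Kernel (ℝ≥0 × ℝ) ℝ) (s : ℝ≥0) (y : ℝ)

/-- The rate of the random clock in which the coefficients of the Zakai equation, written as a
linear system for the point masses, are bounded. -/
def clock : ℝ≥0∞ := 1 + η (s, y) Set.univ + ∑ u, ‖𝓜.ratio s u y‖ₑ ^ 2

/-- The drift of the mass of the point `u` in the linear system for the vector `w` of the point
masses, relative to the Brownian motion of the observation: `φ` is a test function that is the
indicator of `u` on the state space, `x` the state of the signal, `y` that of the observation and
`yl` the left limit of the observation. -/
def linearDrift (φ : ℝ → ℝ) (u : 𝓜.S) (x : 𝓜.S) (yl : ℝ) (w : 𝓜.S → ℝ) : ℝ :=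
  (∑ v, w v * (𝓜.driftCoeff φ s v y + (η (s, yl)).real Set.univ * φ v)) +
    𝓜.ratio s u y * w u * 𝓜.ratio s x y

lemma measurable_ratio (u : 𝓜.S) : Measurable fun p : ℝ≥0 × ℝ => 𝓜.ratio p.1 u p.2 :=
  (𝓜.measurable_b1 u).div 𝓜.measurable_sigma1

lemma measurable_clock : Measurable fun p : ℝ≥0 × ℝ => 𝓜.clock η p.1 p.2 :=
  (measurable_const.add (η.measurable_coe MeasurableSet.univ)).add
    (Finset.measurable_fun_sum _ fun u _ => (𝓜.measurable_ratio u).enorm.pow_const 2)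

lemma one_le_clock : 1 ≤ 𝓜.clock η s y := le_self_add.trans le_self_add

lemma kernel_univ_le_clock : η (s, y) Set.univ ≤ 𝓜.clock η s y :=
  le_add_self.trans le_self_add

lemma enorm_ratio_sq_le_clock (u : 𝓜.S) : ‖𝓜.ratio s u y‖ₑ ^ 2 ≤ 𝓜.clock η s y :=
  (Finset.single_le_sum (f := fun u => ‖𝓜.ratio s u y‖ₑ ^ 2) (fun _ _ => zero_le)
    (Finset.mem_univ u)).trans le_add_self

lemma enorm_ratio_le_clock (u : 𝓜.S) : ‖𝓜.ratio s u y‖ₑ ≤ 𝓜.clock η s y := by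
  rcases le_total ‖𝓜.ratio s u y‖ₑ 1 with h | h
  · exact h.trans (𝓜.one_le_clock η s y)
  · exact (le_self_pow₀ h two_ne_zero).trans (𝓜.enorm_ratio_sq_le_clock η s y u)

lemma enorm_ratio_mul_ratio_le_clock (u v : 𝓜.S) :
    ‖𝓜.ratio s u y * 𝓜.ratio s v y‖ₑ ≤ 𝓜.clock η s y := by
  rw [enorm_mul]
  rcases le_total ‖𝓜.ratio s u y‖ₑ ‖𝓜.ratio s v y‖ₑ with h | h
  · exact (mul_le_mul_left h _).trans ((sq _).ge.trans (𝓜.enorm_ratio_sq_le_clock η s y v))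
  · exact (mul_le_mul_right h _).trans ((sq _).ge.trans (𝓜.enorm_ratio_sq_le_clock η s y u))

lemma linearDrift_sub (φ : ℝ → ℝ) (u x : 𝓜.S) (yl : ℝ) (w w' : 𝓜.S → ℝ) :
    𝓜.linearDrift η s y φ u x yl (w - w') =
      𝓜.linearDrift η s y φ u x yl w - 𝓜.linearDrift η s y φ u x yl w' := by
  simp only [linearDrift, Pi.sub_apply, sub_mul, mul_sub, Finset.sum_sub_distrib]
  ring

lemma exists_enorm_driftCoeff_add_le {φ : ℝ → ℝ} {B : ℝ} (hφ : ∀ x, |φ x| ≤ B) :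
    ∃ C : ℝ≥0, ∀ s y v, ‖𝓜.driftCoeff φ s v y + (η (s, y)).real Set.univ * φ v‖ₑ ≤
      C * 𝓜.clock η s y := by
  refine ⟨(3 * B * 𝓜.nu.real Set.univ).toNNReal + B.toNNReal, fun s y v => ?_⟩
  have hcoeff : ‖𝓜.driftCoeff φ s v y‖ₑ ≤ (3 * B * 𝓜.nu.real Set.univ).toNNReal := by
    rw [Real.enorm_eq_ofReal_abs]
    exact ENNReal.ofReal_le_ofReal (𝓜.abs_driftCoeff_le hφ s v y)
  have hkernel : ‖(η (s, y)).real Set.univ‖ₑ ≤ η (s, y) Set.univ :=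
    (Real.enorm_eq_ofReal measureReal_nonneg).trans_le ENNReal.ofReal_toReal_le
  have htest : ‖φ v‖ₑ ≤ B.toNNReal := by
    rw [Real.enorm_eq_ofReal_abs]
    exact ENNReal.ofReal_le_ofReal (hφ v)
  calc ‖𝓜.driftCoeff φ s v y + (η (s, y)).real Set.univ * φ v‖ₑ
      ≤ (3 * B * 𝓜.nu.real Set.univ).toNNReal * 1 + B.toNNReal * η (s, y) Set.univ := by
        refine (enorm_add_le _ _).trans ?_
        rw [enorm_mul, mul_one, mul_comm]
        gcongr
    _ ≤ (3 * B * 𝓜.nu.real Set.univ).toNNReal * 𝓜.clock η s y +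
        B.toNNReal * 𝓜.clock η s y := by
        gcongr
        · exact 𝓜.one_le_clock η s y
        · exact 𝓜.kernel_univ_le_clock η s y
    _ = _ := by rw [ENNReal.coe_add, add_mul]

lemma exists_enorm_linearDrift_le {φ : ℝ → ℝ} {B : ℝ} (hφ : ∀ x, |φ x| ≤ B) :
    ∃ C : ℝ≥0, ∀ s y u x w,
      ‖𝓜.linearDrift η s y φ u x y w‖ₑ ≤ C * (𝓜.clock η s y * ‖w‖ₑ) := by
  obtain ⟨C, hC⟩ := 𝓜.exists_enorm_driftCoeff_add_le η hφ
  refine ⟨Fintype.card 𝓜.S * C + 1, fun s y u x w => ?_⟩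
  have hsum := enorm_sum_mul_le w _ fun v => hC s y v
  have hratio : ‖𝓜.ratio s u y * w u * 𝓜.ratio s x y‖ₑ ≤ ‖w‖ₑ * 𝓜.clock η s y := by
    rw [mul_right_comm, enorm_mul, mul_comm]
    gcongr
    exacts [enorm_le_iff_norm_le.2 (norm_le_pi_norm w u),
      𝓜.enorm_ratio_mul_ratio_le_clock η s y u x]
  refine (enorm_add_le _ _).trans ((add_le_add hsum hratio).trans_eq ?_)
  push_cast
  ring

end Clock

lemma measurable_along (𝓜 : Model) {f : ℝ≥0 → 𝓜.S → ℝ → ℝ}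
    (hf : ∀ u, Measurable fun p : ℝ≥0 × ℝ => f p.1 u p.2) {x : ℝ≥0 → 𝓜.S} {y : ℝ≥0 → ℝ}
    (hx : Measurable x) (hy : Measurable y) : Measurable fun s => f s (x s) (y s) := by
  have h : Measurable fun p : 𝓜.S × (ℝ≥0 × ℝ) => f p.2.1 p.1 p.2.2 :=
    measurable_from_prod_countable_right hf
  exact h.comp (hx.prodMk (measurable_id.prodMk hy))

lemma IsSolution.ae_intervalIntegrable_b1 {𝓜 : Model} {𝓕 : Filtration ℝ≥0 mΩ} {T : ℝ≥0}
    {W : ℝ≥0 → Ω → ℝ} {N : 𝓜.S × 𝓜.S → ℝ≥0 → Ω → ℕ} {X : ℝ≥0 → Ω → 𝓜.S} {Y : ℝ≥0 → Ω → ℝ}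
    (hXY : 𝓜.IsSolution P 𝓕 T W N X Y) : ∀ᵐ ω ∂P, IntervalIntegrable
      (fun s : ℝ => 𝓜.b1 s.toNNReal (X s.toNNReal ω) (Y s.toNNReal ω)) volume 0 T := by
  filter_upwards [hXY.integrable_b1, hXY.cadlag_X, hXY.cadlag_Y] with ω hb hX hY
  exact intervalIntegrable_of_timeLIntegral_lt_top (R := fun s => 𝓜.b1 s (X s ω) (Y s ω))
    ((𝓜.measurable_along 𝓜.measurable_b1 hX.measurable hY.measurable).comp
      measurable_real_toNNReal).aestronglyMeasurable hb

end Model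

namespace Model

/-- A path of the signal and of the observation along which the coefficients of the Zakai equation
are integrable. -/
structure IsRegularPath (𝓜 : Model) (η : Kernel (ℝ≥0 × ℝ) ℝ) (T : ℝ≥0) (x : ℝ≥0 → 𝓜.S)
    (y : ℝ≥0 → ℝ) : Prop where
  measurable_signal : Measurable x
  measurable_observation : Measurable y
  leftLim_eq : ∀ᵐ s ∂volume.restrict (Set.Icc (0 : ℝ) T),
    Function.leftLim y s.toNNReal = y s.toNNReal
  clock_lt_top : timeLIntegral (fun s => 𝓜.clock η s (y s)) T < ∞

namespace IsRegularPath

variable {𝓜 : Model} {η : Kernel (ℝ≥0 × ℝ) ℝ} {T : ℝ≥0} {x : ℝ≥0 → 𝓜.S} {y : ℝ≥0 → ℝ}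

lemma ratio_sq_lt_top (h : 𝓜.IsRegularPath η T x y) :
    timeLIntegral (fun s => ‖𝓜.ratio s (x s) (y s)‖ₑ ^ 2) T < ∞ :=
  (lintegral_mono fun _ => 𝓜.enorm_ratio_sq_le_clock η _ _ _).trans_lt h.clock_lt_top

lemma measurable_ratio_along (h : 𝓜.IsRegularPath η T x y) :
    Measurable fun s => 𝓜.ratio s (x s) (y s) :=
  𝓜.measurable_along 𝓜.measurable_ratio h.measurable_signal h.measurable_observation

lemma measurable_ratio_state (h : 𝓜.IsRegularPath η T x y) (u : 𝓜.S) :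
    Measurable fun s => 𝓜.ratio s u (y s) :=
  𝓜.measurable_along 𝓜.measurable_ratio measurable_const h.measurable_observation

lemma intervalIntegrable_of_enorm_le {E : Type*} [SeminormedAddCommGroup E]
    (h : 𝓜.IsRegularPath η T x y) {f : ℝ≥0 → ℝ}
    (hf : AEStronglyMeasurable (fun s : ℝ => f s.toNNReal) (volume.restrict (Set.Icc 0 T)))
    {w : ℝ≥0 → E} (hw : IsCadlag w) {C : ℝ≥0}
    (hC : ∀ᵐ s ∂volume.restrict (Set.Icc (0 : ℝ) T), ‖f s.toNNReal‖ₑ ≤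
      C * (𝓜.clock η s.toNNReal (y s.toNNReal) * ‖w s.toNNReal‖ₑ)) :
    IntervalIntegrable (fun s : ℝ => f s.toNNReal) volume 0 T := by
  obtain ⟨D, hD⟩ := hw.exists_enorm_le T
  suffices hbound : timeLIntegral (fun s => ‖f s‖ₑ) T ≤
      C * D * timeLIntegral (fun s => 𝓜.clock η s (y s)) T from
    intervalIntegrable_of_timeLIntegral_lt_top hf <| hbound.trans_lt <|
      ENNReal.mul_lt_top (ENNReal.mul_lt_top ENNReal.coe_lt_top ENNReal.coe_lt_top) h.clock_lt_top
  unfold timeLIntegral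
  rw [← lintegral_const_mul' _ _ (ENNReal.mul_ne_top ENNReal.coe_ne_top ENNReal.coe_ne_top)]
  refine lintegral_mono_ae ?_
  filter_upwards [hC, ae_restrict_mem measurableSet_Icc] with s hs hsT
  refine hs.trans ?_
  rw [mul_assoc, mul_comm (D : ℝ≥0∞)]
  gcongr
  exact hD _ (Real.toNNReal_le_iff_le_coe.2 hsT.2)

lemma intervalIntegrable_ratio (h : 𝓜.IsRegularPath η T x y) :
    IntervalIntegrable (fun s : ℝ => 𝓜.ratio s.toNNReal (x s.toNNReal) (y s.toNNReal))
      volume 0 T :=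
  intervalIntegrable_of_timeLIntegral_lt_top (R := fun s => 𝓜.ratio s (x s) (y s))
    (h.measurable_ratio_along.comp measurable_real_toNNReal).aestronglyMeasurable <|
    (lintegral_mono fun _ => 𝓜.enorm_ratio_le_clock η _ _ _).trans_lt h.clock_lt_top

lemma intervalIntegrable_filteredRatio {Y : ℝ≥0 → Ω → ℝ} {ω : Ω}
    (h : 𝓜.IsRegularPath η T x fun s => Y s ω) {π : ℝ≥0 → Ω → ProbabilityMeasure 𝓜.S}
    (hπ : IsCadlag fun t => π t ω) :
    IntervalIntegrable (fun s : ℝ => 𝓜.filteredRatio Y π s.toNNReal ω) volume 0 T := by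
  have hmasses : IsCadlag fun s => pointMasses (π s ω).toFiniteMeasure :=
    hπ.comp (continuous_pointMasses.comp ProbabilityMeasure.toFiniteMeasure_continuous)
  have hsum (s : ℝ≥0) : 𝓜.filteredRatio Y π s ω =
      ∑ v, pointMasses (π s ω).toFiniteMeasure v * 𝓜.ratio s v (Y s ω) := by
    rw [filteredRatio, integral_fintype Integrable.of_finite]
    rfl
  refine h.intervalIntegrable_of_enorm_le (f := fun s => 𝓜.filteredRatio Y π s ω)
    (C := Fintype.card 𝓜.S) ?_ hmasses (ae_of_all _ fun s => ?_)
  · simp only [hsum]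
    exact ((Finset.measurable_fun_sum _ fun v _ => (hmasses.measurable.eval (a := v)).mul
      (h.measurable_ratio_state v)).comp measurable_real_toNNReal).aestronglyMeasurable
  · rw [hsum]
    exact enorm_sum_mul_le _ _ fun v => 𝓜.enorm_ratio_le_clock η _ _ v

lemma Wtilde_eq {W Y : ℝ≥0 → Ω → ℝ} {X : ℝ≥0 → Ω → 𝓜.S} {π : ℝ≥0 → Ω → ProbabilityMeasure 𝓜.S}
    {ω : Ω} (h : 𝓜.IsRegularPath η T (fun s => X s ω) fun s => Y s ω)
    (hπ : IsCadlag fun t => π t ω) {t : ℝ≥0} (ht : t ≤ T) :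
    𝓜.Wtilde W X Y π t ω =
      W t ω + timeIntegral (fun s => 𝓜.ratio s (X s ω) (Y s ω)) t := by
  unfold Wtilde innovation timeIntegral
  rw [intervalIntegral.integral_sub (intervalIntegrable_of_le h.intervalIntegrable_ratio ht)
    (intervalIntegrable_of_le (h.intervalIntegrable_filteredRatio hπ) ht)]
  ring

lemma measurable_linearDrift (h : 𝓜.IsRegularPath η T x y) (φ : ℝ → ℝ) (u : 𝓜.S)
    {w : ℝ≥0 → 𝓜.S → ℝ} (hw : Measurable w) :
    Measurable fun s => 𝓜.linearDrift η s (y s) φ u (x s) (y s) (w s) := by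
  have hcoeff (v : 𝓜.S) : Measurable fun s => 𝓜.driftCoeff φ s v (y s) :=
    𝓜.measurable_along (𝓜.measurable_driftCoeff φ) measurable_const h.measurable_observation
  have hkernel : Measurable fun s => (η (s, y s)).real Set.univ :=
    ((η.measurable_coe MeasurableSet.univ).comp
      (measurable_id.prodMk h.measurable_observation)).ennreal_toReal
  exact (Finset.measurable_fun_sum _ fun v _ =>
    hw.eval.mul ((hcoeff v).add (hkernel.mul_const _))).add
      (((h.measurable_ratio_state u).mul hw.eval).mul h.measurable_ratio_along)

lemma intervalIntegrable_linearDrift (h : 𝓜.IsRegularPath η T x y) {φ : ℝ → ℝ} {B : ℝ}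
    (hφ : ∀ x, |φ x| ≤ B) (u : 𝓜.S) {w : ℝ≥0 → 𝓜.S → ℝ} (hw : IsCadlag w) :
    IntervalIntegrable (fun s : ℝ => 𝓜.linearDrift η s.toNNReal (y s.toNNReal) φ u (x s.toNNReal)
      (Function.leftLim y s.toNNReal) (w s.toNNReal)) volume 0 T := by
  obtain ⟨C, hC⟩ := 𝓜.exists_enorm_linearDrift_le η hφ
  refine h.intervalIntegrable_of_enorm_le (f := fun s =>
    𝓜.linearDrift η s (y s) φ u (x s) (Function.leftLim y s) (w s)) (C := C) ?_ hw ?_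
  · refine ((h.measurable_linearDrift φ u hw.measurable).comp
      measurable_real_toNNReal).aestronglyMeasurable.congr ?_
    filter_upwards [h.leftLim_eq] with s hs
    rw [hs, Function.comp_apply]
  · filter_upwards [h.leftLim_eq] with s hs
    rw [hs]
    exact hC _ _ _ _ _

lemma intervalIntegrable_ratio_mul (h : 𝓜.IsRegularPath η T x y) (u : 𝓜.S)
    {w : ℝ≥0 → 𝓜.S → ℝ} (hw : IsCadlag w) :
    IntervalIntegrable (fun s : ℝ => 𝓜.ratio s.toNNReal u (y s.toNNReal) * w s.toNNReal u *
      𝓜.ratio s.toNNReal (x s.toNNReal) (y s.toNNReal)) volume 0 T := by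
  refine h.intervalIntegrable_of_enorm_le (C := 1)
    (f := fun s => 𝓜.ratio s u (y s) * w s u * 𝓜.ratio s (x s) (y s))
    ((((h.measurable_ratio_state u).mul hw.measurable.eval).mul h.measurable_ratio_along).comp
      measurable_real_toNNReal).aestronglyMeasurable hw (ae_of_all _ fun s => ?_)
  rw [mul_right_comm, enorm_mul, ENNReal.coe_one, one_mul]
  gcongr
  exacts [𝓜.enorm_ratio_mul_ratio_le_clock η _ _ _ _,
    enorm_le_iff_norm_le.2 (norm_le_pi_norm _ u)]

end IsRegularPath

lemma timeLIntegral_clock_lt_top {𝓜 : Model} {η : Kernel (ℝ≥0 × ℝ) ℝ} {T : ℝ≥0} {y : ℝ≥0 → ℝ}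
    (hy : Measurable y) (hη : timeLIntegral (fun s => η (s, y s) Set.univ) T < ∞)
    (hratio : ∀ u : 𝓜.S, timeLIntegral (fun s => ‖𝓜.ratio s u (y s)‖ₑ ^ 2) T < ∞) :
    timeLIntegral (fun s => 𝓜.clock η s (y s)) T < ∞ := by
  have hpath : Measurable fun s : ℝ => (s.toNNReal, y s.toNNReal) :=
    measurable_real_toNNReal.prodMk (hy.comp measurable_real_toNNReal)
  have hkernel : Measurable fun s : ℝ => η (s.toNNReal, y s.toNNReal) Set.univ :=
    (η.measurable_coe MeasurableSet.univ).comp hpath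
  have hratio_meas (u : 𝓜.S) : Measurable fun s : ℝ => ‖𝓜.ratio s.toNNReal u (y s.toNNReal)‖ₑ ^ 2 :=
    ((𝓜.measurable_ratio u).comp hpath).enorm.pow_const 2
  simp only [timeLIntegral, clock]
  rw [lintegral_add_left (hkernel.const_add 1), lintegral_add_left measurable_const,
    lintegral_finsetSum _ fun u _ => hratio_meas u]
  exact ENNReal.add_lt_top.2 ⟨ENNReal.add_lt_top.2 ⟨by simp, hη⟩,
    ENNReal.sum_lt_top.2 fun u _ => hratio u⟩

end Model

lemma continuousWithinAt_Ici_indicator {E : Type*} [TopologicalSpace E] [Zero E]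
    {x : ℝ≥0 → Ω → E} {A : Set Ω}
    (hx : ∀ ω ∈ A, ∀ t, ContinuousWithinAt (fun s => x s ω) (Set.Ici t) t) (ω : Ω) (t : ℝ≥0) :
    ContinuousWithinAt (fun s => A.indicator (x s) ω) (Set.Ici t) t := by
  by_cases hω : ω ∈ A
  · simpa only [Set.indicator_of_mem hω] using hx ω hω t
  · simpa only [Set.indicator_of_notMem hω] using continuousWithinAt_const

lemma measurableUpTo_indicator_of_isCadlag {E : Type*} [TopologicalSpace E]
    [TopologicalSpace.PseudoMetrizableSpace E] [MeasurableSpace E] [BorelSpace E] [Zero E]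
    {m : MeasurableSpace Ω} {t : ℝ≥0} {x : ℝ≥0 → Ω → E} (hx : ∀ s ≤ t, Measurable[m] (x s))
    {A : Set Ω} (hA : MeasurableSet[m] A) (hxA : ∀ ω ∈ A, IsCadlag fun s => x s ω) :
    MeasurableUpTo m t fun s => A.indicator (x s) :=
  measurableUpTo_of_rightContinuous (fun s hs => (hx s hs).indicator hA)
    (continuousWithinAt_Ici_indicator fun ω hω s => (hxA ω hω s).1)

namespace Model

lemma ae_clock_lt_top {𝓜 : Model} {η : Kernel (ℝ≥0 × ℝ) ℝ} {T : ℝ≥0} {Y : ℝ≥0 → Ω → ℝ}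
    (hY : ∀ t, Measurable (Y t)) (hYc : ∀ᵐ ω ∂P, IsCadlag fun t => Y t ω)
    (hleft : ∀ᵐ ω ∂P, ∀ᵐ s ∂volume.restrict (Set.Icc (0 : ℝ) T),
      Function.leftLim (fun r => Y r ω) s.toNNReal = Y s.toNNReal ω)
    (hη : ∫⁻ ω, timeLIntegral
      (fun s => η (s, Function.leftLim (fun r => Y r ω) s) Set.univ) T ∂P < ∞)
    (hratio : ∀ u : 𝓜.S, ∀ᵐ ω ∂P, timeLIntegral (fun s => ‖𝓜.ratio s u (Y s ω)‖ₑ ^ 2) T < ∞) :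
    ∀ᵐ ω ∂P, timeLIntegral (fun s => 𝓜.clock η s (Y s ω)) T < ∞ := by
  obtain ⟨A, hA, hAm, hAc⟩ := hYc.exists_measurable_mem
  have hkernel : Measurable fun ω =>
      timeLIntegral (fun s => η (s, A.indicator (Y s) ω) Set.univ) T :=
    ((measurableUpTo_indicator_of_isCadlag (fun s _ => hY s) hAm hAc).comp_time
      (η.measurable_coe MeasurableSet.univ)).lintegral 0
  have hkernel_eq : ∀ᵐ ω ∂P, timeLIntegral (fun s => η (s, A.indicator (Y s) ω) Set.univ) T =
      timeLIntegral (fun s => η (s, Function.leftLim (fun r => Y r ω) s) Set.univ) T := by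
    filter_upwards [hA, hleft] with ω hω hleft
    refine lintegral_congr_ae ?_
    filter_upwards [hleft] with s hs
    rw [Set.indicator_of_mem hω, hs]
  filter_upwards [ae_lt_top hkernel ((lintegral_congr_ae hkernel_eq).trans_lt hη).ne, hA,
    ae_all_iff.2 hratio] with ω hη hω hratio
  simp only [Set.indicator_of_mem hω] at hη
  exact timeLIntegral_clock_lt_top (hAc ω hω).measurable hη hratio

end Model

lemma timeLIntegral_eq_zero_of_forall_lt {f : ℝ≥0 → ℝ≥0∞} {t : ℝ≥0} (hf : ∀ s < t, f s = 0) :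
    timeLIntegral f t = 0 := by
  rw [timeLIntegral, setLIntegral_congr Ico_ae_eq_Icc.symm]
  refine setLIntegral_eq_zero measurableSet_Ico fun s hs => ?_
  exact hf _ ((Real.toNNReal_lt_iff_lt_coe hs.1).2 hs.2)

lemma SimpleIntegrand.tendsto_value_sub {𝓖 : Filtration ℝ≥0 mΩ} {H H' : ℕ → SimpleIntegrand 𝓖}
    {h h' : ℝ≥0 → ℝ} {T : ℝ≥0} {ω : Ω} (hm : Measurable h)
    (hH : Tendsto (fun n => timeLIntegral (fun s => ‖(H n).value s ω - h s‖ₑ ^ 2) T) atTop (𝓝 0))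
    (hH' : Tendsto (fun n => timeLIntegral (fun s => ‖(H' n).value s ω - h' s‖ₑ ^ 2) T) atTop
      (𝓝 0)) :
    Tendsto (fun n => timeLIntegral (fun s =>
      ‖(H n).value s ω - (H' n).value s ω - (h s - h' s)‖ₑ ^ 2) T) atTop (𝓝 0) := by
  have hlim := ENNReal.Tendsto.const_mul (a := 2) (hH.add hH') (Or.inr (by simp))
  rw [add_zero, mul_zero] at hlim
  refine tendsto_of_tendsto_of_tendsto_of_le_of_le tendsto_const_nhds hlim (fun n => zero_le)
    fun n => ?_
  have hmeas : Measurable fun s : ℝ => ‖(H n).value s.toNNReal ω - h s.toNNReal‖ₑ ^ 2 :=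
    (((H n).measurable_value_path ω).sub (hm.comp measurable_real_toNNReal)).enorm.pow_const 2
  unfold timeLIntegral
  rw [← lintegral_add_left hmeas, ← lintegral_const_mul' _ _ (by simp)]
  refine lintegral_mono fun s => ?_
  beta_reduce
  rw [sub_sub_sub_comm]
  exact (pow_le_pow_left₀ zero_le enorm_sub_le 2).trans (ennreal_add_sq_le _ _)

lemma enorm_pi_le {ι : Type*} [Fintype ι] {w : ι → ℝ} {a : ℝ≥0∞} (h : ∀ i, ‖w i‖ₑ ≤ a) :
    ‖w‖ₑ ≤ a := by
  induction a with
  | top => exact le_top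
  | coe a => exact ENNReal.coe_le_coe.2 ((pi_nnnorm_le_iff).2 fun i => ENNReal.coe_le_coe.1 (h i))

namespace Model

section MassEquation

variable {𝓜 : Model} {η : Kernel (ℝ≥0 × ℝ) ℝ} {T : ℝ≥0}

lemma IsRegularPath.timeIntegral_zakaiDrift_eq {X : ℝ≥0 → Ω → 𝓜.S} {Y : ℝ≥0 → Ω → ℝ} {ω : Ω}
    (h : 𝓜.IsRegularPath η T (fun s => X s ω) fun s => Y s ω) {φ : ℝ → ℝ} {B : ℝ}
    (hφ : ∀ x, |φ x| ≤ B) (u : 𝓜.S) {ξ : ℝ≥0 → Ω → FiniteMeasure 𝓜.S}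
    (hξ : IsCadlag fun t => ξ t ω) {t : ℝ≥0} (ht : t ≤ T) :
    timeIntegral (fun s => 𝓜.zakaiDrift Y η (fun _ => φ) ξ s ω) t =
      timeIntegral (fun s => 𝓜.linearDrift η s (Y s ω) φ u (X s ω)
        (Function.leftLim (fun r => Y r ω) s) (pointMasses (ξ s ω))) t -
      timeIntegral (fun s => 𝓜.ratio s u (Y s ω) * pointMasses (ξ s ω) u *
        𝓜.ratio s (X s ω) (Y s ω)) t := by
  have hmasses := hξ.comp continuous_pointMasses
  unfold timeIntegral
  rw [← intervalIntegral.integral_sub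
    (intervalIntegrable_of_le (h.intervalIntegrable_linearDrift hφ u hmasses) ht)
    (intervalIntegrable_of_le (h.intervalIntegrable_ratio_mul u hmasses) ht)]
  simp only [𝓜.zakaiDrift_eq_sum, linearDrift, add_sub_cancel_right]

lemma IsRegularPath.enorm_timeIntegral_linearDrift_sub_le {x : ℝ≥0 → 𝓜.S} {y : ℝ≥0 → ℝ}
    (h : 𝓜.IsRegularPath η T x y) {φ : ℝ → ℝ} {B : ℝ} (hφ : ∀ x, |φ x| ≤ B) {C : ℝ≥0}
    (hC : ∀ s y u x w, ‖𝓜.linearDrift η s y φ u x y w‖ₑ ≤ C * (𝓜.clock η s y * ‖w‖ₑ)) (u : 𝓜.S)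
    {w w' : ℝ≥0 → 𝓜.S → ℝ} (hw : IsCadlag w) (hw' : IsCadlag w') {t : ℝ≥0} (ht : t ≤ T) :
    ‖timeIntegral (fun s => 𝓜.linearDrift η s (y s) φ u (x s) (Function.leftLim y s) (w s)) t -
      timeIntegral (fun s => 𝓜.linearDrift η s (y s) φ u (x s) (Function.leftLim y s) (w' s)) t‖ₑ ≤
      C * timeLIntegral (fun s => 𝓜.clock η s (y s) * ‖w s - w' s‖ₑ) t := by
  have hsub : timeIntegral (fun s =>
        𝓜.linearDrift η s (y s) φ u (x s) (Function.leftLim y s) (w s - w' s)) t =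
      timeIntegral (fun s =>
        𝓜.linearDrift η s (y s) φ u (x s) (Function.leftLim y s) (w s)) t -
      timeIntegral (fun s =>
        𝓜.linearDrift η s (y s) φ u (x s) (Function.leftLim y s) (w' s)) t := by
    unfold timeIntegral
    rw [← intervalIntegral.integral_sub
      (intervalIntegrable_of_le (h.intervalIntegrable_linearDrift hφ u hw) ht)
      (intervalIntegrable_of_le (h.intervalIntegrable_linearDrift hφ u hw') ht)]
    simp only [linearDrift_sub]
  rw [← hsub]
  refine (enorm_timeIntegral_le _ _).trans ?_
  unfold timeLIntegral
  rw [← lintegral_const_mul' _ _ ENNReal.coe_ne_top]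
  refine lintegral_mono_ae ?_
  filter_upwards [ae_restrict_of_ae_restrict_of_subset
    (Set.Icc_subset_Icc_right (NNReal.coe_le_coe.2 ht)) h.leftLim_eq] with s hs
  rw [hs]
  exact hC _ _ _ _ _

/-- Along the outcome `ω`, the mass `ξ t ω {u}` solves the linear equation with drift
`Model.linearDrift`, continuous martingale part `m` and the jumps of the Zakai equation. The
function `φ` is the test function of the Zakai equation that gives this equation. -/
structure SolvesMassEquation (𝓜 : Model) (η : Kernel (ℝ≥0 × ℝ) ℝ) (T : ℝ≥0) (φ : ℝ → ℝ) (u : 𝓜.S)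
    (X : ℝ≥0 → Ω → 𝓜.S) (Y : ℝ≥0 → Ω → ℝ) (ξ : ℝ≥0 → Ω → FiniteMeasure 𝓜.S) (ω : Ω)
    (m : ℝ≥0 → ℝ) : Prop where
  isCadlag : IsCadlag fun t => ξ t ω
  continuousOn : ContinuousOn m (Set.Iic T)
  map_zero : m 0 = 0
  equation : ∀ t ≤ T, pointMasses (ξ t ω) u = φ 𝓜.x0 +
    timeIntegral (fun s => 𝓜.linearDrift η s (Y s ω) φ u (X s ω)
      (Function.leftLim (fun r => Y r ω) s) (pointMasses (ξ s ω))) t + m t +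
    ∑ᶠ s ∈ {s | s ∈ Set.Ioc 0 t ∧ jump (fun r => Y r ω) s ≠ 0},
      𝓜.zakaiJump Y η (fun _ => φ) ξ s ω (jump (fun r => Y r ω) s)

namespace SolvesMassEquation

variable {φ : ℝ → ℝ} {u : 𝓜.S} {X : ℝ≥0 → Ω → 𝓜.S} {Y : ℝ≥0 → Ω → ℝ}
  {ξ ξ' : ℝ≥0 → Ω → FiniteMeasure 𝓜.S} {ω : Ω} {m m' : ℝ≥0 → ℝ}

lemma enorm_sub_le (h : 𝓜.SolvesMassEquation η T φ u X Y ξ ω m)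
    (h' : 𝓜.SolvesMassEquation η T φ u X Y ξ' ω m')
    (hpath : 𝓜.IsRegularPath η T (fun s => X s ω) fun s => Y s ω) {B : ℝ}
    (hφ : ∀ x, |φ x| ≤ B) {C : ℝ≥0}
    (hC : ∀ s y u x w, ‖𝓜.linearDrift η s y φ u x y w‖ₑ ≤ C * (𝓜.clock η s y * ‖w‖ₑ))
    {t : ℝ≥0} (ht : t ≤ T)
    (hleft : ∀ s ∈ Set.Ioc 0 t, jump (fun r => Y r ω) s ≠ 0 → ∀ r < s, ξ r ω = ξ' r ω) :
    ‖pointMasses (ξ t ω) u - pointMasses (ξ' t ω) u - (m t - m' t)‖ₑ ≤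
      C * timeLIntegral (fun s => 𝓜.clock η s (Y s ω) *
        ‖pointMasses (ξ s ω) - pointMasses (ξ' s ω)‖ₑ) t := by
  have hjumps : ∑ᶠ s ∈ {s | s ∈ Set.Ioc 0 t ∧ jump (fun r => Y r ω) s ≠ 0},
        𝓜.zakaiJump Y η (fun _ => φ) ξ s ω (jump (fun r => Y r ω) s) =
      ∑ᶠ s ∈ {s | s ∈ Set.Ioc 0 t ∧ jump (fun r => Y r ω) s ≠ 0},
        𝓜.zakaiJump Y η (fun _ => φ) ξ' s ω (jump (fun r => Y r ω) s) :=
    finsum_mem_congr rfl fun s hs =>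
      zakaiJump_congr Y η _ hs.1.1 (hleft s hs.1 hs.2) h.isCadlag _
  refine le_of_eq_of_le (congrArg _ ?_) (hpath.enorm_timeIntegral_linearDrift_sub_le hφ hC u
    (h.isCadlag.comp continuous_pointMasses) (h'.isCadlag.comp continuous_pointMasses) ht)
  rw [h.equation t ht, h'.equation t ht, hjumps]
  ring

lemma sub_eq_sub_of_left (h : 𝓜.SolvesMassEquation η T φ u X Y ξ ω m)
    (h' : 𝓜.SolvesMassEquation η T φ u X Y ξ' ω m')
    (hpath : 𝓜.IsRegularPath η T (fun s => X s ω) fun s => Y s ω) {B : ℝ}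
    (hφ : ∀ x, |φ x| ≤ B) {t : ℝ≥0} (ht : t ≤ T) (hleft : ∀ r < t, ξ r ω = ξ' r ω) :
    pointMasses (ξ t ω) u - pointMasses (ξ' t ω) u = m t - m' t := by
  obtain ⟨C, hC⟩ := 𝓜.exists_enorm_linearDrift_le η hφ
  have hbound := h.enorm_sub_le h' hpath hφ hC ht fun s hs _ r hr =>
    hleft r (hr.trans_le hs.2)
  rw [timeLIntegral_eq_zero_of_forall_lt fun s hs => by rw [hleft s hs, sub_self, enorm_zero,
    mul_zero], mul_zero] at hbound
  exact sub_eq_zero.1 (enorm_eq_zero.1 (nonpos_iff_eq_zero.1 hbound))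

lemma eq_of_left (h : 𝓜.SolvesMassEquation η T φ u X Y ξ ω m)
    (h' : 𝓜.SolvesMassEquation η T φ u X Y ξ' ω m')
    (hpath : 𝓜.IsRegularPath η T (fun s => X s ω) fun s => Y s ω) {B : ℝ}
    (hφ : ∀ x, |φ x| ≤ B) {t : ℝ≥0} (ht : t ≤ T) (hleft : ∀ r < t, ξ r ω = ξ' r ω) :
    pointMasses (ξ t ω) u = pointMasses (ξ' t ω) u := by
  suffices hm : m t - m' t = 0 from
    sub_eq_zero.1 ((h.sub_eq_sub_of_left h' hpath hφ ht hleft).trans hm)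
  rcases eq_or_ne t 0 with rfl | ht0
  · rw [h.map_zero, h'.map_zero, sub_zero]
  have : (𝓝[<] t).NeBot := nhdsLT_neBot_of_exists_lt ⟨0, pos_iff_ne_zero.2 ht0⟩
  have hlim : Tendsto (m - m') (𝓝[<] t) (𝓝 (m t - m' t)) :=
    ((h.continuousOn.sub h'.continuousOn t ht).mono
      fun r (hr : r < t) => hr.le.trans ht).tendsto
  refine tendsto_nhds_unique hlim (tendsto_const_nhds.congr' ?_)
  filter_upwards [self_mem_nhdsWithin] with s (hs : s < t)
  rw [Pi.sub_apply, ← h.sub_eq_sub_of_left h' hpath hφ (hs.le.trans ht)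
    fun r hr => hleft r (hr.trans hs), hleft s hs, sub_self]

lemma enorm_pi_sub_le {φ : 𝓜.S → ℝ → ℝ} {m m' : ℝ≥0 → 𝓜.S → ℝ}
    (h : ∀ u, 𝓜.SolvesMassEquation η T (φ u) u X Y ξ ω fun t => m t u)
    (h' : ∀ u, 𝓜.SolvesMassEquation η T (φ u) u X Y ξ' ω fun t => m' t u)
    (hpath : 𝓜.IsRegularPath η T (fun s => X s ω) fun s => Y s ω) {B : 𝓜.S → ℝ}
    (hφ : ∀ u x, |φ u x| ≤ B u) {C : 𝓜.S → ℝ≥0}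
    (hC : ∀ u s y v x w,
      ‖𝓜.linearDrift η s y (φ u) v x y w‖ₑ ≤ C u * (𝓜.clock η s y * ‖w‖ₑ))
    {t : ℝ≥0} (ht : t ≤ T)
    (hleft : ∀ s ∈ Set.Ioc 0 t, jump (fun r => Y r ω) s ≠ 0 → ∀ r < s, ξ r ω = ξ' r ω) :
    ‖pointMasses (ξ t ω) - pointMasses (ξ' t ω) - (m t - m' t)‖ₑ ≤
      (Finset.univ.sup C : ℝ≥0) * timeLIntegral (fun s => 𝓜.clock η s (Y s ω) *
        ‖pointMasses (ξ s ω) - pointMasses (ξ' s ω)‖ₑ) t := by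
  refine enorm_pi_le fun u => ?_
  refine ((h u).enorm_sub_le (h' u) hpath (hφ u) (hC u) ht hleft).trans ?_
  gcongr
  exact Finset.le_sup (Finset.mem_univ u)

end SolvesMassEquation

/-- Under `P` the observation noise `Model.Wtilde` is the Brownian motion `W` with a drift, which
moves into the drift of the equation. -/
lemma IsZakaiSolution.exists_solvesMassEquation {P₀ : Measure Ω} (hP : P ≪ P₀)
    {𝓨 : Filtration ℝ≥0 mΩ} {W Y : ℝ≥0 → Ω → ℝ} {X : ℝ≥0 → Ω → 𝓜.S}
    {π : ℝ≥0 → Ω → ProbabilityMeasure 𝓜.S} {ξ : ℝ≥0 → Ω → FiniteMeasure 𝓜.S}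
    (hξ : 𝓜.IsZakaiSolution P₀ 𝓨 T (𝓜.Wtilde W X Y π) Y η ξ)
    (hpath : ∀ᵐ ω ∂P, 𝓜.IsRegularPath η T (fun s => X s ω) fun s => Y s ω)
    (hπ : ∀ᵐ ω ∂P, IsCadlag fun t => π t ω) (hW : ∀ᵐ ω ∂P, Continuous fun t => W t ω)
    {φ : ℝ → ℝ} {u : 𝓜.S} (hφ : IsTestFunction fun _ => φ)
    (hφu : ∀ x : 𝓜.S, φ x = if x = u then 1 else 0) :
    ∃ (Hn : ℕ → SimpleIntegrand 𝓨) (M : ℝ≥0 → Ω → ℝ), ∀ᵐ ω ∂P,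
      𝓜.SolvesMassEquation η T φ u X Y ξ ω (fun t => M t ω) ∧
      Tendsto (fun n => timeLIntegral (fun s => ‖(Hn n).value s ω -
        𝓜.ratio s u (Y s ω) * pointMasses (ξ s ω) u‖ₑ ^ 2) T) atTop (𝓝 0) ∧
      ∀ t ≤ T, Tendsto (fun n => (Hn n).integral W t ω) atTop (𝓝 (M t ω)) := by
  obtain ⟨M, hM, heq⟩ := hξ.equation _ hφ
  obtain ⟨Hn, hHn⟩ := hM.exists_ae_tendsto
  obtain ⟨B, hB⟩ := hφ.bounded
  refine ⟨Hn, fun t ω => M t ω - timeIntegral (fun s => 𝓜.ratio s u (Y s ω) *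
    pointMasses (ξ s ω) u * 𝓜.ratio s (X s ω) (Y s ω)) t, ?_⟩
  filter_upwards [hP.ae_le heq, hP.ae_le hHn, hP.ae_le hξ.cadlag, hpath, hπ, hW]
    with ω heq ⟨hconv, hunif⟩ hξ hpath hπ hW
  have hmasses := hξ.comp continuous_pointMasses
  have hWtilde : ∀ t ≤ T, 𝓜.Wtilde W X Y π t ω =
      W t ω + timeIntegral (fun s => 𝓜.ratio s (X s ω) (Y s ω)) t := fun t ht =>
    hpath.Wtilde_eq hπ ht
  have hcont : ContinuousOn (fun t => 𝓜.Wtilde W X Y π t ω) (Set.Iic T) :=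
    (hW.continuousOn.add (continuousOn_timeIntegral hpath.intervalIntegrable_ratio)).congr hWtilde
  have hdrift := hpath.intervalIntegrable_ratio_mul u hmasses
  simp only [zakaiDiffusion_eq_ratio_mul hφu] at hconv
  have hlim : ∀ t ≤ T, Tendsto (fun n => (Hn n).integral W t ω) atTop (𝓝 (M t ω -
      timeIntegral (fun s => 𝓜.ratio s u (Y s ω) * pointMasses (ξ s ω) u *
        𝓜.ratio s (X s ω) (Y s ω)) t)) := fun t ht =>
    tendsto_integral_of_drift hWtilde hpath.intervalIntegrable_ratio hpath.ratio_sq_lt_top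
      (((hpath.measurable_ratio_state u).mul hmasses.measurable.eval).comp
        measurable_real_toNNReal).aestronglyMeasurable hdrift hconv ht (hunif.tendsto_at ht)
  refine ⟨⟨hξ, ?_, ?_, fun t ht => ?_⟩, hconv, hlim⟩
  · exact (hunif.continuousOn (Frequently.of_forall fun n =>
      (Hn n).continuousOn_integral hcont)).sub (continuousOn_timeIntegral hdrift)
  · refine tendsto_nhds_unique (hlim 0 zero_le) (tendsto_const_nhds.congr fun n => ?_)
    simp [SimpleIntegrand.integral]
  · rw [← pairing_eq_pointMasses hφu _ t, heq t ht,
      hpath.timeIntegral_zakaiDrift_eq (fun x => (hB 0 x).1) u hξ ht]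
    simp only [Set.mem_ofPred_eq]
    ring

/-- The equations `Model.SolvesMassEquation` for all states at once, together with elementary
integrands `H u` whose integrals against `W` approximate the martingale part `M u` of the mass at
`u`. -/
structure IsMassSystem (𝓜 : Model) (P : Measure Ω) (η : Kernel (ℝ≥0 × ℝ) ℝ) (T : ℝ≥0)
    (φ : 𝓜.S → ℝ → ℝ) (W : ℝ≥0 → Ω → ℝ) (X : ℝ≥0 → Ω → 𝓜.S) (Y : ℝ≥0 → Ω → ℝ)
    (ξ : ℝ≥0 → Ω → FiniteMeasure 𝓜.S) {𝓨 : Filtration ℝ≥0 mΩ} (H : 𝓜.S → ℕ → SimpleIntegrand 𝓨)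
    (M : ℝ≥0 → Ω → 𝓜.S → ℝ) : Prop where
  solves : ∀ᵐ ω ∂P, ∀ u, 𝓜.SolvesMassEquation η T (φ u) u X Y ξ ω fun t => M t ω u
  tendsto_value : ∀ u, ∀ᵐ ω ∂P, Tendsto (fun n => timeLIntegral (fun s => ‖(H u n).value s ω -
    𝓜.ratio s u (Y s ω) * pointMasses (ξ s ω) u‖ₑ ^ 2) T) atTop (𝓝 0)
  tendsto_integral : ∀ u, ∀ᵐ ω ∂P, ∀ t ≤ T,
    Tendsto (fun n => (H u n).integral W t ω) atTop (𝓝 (M t ω u))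

lemma IsZakaiSolution.exists_isMassSystem {P₀ : Measure Ω} (hP : P ≪ P₀)
    {𝓨 : Filtration ℝ≥0 mΩ} {W Y : ℝ≥0 → Ω → ℝ} {X : ℝ≥0 → Ω → 𝓜.S}
    {π : ℝ≥0 → Ω → ProbabilityMeasure 𝓜.S} {ξ : ℝ≥0 → Ω → FiniteMeasure 𝓜.S}
    (hξ : 𝓜.IsZakaiSolution P₀ 𝓨 T (𝓜.Wtilde W X Y π) Y η ξ)
    (hpath : ∀ᵐ ω ∂P, 𝓜.IsRegularPath η T (fun s => X s ω) fun s => Y s ω)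
    (hπ : ∀ᵐ ω ∂P, IsCadlag fun t => π t ω) (hW : ∀ᵐ ω ∂P, Continuous fun t => W t ω)
    {φ : 𝓜.S → ℝ → ℝ} (hφ : ∀ u, IsTestFunction fun _ => φ u)
    (hφu : ∀ u x : 𝓜.S, φ u x = if x = u then 1 else 0) :
    ∃ (H : 𝓜.S → ℕ → SimpleIntegrand 𝓨) (M : ℝ≥0 → Ω → 𝓜.S → ℝ),
      𝓜.IsMassSystem P η T φ W X Y ξ H M := by
  choose H M hM using fun u => hξ.exists_solvesMassEquation hP hpath hπ hW (hφ u) (hφu u)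
  exact ⟨H, fun t ω u => M u t ω, ae_all_iff.2 fun u => (hM u).mono fun _ h => h.1,
    fun u => (hM u).mono fun _ h => h.2.1, fun u => (hM u).mono fun _ h => h.2.2⟩

end MassEquation

end Model

lemma isRestartingSystem_indicator_sub {ι E : Type*} [NormedAddCommGroup E]
    [MeasurableSpace E] [MeasurableSub₂ E] {𝓗 : Filtration ℝ≥0 mΩ} {T : ℝ≥0}
    {w w' : ℝ≥0 → Ω → E} {N : ι → ℝ≥0 → Ω → ℕ} {k : ℝ≥0 → Ω → ℝ≥0∞} {A : Set Ω}
    (hA : ∀ t, MeasurableSet[𝓗 t] A) (hAe : ∀ᵐ ω ∂P, ω ∈ A)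
    (hw : ∀ t ≤ T, Measurable[𝓗 t] (w t)) (hwc : ∀ ω ∈ A, IsCadlag fun t => w t ω)
    (hw' : ∀ t ≤ T, Measurable[𝓗 t] (w' t)) (hwc' : ∀ ω ∈ A, IsCadlag fun t => w' t ω)
    (hN : ∀ i t, Measurable[𝓗 t] (N i t))
    (hNm : ∀ ω ∈ A, ∀ i, Monotone fun t => N i t ω)
    (hNc : ∀ ω ∈ A, ∀ i, IsCadlag fun t => N i t ω)
    (hk : ∀ t ≤ T, MeasurableUpTo (𝓗 t) t k)
    (hkT : ∀ᵐ ω ∂P, timeLIntegral (fun s => k s ω) T < ∞)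
    (hleft : ∀ᵐ ω ∂P, ∀ t ≤ T, (∀ s < t, w s ω = w' s ω) → w t ω = w' t ω) :
    IsRestartingSystem P 𝓗 T (fun t => A.indicator (w t - w' t))
      (fun t => A.indicator fun ω i => N i t ω) k where
  adapted t ht := Measurable.indicator ((hw t ht).sub (hw' t ht)) (hA t)
  rightContinuous := continuousWithinAt_Ici_indicator fun ω hω t =>
    (hwc ω hω t).1.sub (hwc' ω hω t).1
  adapted_jumps t := (@measurable_pi_lambda _ _ _ (𝓗 t) _ _ fun i => hN i t).indicator (hA t)
  monotone_jumps ω := by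
    by_cases hω : ω ∈ A
    · simp only [Set.indicator_of_mem hω]
      exact fun s t hst i => hNm ω hω i hst
    · simpa only [Set.indicator_of_notMem hω] using monotone_const
  rightContinuous_jumps := continuousWithinAt_Ici_indicator fun ω hω t =>
    continuousWithinAt_pi.2 fun i => (hNc ω hω i t).1
  progressive_clock := hk
  clock_lt_top := hkT
  eq_zero_of_left := by
    filter_upwards [hAe, hleft] with ω hω hleft t ht hzero
    simp only [Set.indicator_of_mem hω, Pi.sub_apply, sub_eq_zero] at hzero ⊢
    exact hleft t ht hzero

namespace Model

variable {𝓜 : Model} {η : Kernel (ℝ≥0 × ℝ) ℝ} {T : ℝ≥0} {P₀ : Measure Ω}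
  {𝓕 𝓨 : Filtration ℝ≥0 mΩ} {W Y : ℝ≥0 → Ω → ℝ} {N : 𝓜.S × 𝓜.S → ℝ≥0 → Ω → ℕ}
  {X : ℝ≥0 → Ω → 𝓜.S} {π : ℝ≥0 → Ω → ProbabilityMeasure 𝓜.S} {ξ ξ' : ℝ≥0 → Ω → FiniteMeasure 𝓜.S}

lemma IsZakaiSolution.isRestartingSystem (h𝓨 : 𝓨 ≤ augmentation P 𝓕)
    (hN : IsPoissonFamily P 𝓕 N 𝓜.rate)
    (hpath : ∀ᵐ ω ∂P, 𝓜.IsRegularPath η T (fun s => X s ω) fun s => Y s ω)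
    (hξ : 𝓜.IsZakaiSolution P₀ 𝓨 T (𝓜.Wtilde W X Y π) Y η ξ)
    (hξ' : 𝓜.IsZakaiSolution P₀ 𝓨 T (𝓜.Wtilde W X Y π) Y η ξ')
    (hleft : ∀ᵐ ω ∂P, ∀ t ≤ T, (∀ s < t, ξ s ω = ξ' s ω) → ξ t ω = ξ' t ω)
    {A : Set Ω} (hAm : MeasurableSet A) (hA : ∀ᵐ ω ∂P, ω ∈ A)
    (hYA : ∀ t, MeasurableUpTo (augmentation P 𝓕 t) t fun s => A.indicator (Y s))
    (hAξ : ∀ ω ∈ A, IsCadlag fun t => ξ t ω) (hAξ' : ∀ ω ∈ A, IsCadlag fun t => ξ' t ω)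
    (hAN : ∀ ω ∈ A, ∀ ζ, Monotone (fun t => N ζ t ω) ∧ IsCadlag fun t => N ζ t ω) :
    IsRestartingSystem P (augmentation P 𝓕) T
      (fun t => A.indicator fun ω => pointMasses (ξ t ω) - pointMasses (ξ' t ω))
      (fun t => A.indicator fun ω ζ => N ζ t ω)
      (fun s ω => 𝓜.clock η s (A.indicator (Y s) ω)) := by
  have hA𝓗 (t) : MeasurableSet[augmentation P 𝓕 t] A := measurableSet_augmentation hAm hA t
  refine isRestartingSystem_indicator_sub hA𝓗 hA
    (fun t ht => measurable_pointMasses.comp ((hξ.adapted t ht).mono (h𝓨 t) le_rfl))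
    (fun ω hω => (hAξ ω hω).comp continuous_pointMasses)
    (fun t ht => measurable_pointMasses.comp ((hξ'.adapted t ht).mono (h𝓨 t) le_rfl))
    (fun ω hω => (hAξ' ω hω).comp continuous_pointMasses)
    (fun ζ t => (hN.adapted ζ t).mono (le_augmentation P 𝓕 t) le_rfl)
    (fun ω hω ζ => (hAN ω hω ζ).1) (fun ω hω ζ => (hAN ω hω ζ).2)
    (fun t _ => (hYA t).comp_time (𝓜.measurable_clock η)) ?_ ?_
  · filter_upwards [hA, hpath] with ω hω hpath
    simpa only [Set.indicator_of_mem hω] using hpath.clock_lt_top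
  · filter_upwards [hleft] with ω hleft t ht hlt
    exact congrArg _ (hleft t ht fun s hs => pointMasses_injective (hlt s hs))

section MassSystem

variable {φ : 𝓜.S → ℝ → ℝ} {B : 𝓜.S → ℝ} {H H' : 𝓜.S → ℕ → SimpleIntegrand 𝓨}
  {M M' : ℝ≥0 → Ω → 𝓜.S → ℝ}

lemma IsMassSystem.ae_eq_of_left (h : 𝓜.IsMassSystem P η T φ W X Y ξ H M)
    (h' : 𝓜.IsMassSystem P η T φ W X Y ξ' H' M')
    (hpath : ∀ᵐ ω ∂P, 𝓜.IsRegularPath η T (fun s => X s ω) fun s => Y s ω)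
    (hφ : ∀ u x, |φ u x| ≤ B u) :
    ∀ᵐ ω ∂P, ∀ t ≤ T, (∀ s < t, ξ s ω = ξ' s ω) → ξ t ω = ξ' t ω := by
  filter_upwards [h.solves, h'.solves, hpath] with ω h h' hpath t ht hlt
  exact pointMasses_injective (funext fun u => (h u).eq_of_left (h' u) hpath (hφ u) ht hlt)

lemma IsMassSystem.ae_eq_of_isRestartingSystem [IsProbabilityMeasure P]
    (h : 𝓜.IsMassSystem P η T φ W X Y ξ H M) (h' : 𝓜.IsMassSystem P η T φ W X Y ξ' H' M')
    (h𝓨 : 𝓨 ≤ augmentation P 𝓕) (hW : IsBrownianWrt P 𝓕 W)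
    (hjump : ∀ᵐ ω ∂P, ∀ s ≤ T, (∃ q < s, ∀ ζ, N ζ q ω = N ζ s ω) → jump (fun r => Y r ω) s = 0)
    (hpath : ∀ᵐ ω ∂P, 𝓜.IsRegularPath η T (fun s => X s ω) fun s => Y s ω)
    (hφ : ∀ u x, |φ u x| ≤ B u) {A : Set Ω} (hA : ∀ᵐ ω ∂P, ω ∈ A)
    (hYA : ∀ t, MeasurableUpTo (augmentation P 𝓕 t) t fun s => A.indicator (Y s))
    (hs : IsRestartingSystem P (augmentation P 𝓕) T
      (fun t => A.indicator fun ω => pointMasses (ξ t ω) - pointMasses (ξ' t ω))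
      (fun t => A.indicator fun ω ζ => N ζ t ω)
      (fun s ω => 𝓜.clock η s (A.indicator (Y s) ω))) :
    ∀ᵐ ω ∂P, ∀ t ≤ T, ξ t ω = ξ' t ω := by
  choose C hC using fun u => 𝓜.exists_enorm_linearDrift_le η (hφ u)
  have hzero := hs.ae_eq_zero hW.augmentation
    (h := fun u s ω => 𝓜.ratio s u (A.indicator (Y s) ω) *
      A.indicator (fun ω => pointMasses (ξ s ω) - pointMasses (ξ' s ω)) ω u)
    (H := fun u n => (H u n).ofLE h𝓨) (H' := fun u n => (H' u n).ofLE h𝓨)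
    (M := fun t ω => M t ω - M' t ω) (C := Finset.univ.sup C) ?_ ?_ ?_ ?_ ?_
  · filter_upwards [hA, hzero] with ω hω hzero t ht
    have hdiff := hzero t ht
    rw [Set.indicator_of_mem hω, sub_eq_zero] at hdiff
    exact pointMasses_injective hdiff
  · exact fun u t ht => ((hYA t).comp_time (𝓜.measurable_ratio u)).mul
      ((measurable_pi_apply u).comp (hs.measurableUpTo ht))
  · intro u s ω
    rw [enorm_mul, mul_pow]
    gcongr
    exacts [𝓜.enorm_ratio_sq_le_clock η s _ u, enorm_le_iff_norm_le.2 (norm_le_pi_norm _ u)]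
  · intro u
    filter_upwards [hA, hpath, h.solves, h.tendsto_value u, h'.tendsto_value u]
      with ω hω hpath hsolves hH hH'
    simp only [Set.indicator_of_mem hω, Pi.sub_apply, mul_sub]
    exact SimpleIntegrand.tendsto_value_sub ((hpath.measurable_ratio_state u).mul
      ((hsolves u).isCadlag.comp continuous_pointMasses).measurable.eval) hH hH'
  · intro u
    filter_upwards [h.tendsto_integral u, h'.tendsto_integral u] with ω hH hH' t ht
    exact (hH t ht).sub (hH' t ht)
  · filter_upwards [hA, h.solves, h'.solves, hpath, hjump] with ω hω h h' hpath hjump t ht hquiet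
    simp only [Set.indicator_of_mem hω, sub_eq_zero] at hquiet ⊢
    refine SolvesMassEquation.enorm_pi_sub_le h h' hpath hφ hC ht fun s hs hsj r hr => ?_
    refine pointMasses_injective ((hquiet s hs.2).resolve_right (fun ⟨q, hq, hqs⟩ => hsj ?_) r hr)
    exact hjump s (hs.2.trans ht) ⟨q, hq, congrFun hqs⟩

end MassSystem

theorem IsZakaiSolution.ae_eq [IsProbabilityMeasure P] (hP : P ≪ P₀)
    (h𝓨 : 𝓨 ≤ augmentation P 𝓕) (hW : IsBrownianWrt P 𝓕 W) (hN : IsPoissonFamily P 𝓕 N 𝓜.rate)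
    (hYa : ∀ t, Measurable[𝓕 t] (Y t)) (hYc : ∀ᵐ ω ∂P, IsCadlag fun t => Y t ω)
    (hjump : ∀ᵐ ω ∂P, ∀ s ≤ T, (∃ q < s, ∀ ζ, N ζ q ω = N ζ s ω) → jump (fun r => Y r ω) s = 0)
    (hpath : ∀ᵐ ω ∂P, 𝓜.IsRegularPath η T (fun s => X s ω) fun s => Y s ω)
    (hπ : ∀ᵐ ω ∂P, IsCadlag fun t => π t ω)
    (hξ : 𝓜.IsZakaiSolution P₀ 𝓨 T (𝓜.Wtilde W X Y π) Y η ξ)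
    (hξ' : 𝓜.IsZakaiSolution P₀ 𝓨 T (𝓜.Wtilde W X Y π) Y η ξ') :
    ∀ᵐ ω ∂P, ∀ t ≤ T, ξ t ω = ξ' t ω := by
  choose φ hφ hφu using exists_isTestFunction_eq_ite 𝓜.S
  choose B hB using fun u => (hφ u).bounded
  have hφB (u x) : |φ u x| ≤ B u := (hB u 0 x).1
  obtain ⟨H, M, h⟩ := hξ.exists_isMassSystem hP hpath hπ hW.brownian.cont hφ hφu
  obtain ⟨H', M', h'⟩ := hξ'.exists_isMassSystem hP hpath hπ hW.brownian.cont hφ hφu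
  obtain ⟨A, hA, hAm, hgood⟩ := (hYc.and ((hξ.cadlag.filter_mono hP.ae_le).and
    ((hξ'.cadlag.filter_mono hP.ae_le).and (ae_all_iff.2 fun ζ =>
      (hN.paths ζ).mono fun _ h => h.2)))).exists_measurable_mem
  have hYA (t) : MeasurableUpTo (augmentation P 𝓕 t) t fun s => A.indicator (Y s) :=
    measurableUpTo_indicator_of_isCadlag
      (fun s hs => (hYa s).mono ((𝓕.mono hs).trans (le_augmentation P 𝓕 t)) le_rfl)
      (measurableSet_augmentation hAm hA t) fun ω hω => (hgood ω hω).1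
  exact h.ae_eq_of_isRestartingSystem h' h𝓨 hW hjump hpath hφB hA hYA <|
    hξ.isRestartingSystem h𝓨 hN hpath hξ' (h.ae_eq_of_left h' hpath hφB) hAm hA hYA
      (fun ω hω => (hgood ω hω).2.1) (fun ω hω => (hgood ω hω).2.2.1)
      fun ω hω => (hgood ω hω).2.2.2

end Model

end PureJumpFilter

end

theorem mainTheorem7_general {Ω : Type*} [mΩ : MeasurableSpace Ω] (P : Measure Ω)
    [IsProbabilityMeasure P] (𝓕 : Filtration ℝ≥0 mΩ) (T : ℝ≥0) (𝓜 : PureJumpFilter.Model)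
    (W : ℝ≥0 → Ω → ℝ) (hW : PureJumpFilter.IsBrownianWrt P 𝓕 W)
    (N : 𝓜.S × 𝓜.S → ℝ≥0 → Ω → ℕ) (hN : PureJumpFilter.IsPoissonFamily P 𝓕 N 𝓜.rate)
    (X : ℝ≥0 → Ω → 𝓜.S) (Y : ℝ≥0 → Ω → ℝ) (hXY : 𝓜.IsSolution P 𝓕 T W N X Y)
    (hratio : ∀ u : 𝓜.S, ∀ᵐ ω ∂P,
      PureJumpFilter.timeLIntegral (fun s => ‖𝓜.ratio s u (Y s ω)‖ₑ ^ 2) T < ∞)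
    (hY : ∀ t, StronglyMeasurable (Y t)) (π : ℝ≥0 → Ω → ProbabilityMeasure 𝓜.S)
    (hπ : 𝓜.IsFilter P (PureJumpFilter.obsFiltration P Y hY) T X π)
    (η : Kernel (ℝ≥0 × ℝ) ℝ) (Ψ : ℝ≥0 → Ω → ℝ → ℝ)
    (hη : 𝓜.IsReference P (PureJumpFilter.obsFiltration P Y hY) T Y π η Ψ) (J : ℝ≥0 → Ω → ℝ)
    (hJ : PureJumpFilter.IsItoIntegral P (PureJumpFilter.obsFiltration P Y hY) T
      (𝓜.innovation W X Y π) (𝓜.filteredRatio Y π) J)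
    (hZ : AEMeasurable (𝓜.girsanovDensity Y π Ψ J T) P) (ξ ξ' : ℝ≥0 → Ω → FiniteMeasure 𝓜.S)
    (hξ : 𝓜.IsZakaiSolution (𝓜.referenceMeasure P T Y π Ψ J)
      (PureJumpFilter.obsFiltration P Y hY) T (𝓜.Wtilde W X Y π) Y η ξ)
    (hξ' : 𝓜.IsZakaiSolution (𝓜.referenceMeasure P T Y π Ψ J)
      (PureJumpFilter.obsFiltration P Y hY) T (𝓜.Wtilde W X Y π) Y η ξ') :
    ∀ᵐ ω ∂(𝓜.referenceMeasure P T Y π Ψ J), ∀ t ≤ T, ξ t ω = ξ' t ω := by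
  have hP := 𝓜.absolutelyContinuous_referenceMeasure hη hZ
  have hjump := 𝓜.ae_jump_eq_zero hW hN hXY hXY.ae_intervalIntegrable_b1
  have hleft : ∀ᵐ ω ∂P, ∀ᵐ s ∂volume.restrict (Set.Icc (0 : ℝ) T),
      Function.leftLim (fun r => Y r ω) s.toNNReal = Y s.toNNReal ω := by
    filter_upwards [hN.ae_monotone, hjump] with ω hN hjump
      using PureJumpFilter.ae_leftLim_eq hN hjump
  have hclock := PureJumpFilter.Model.ae_clock_lt_top (fun t => (hY t).measurable) hXY.cadlag_Y
    hleft hη.integrable hratio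
  have hpath : ∀ᵐ ω ∂P, 𝓜.IsRegularPath η T (fun s => X s ω) fun s => Y s ω := by
    filter_upwards [hXY.cadlag_X, hXY.cadlag_Y, hleft, hclock] with ω hX hY hleft hclock
      using ⟨hX.measurable, hY.measurable, hleft, hclock⟩
  exact (withDensity_absolutelyContinuous P _).ae_le <| hξ.ae_eq hP
    (PureJumpFilter.obsFiltration_le_augmentation hY hXY.adapted_Y) hW hN hXY.adapted_Y
    hXY.cadlag_Y hjump hpath hπ.cadlag hξ'

theorem mainTheorem7 {Ω : Type*} [mΩ : MeasurableSpace Ω] (P : Measure Ω) [IsProbabilityMeasure P]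
    (𝓕 : Filtration ℝ≥0 mΩ) (T : ℝ≥0) (hT : 0 < T) (𝓜 : PureJumpFilter.Model)
    (W : ℝ≥0 → Ω → ℝ) (hW : PureJumpFilter.IsBrownianWrt P 𝓕 W)
    (N : 𝓜.S × 𝓜.S → ℝ≥0 → Ω → ℕ) (hN : PureJumpFilter.IsPoissonFamily P 𝓕 N 𝓜.rate)
    -- existence and uniqueness for the system
    (X : ℝ≥0 → Ω → 𝓜.S) (Y : ℝ≥0 → Ω → ℝ) (hXY : 𝓜.IsSolution P 𝓕 T W N X Y)
    (hunique : ∀ X' Y', 𝓜.IsSolution P 𝓕 T W N X' Y' →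
      ∀ᵐ ω ∂P, ∀ t ≤ T, X' t ω = X t ω ∧ Y' t ω = Y t ω)
    (hint : 𝓜.IsIntegrableSystem P T X Y)
    -- the coefficients of the linear system between jump times are square integrable
    (hratio : ∀ u : 𝓜.S, ∀ᵐ ω ∂P,
      PureJumpFilter.timeLIntegral (fun s => ‖𝓜.ratio s u (Y s ω)‖ₑ ^ 2) T < ∞)
    -- the filter
    (hY : ∀ t, StronglyMeasurable (Y t))
    (π : ℝ≥0 → Ω → ProbabilityMeasure 𝓜.S)
    (hπ : 𝓜.IsFilter P (PureJumpFilter.obsFiltration P Y hY) T X π)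
    (hπratio : ∫⁻ ω, PureJumpFilter.timeLIntegral
      (fun s => (∫⁻ x, ‖𝓜.ratio s x (Y s ω)‖ₑ ∂(π s ω : Measure 𝓜.S)) ^ 2) T ∂P < ∞)
    -- the reference probability
    (η : Kernel (ℝ≥0 × ℝ) ℝ) (Ψ : ℝ≥0 → Ω → ℝ → ℝ)
    (hη : 𝓜.IsReference P (PureJumpFilter.obsFiltration P Y hY) T Y π η Ψ)
    (J : ℝ≥0 → Ω → ℝ)
    (hJ : PureJumpFilter.IsItoIntegral P (PureJumpFilter.obsFiltration P Y hY) T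
      (𝓜.innovation W X Y π) (𝓜.filteredRatio Y π) J)
    (hZ : Martingale (fun t => 𝓜.girsanovDensity Y π Ψ J (min t T))
      (PureJumpFilter.obsFiltration P Y hY) P)
    -- two strong solutions of the Zakai equation
    (ξ ξ' : ℝ≥0 → Ω → FiniteMeasure 𝓜.S)
    (hξ : 𝓜.IsZakaiSolution (𝓜.referenceMeasure P T Y π Ψ J)
      (PureJumpFilter.obsFiltration P Y hY) T (𝓜.Wtilde W X Y π) Y η ξ)
    (hξ' : 𝓜.IsZakaiSolution (𝓜.referenceMeasure P T Y π Ψ J)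
      (PureJumpFilter.obsFiltration P Y hY) T (𝓜.Wtilde W X Y π) Y η ξ') :
    ∀ᵐ ω ∂(𝓜.referenceMeasure P T Y π Ψ J), ∀ t ≤ T, ξ t ω = ξ' t ω :=
  mainTheorem7_general P 𝓕 T 𝓜 W hW N hN X Y hXY hratio hY π hπ η Ψ hη J hJ
    (by simpa only [min_self] using (hZ.integrable T).aemeasurable) ξ ξ' hξ hξ'
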